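/- **Setting (assumption (A)).** Let $\lambda_1,\dots,\lambda_n\in\mathbb C\setminus\{0\}$ have pairwise distinct arguments, let $c_1,\dots,c_n>0$, and put $\omega_{k,j}=(c_k+j)\lambda_k$ for $1\le k\le n$, $j=0,1,2,\dots$ (points equally spaced along finitely many rays; $c_k=1$ gives $\lambda_k,2\lambda_k,3\lambda_k,\dots$). For a small angle $\theta>0$ let $u_k=e^{i\theta}\lambda_k/|\lambda_k|$, let $\ell_{k,j}=\omega_{k,j}+u_k[0,\infty)$, and let the sheet $\Omega_\theta$ be $\mathbb C\setminus\bigcup_{k,j}\ell_{k,j}$. Write $$\|f\|_{1,\nu}=\sup_{\varphi}\int_0^{\infty e^{i\varphi}}|f(p)|e^{-\nu|p|}\,d|p| .$$ Let $F$ be a germ of an analytic function at $0$ and let $\nu>0$, $\theta_0>0$, $M<\infty$ be such that for every $\theta\in(0,\theta_0)$ the germ $F$ extends to an analytic function $F_\theta$ on $\Omega_\theta$, $\|F_\theta\|_{1,\nu}\le M$, and at each $\omega_{k,j}$ the function $F_\theta$ has a Frobenius-type convergent expansion: in a small disk cut along $\ell_{k,j}$ it is a finite sum of terms $A(p)(p-\omega_{k,j})^{\alpha}\log^m(p-\omega_{k,j})$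 with $A$ analytic in the disk, $\alpha\in\mathbb C$, $m\in\{0,1,2,\dots\}$. A *resurgent element* at $\omega$ with cut $\ell=\omega+u[0,\infty)$ is a function $f$ analytic in $\mathbb C\setminus\ell$ that can be continued analytically through both sides of the cut at each of its points other than $\omega$, that has a Frobenius-type expansion at $\omega$, with $(p-\omega)^mf(p)$ bounded near $\omega$ for some integer $m\ge0$, and that satisfies $f(p)=O(1/p)$ as $p\to\infty$ in $\mathbb C\setminus\ell$. **Theorem.** For every $\mu>\nu$ there are $\nu'>0$ and $\theta_1\in(0,\theta_0]$ such that for every $\theta\in(0,\theta_1)$ one has $\mu\cos\theta>\nu$ and the following holds with $\mu_k=\mu/u_k$ (so $|\mu_k|=\mu$ and $\mu_k u_k>0$). There are $d>0$, resurgent elements $\tilde F_{k,j}$ at $\omega_{k,j}$ with cut $\ell_{k,j}$, an entire function $G$ with $|G(p)|\le Ce^{\nu'|p|}$ on $\mathbb C$ for some constant $C$, and a function $g$ on $\{|x|>\nu'\}$ such that: 1. The closed half-strips $S_{k,j}=\{\omega_{k,j}+u_k(a+ib): a\ge -d,\ |b|\le d\}$ are pairwise disjoint, and for $p\notin S_{k,j}$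 $$\tilde F_{k,j}(p)=\frac1{2\pi i}\int_{\partial S_{k,j}}\frac{F_\theta(s)e^{-\mu_k s}}{s-p}\,ds ,$$ where the Hankel contour $\partial S_{k,j}$ is traversed with $S_{k,j}$ on its right. 2. With $F_{k,j}(p)=e^{\mu_k p}\tilde F_{k,j}(p)$, the difference $F_\theta-F_{k,j}$ extends analytically to a neighborhood of $\omega_{k,j}$, and $\|F_{k,j}\|_{1,\nu'}\le C'e^{-(\mu\cos\theta-\nu)|\omega_{k,j}|}$ with $C'$ independent of $k,j$. 3. $F_\theta=\sum_{k,j}e^{\mu_kp}\tilde F_{k,j}(p)+G(p)$, with locally uniform convergence on $\Omega_\theta$. 4. $g(x)=\sum_{m\ge0}G^{(m)}(0)\,x^{-m-1}$, convergent for $|x|>\nu'$. 5. For all real $\varphi$ and all $x\in\mathbb C$ with $\operatorname{Re}(xe^{i\varphi})>\nu'$, writing $\mathcal L_\varphi f(x)=\int_0^{\infty e^{i\varphi}}e^{-xp}f(p)\,dp$, the integrals below converge absolutely, $\mathcal L_\varphi G(x)=g(x)$, and $$\mathcal L_\varphi F_\theta(x)=\sum_{k,j}\mathcal L_\varphi[\tilde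 F_{k,j}](x-\mu_k)+g(x),$$ the (unconditional) sum being convergent. -/

import Mathlib

open Complex Set Filter Topology MeasureTheory
open scoped ENNReal NNReal

namespace Resurgence

/-- The closed ray `ω + u [0, ∞)`. -/
def cut (ω u : ℂ) : Set ℂ := {p | ∃ t : ℝ, 0 ≤ t ∧ p = ω + t * u}

/-- The singular points `(c k + j) lam k`, `j = 0, 1, 2, …`: on each of the finitely many rays
`lam k (0, ∞)` they are equally spaced with spacing `|lam k|`. (With `c k = 1` these are the
points `lam k, 2 lam k, 3 lam k, …`.) -/
noncomputable def sing {n : ℕ} (lam : Fin n → ℂ) (c : Fin n → ℝ) (i : Fin n × ℕ) : ℂ :=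
  ((c i.1 + i.2 : ℝ) : ℂ) * lam i.1

/-- The unit vector making the angle `θ` with `lam k`: the direction of the cuts issuing from the
singular points of the `k`-th ray. -/
noncomputable def dir {n : ℕ} (lam : Fin n → ℂ) (θ : ℝ) (k : Fin n) : ℂ :=
  exp (θ * I) * (lam k / (‖lam k‖ : ℂ))

/-- The first Riemann sheet: the plane with, from each singular point, a cut to infinity in the
direction that makes the angle `θ` with the ray of this point. -/
def sheet {n : ℕ} (lam : Fin n → ℂ) (c : Fin n → ℝ) (θ : ℝ) : Set ℂ :=
  {p | ∀ i : Fin n × ℕ, p ∉ cut (sing lam c i) (dir lam θ i.1)}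

/-- The exponentially weighted norm `sup_φ ∫_0^{∞ e^{iφ}} |f(p)| e^{-ν|p|} d|p|`. -/
noncomputable def rayNorm (ν : ℝ) (f : ℂ → ℂ) : ℝ≥0∞ :=
  ⨆ φ : ℝ, ∫⁻ r in Ioi (0 : ℝ), ‖f (r * exp (φ * I))‖ₑ * ENNReal.ofReal (Real.exp (-ν * r))

/-- `f` has at `ω` a Frobenius-type convergent expansion: in a disk around `ω`, cut along the
ray from `ω` in direction `u`, it is a finite sum of terms
`A(p) (p - ω)^α (log (p - ω))^m` with `A` holomorphic in the disk. The branches of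
the power and of the logarithm are those of the cut disk; changing them, or the constant factor
`-1/u`, only regroups the sum. -/
def IsFrobeniusAt (f : ℂ → ℂ) (ω u : ℂ) : Prop :=
  ∃ r : ℝ, 0 < r ∧ ∃ (N : ℕ) (α : Fin N → ℂ) (m : Fin N → ℕ) (A : Fin N → ℂ → ℂ),
    (∀ l, DifferentiableOn ℂ (A l) (Metric.ball ω r)) ∧
    ∀ p ∈ Metric.ball ω r, p ∉ cut ω u →
      f p = ∑ l, A l p * (-(p - ω) / u) ^ α l * log (-(p - ω) / u) ^ m l

/-- `f` can be continued analytically through both sides of the cut `ω + u (0, ∞)`. -/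
def ContinuesAcross (f : ℂ → ℂ) (ω u : ℂ) : Prop :=
  ∀ q ∈ cut ω u, q ≠ ω → ∃ r : ℝ, 0 < r ∧ ∃ fl fr : ℂ → ℂ,
    DifferentiableOn ℂ fl (Metric.ball q r) ∧ DifferentiableOn ℂ fr (Metric.ball q r) ∧
    (∀ p ∈ Metric.ball q r, 0 < ((p - ω) / u).im → f p = fl p) ∧
    (∀ p ∈ Metric.ball q r, ((p - ω) / u).im < 0 → f p = fr p)

/-- Resurgent (function) elements: on the first Riemann sheet, cut from `ω` in direction `u`,
`f` has no singularity other than `ω`; this one is regular, `(p - ω) ^ m f(p)` being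
bounded near `ω` for some `m`; and `f` decays at infinity, at least like `1 / p`. -/
structure IsElement (f : ℂ → ℂ) (ω u : ℂ) : Prop where
  holo : DifferentiableOn ℂ f (cut ω u)ᶜ
  across : ContinuesAcross f ω u
  regular : IsFrobeniusAt f ω u
  bounded : ∃ (m : ℕ) (r C : ℝ), 0 < r ∧
    ∀ p ∈ Metric.ball ω r, p ∉ cut ω u → ‖(p - ω) ^ m * f p‖ ≤ C
  decay : ∃ C R : ℝ, 0 < R ∧ ∀ p, p ∉ cut ω u → R ≤ ‖p‖ → ‖f p‖ ≤ C / ‖p‖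

/-- The closed half-strip of half-width `d` around the cut `ω + u [0, ∞)`, for `‖u‖ = 1`. -/
def halfStrip (ω u : ℂ) (d : ℝ) : Set ℂ :=
  {p | -d ≤ ((p - ω) / u).re ∧ |((p - ω) / u).im| ≤ d}

/-- The integral of `h` along the boundary of the half-strip, a Hankel contour around `ω`:
it comes from infinity with the half-strip on its right, turns around `ω`, and goes back to
infinity in the direction `u`. -/
noncomputable def hankel (h : ℂ → ℂ) (ω u : ℂ) (d : ℝ) : ℂ :=
  - (∫ t in Ioi (-d), h (ω + u * (t - d * I)) * u)
    + (∫ b in (-d)..d, h (ω + u * (-d + b * I)) * (u * I))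
    + ∫ t in Ioi (-d), h (ω + u * (t + d * I)) * u

/-- The Cauchy integral `(2πi)⁻¹ ∫ F(s) e^{-m s} / (s - p) ds` over the Hankel contour. -/
noncomputable def hankelCauchy (F : ℂ → ℂ) (m ω u : ℂ) (d : ℝ) (p : ℂ) : ℂ :=
  (2 * Real.pi * I)⁻¹ * hankel (fun s => F s * exp (-m * s) / (s - p)) ω u d

/-- The integrand of the Laplace transform along the ray `e^{iφ} (0, ∞)`. -/
noncomputable def laplaceIntegrand (φ : ℝ) (f : ℂ → ℂ) (x : ℂ) (r : ℝ) : ℂ :=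
  exp (-x * (r * exp (φ * I))) * f (r * exp (φ * I)) * exp (φ * I)

/-- The Laplace transform `∫_0^{∞ e^{iφ}} e^{-x p} f(p) dp`. -/
noncomputable def laplace (φ : ℝ) (f : ℂ → ℂ) (x : ℂ) : ℂ :=
  ∫ r in Ioi (0 : ℝ), laplaceIntegrand φ f x r

/-- Convergence of the integral defining the Laplace transform. -/
def LaplaceConverges (φ : ℝ) (f : ℂ → ℂ) (x : ℂ) : Prop :=
  IntegrableOn (laplaceIntegrand φ f x) (Ioi (0 : ℝ))

/-- Assumption (A) on a Borel-plane function. The function is a germ at `0` whose analytic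
continuation to the sheet with cuts at angle `θ` is `F θ`, for all small `θ > 0`: rotating the
cuts a little gives the continuation through their sides. -/
structure AssumptionA {n : ℕ} (lam : Fin n → ℂ) (c : Fin n → ℝ) (ν θ₀ : ℝ)
    (F : ℝ → ℂ → ℂ) : Prop where
  lam_ne : ∀ k, lam k ≠ 0
  c_pos : ∀ k, 0 < c k
  distinct_rays : Function.Injective fun k => arg (lam k)
  nu_pos : 0 < ν
  angle_pos : 0 < θ₀
  /-- the `F θ` are holomorphic on their sheets … -/
  holo : ∀ θ ∈ Ioo 0 θ₀, DifferentiableOn ℂ (F θ) (sheet lam c θ)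
  /-- … and continue the same germ at `0` -/
  germ : ∀ θ ∈ Ioo 0 θ₀, ∀ θ' ∈ Ioo 0 θ₀, F θ =ᶠ[𝓝 0] F θ'
  /-- at most exponential growth: the weighted `L¹` norm is finite -/
  growth : ∃ M : ℝ≥0, ∀ θ ∈ Ioo 0 θ₀, rayNorm ν (F θ) ≤ M
  /-- Frobenius-type expansion at each singularity -/
  frobenius : ∀ θ ∈ Ioo 0 θ₀, ∀ i : Fin n × ℕ,
    IsFrobeniusAt (F θ) (sing lam c i) (dir lam θ i.1)

end Resurgence

open Resurgence

/-! Every cut makes the angle θ with the ray that carries its starting point. Cuts from one ray are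
therefore parallel and distinct, cuts from different rays lie in disjoint narrow sectors, and any
two cuts are at least a fixed positive distance apart (`RayData.sep_le_norm_sub`). So half-strips of
one common half-width 2d around the cuts are disjoint. Outside the strips of half-width d, disks of
radius d fit into the sheet, and the weighted L¹ bound on rays becomes a pointwise bound |F(p)| ≤ K
e^{ν|p|} by the area mean value property (`norm_le_of_rayNorm_le`).

At a single cut, use the coordinate w = (s - ω)/u. There e^{-μ_k s} has modulus e^{-μ(|ω| cos θ + Re
w)}, so F e^{-μ_k s} decays like e^{-(μ-ν) Re w} along the strip, with a constant of order e^{-(μ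
cos θ - ν)|ω|}. Its Cauchy integral over the Hankel contour converges and is holomorphic off the
strip. Widening the contour from half-width d to 2d picks up the residue at p
(`stripCauchy_eq_add`); this continues the integral into the strip as F e^{-μ_k p} plus a function
holomorphic in the wider strip. Multiplied by e^{μ_k p}, the element thus carries exactly the
singularity of F on that cut. The constants are summable because the ω are equally spaced on
finitely many rays. Subtracting all summands leaves an entire function: in the strip around a cut F
itself cancels, and the remaining terms are holomorphic there. The same bounds give exponential
type.

The disk argument does not reach the cut, since no disk of fixed size fits next to it. Here the
whole family F_θ enters: on one side of a cut F_θ agrees with the function whose cuts are rotated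
slightly away from that side (`AssumptionA.eq_of_rotate`), by the identity theorem along a path from
0 inside both sheets. This gives the continuation through the cut. With a rotation angle inversely
proportional to the distance, it also gives the exponential bound right up to the cut
(`AssumptionA.exists_bound_near`), hence the decay O(1/p) of the elements.

For the Laplace transforms, the weighted L¹ norms of the summands are summable, so sum and integral
may be exchanged, and the factor e^{μ_k p} is a shift of x by μ_k. For the entire remainder, the
Taylor series is integrated term by term. -/

namespace Resurgence

/-! ### Cauchy-type integrals along a general curve. -/

section CauchyType

variable {α : Type*} [MeasurableSpace α] {m : Measure α} {h γ : α → ℂ}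

lemma integrable_cauchyType (hh : Integrable h m) (hγ : AEStronglyMeasurable γ m) {p : ℂ} {ε : ℝ}
    (hε : 0 < ε) (hp : ∀ᵐ t ∂m, ε ≤ ‖γ t - p‖) : Integrable (fun t => h t / (γ t - p)) m := by
  have hmeas : AEStronglyMeasurable (fun t => h t / (γ t - p)) m :=
    (hh.1.aemeasurable.div (hγ.aemeasurable.sub_const p)).aestronglyMeasurable
  refine (hh.norm.div_const ε).mono' hmeas ?_
  filter_upwards [hp] with t ht
  rw [norm_div]
  gcongr

lemma norm_cauchyType_le (hh : Integrable h m) {p : ℂ} {ε : ℝ}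
    (hε : 0 < ε) (hp : ∀ᵐ t ∂m, ε ≤ ‖γ t - p‖) :
    ‖∫ t, h t / (γ t - p) ∂m‖ ≤ (∫ t, ‖h t‖ ∂m) / ε := by
  rw [← integral_div]
  refine norm_integral_le_of_norm_le (hh.norm.div_const ε) ?_
  filter_upwards [hp] with t ht
  rw [norm_div]
  gcongr

/-- In |p| ≤ |γ - p| + |γ| the first term cancels the kernel and the second is paid for by a first
moment of h. This is the source of the decay O(1/|p|) of Cauchy integrals over unbounded contours.
-/
lemma norm_mul_norm_cauchyType_le (hh : Integrable h m)
    (hhγ : Integrable (fun t => ‖h t‖ * ‖γ t‖) m) {p : ℂ} {ε : ℝ}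
    (hε : 0 < ε) (hp : ∀ᵐ t ∂m, ε ≤ ‖γ t - p‖) :
    ‖p‖ * ‖∫ t, h t / (γ t - p) ∂m‖ ≤ ∫ t, (‖h t‖ + ‖h t‖ * ‖γ t‖ / ε) ∂m := by
  rw [← norm_mul, ← integral_const_mul]
  refine norm_integral_le_of_norm_le (hh.norm.add (hhγ.div_const ε)) ?_
  filter_upwards [hp] with t ht
  have h0 : 0 < ‖γ t - p‖ := hε.trans_le ht
  have h1 : ‖p‖ ≤ ‖γ t - p‖ + ‖γ t‖ := by
    have := norm_sub_le (γ t) (γ t - p)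
    rw [sub_sub_cancel] at this
    linarith
  calc ‖p * (h t / (γ t - p))‖ = ‖p‖ * (‖h t‖ / ‖γ t - p‖) := by rw [norm_mul, norm_div]
    _ ≤ (‖γ t - p‖ + ‖γ t‖) * (‖h t‖ / ‖γ t - p‖) := by gcongr
    _ = ‖h t‖ + ‖h t‖ * ‖γ t‖ / ‖γ t - p‖ := by field_simp
    _ ≤ _ := by gcongr

lemma differentiableAt_cauchyType (hh : Integrable h m) (hγ : AEStronglyMeasurable γ m) {p : ℂ}
    {ε : ℝ} (hε : 0 < ε) (hp : ∀ᵐ t ∂m, ε ≤ ‖γ t - p‖) :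
    DifferentiableAt ℂ (fun q => ∫ t, h t / (γ t - q) ∂m) p := by
  have hmeas : ∀ q, AEStronglyMeasurable (fun t => h t / (γ t - q)) m := fun q =>
    (hh.1.aemeasurable.div (hγ.aemeasurable.sub_const q)).aestronglyMeasurable
  have key : ∀ᵐ t ∂m, ∀ q ∈ Metric.ball p (ε / 2), ε / 2 ≤ ‖γ t - q‖ := by
    filter_upwards [hp] with t ht q hq
    have h1 : ‖γ t - p‖ ≤ ‖γ t - q‖ + ‖q - p‖ := by
      simpa using norm_add_le (γ t - q) (q - p)
    rw [mem_ball_iff_norm] at hq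
    linarith
  refine (hasDerivAt_integral_of_dominated_loc_of_deriv_le (μ := m) (x₀ := p)
    (F := fun q t => h t / (γ t - q)) (F' := fun q t => h t / (γ t - q) ^ 2)
    (bound := fun t => ‖h t‖ / (ε / 2) ^ 2) (s := Metric.ball p (ε / 2))
    (Metric.ball_mem_nhds p (by positivity)) (Eventually.of_forall hmeas)
    (integrable_cauchyType hh hγ hε hp) ?_ ?_ (hh.norm.div_const _) ?_).2.differentiableAt
  · exact (hh.1.aemeasurable.div ((hγ.aemeasurable.sub_const p).pow_const 2)).aestronglyMeasurable
  · filter_upwards [key] with t ht q hq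
    have := ht q hq
    rw [norm_div, norm_pow]
    gcongr
  · filter_upwards [key] with t ht q hq
    have h0 : γ t - q ≠ 0 := norm_pos_iff.1 ((half_pos hε).trans_le (ht q hq))
    have h1 : HasDerivAt (fun q => γ t - q) (-1) q := by
      simpa using (hasDerivAt_id q).const_sub (γ t)
    exact ((hasDerivAt_const q (h t)).div h1 h0).congr_deriv (by simp)

end CauchyType

/-! ### Cauchy's theorem in a half-infinite strip and the winding number of a rectangle. -/

section Rectangle

/-- Cauchy's theorem for a half-infinite horizontal strip. -/
lemma integral_boundary_halfStrip_eq_zero {ψ : ℂ → ℂ} {x y₁ y₂ B ε : ℝ} (hε : 0 < ε) (hy : y₁ ≤ y₂)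
    (hψ : DifferentiableOn ℂ ψ {w | x ≤ w.re ∧ y₁ ≤ w.im ∧ w.im ≤ y₂})
    (hB : ∀ w : ℂ, x ≤ w.re → y₁ ≤ w.im → w.im ≤ y₂ → ‖ψ w‖ ≤ B * Real.exp (-ε * w.re)) :
    (∫ t in Ioi x, ψ (t + y₁ * I)) - (∫ t in Ioi x, ψ (t + y₂ * I))
      - I * (∫ b in y₁..y₂, ψ (x + b * I)) = 0 := by
  have hint : ∀ y, y₁ ≤ y → y ≤ y₂ → IntegrableOn (fun t : ℝ => ψ (t + y * I)) (Ioi x) := by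
    intro y h1 h2
    have hexp : IntegrableOn (fun t : ℝ => B * Real.exp (-ε * t)) (Ioi x) :=
      (exp_neg_integrableOn_Ioi x hε).const_mul B
    refine hexp.mono' ?_ ?_
    · refine ContinuousOn.aestronglyMeasurable ?_ measurableSet_Ioi
      refine hψ.continuousOn.comp (by fun_prop) ?_
      intro t ht
      simpa using ⟨le_of_lt ht, h1, h2⟩
    · refine (ae_restrict_iff' measurableSet_Ioi).2 (Eventually.of_forall fun t ht => ?_)
      simpa using hB (t + y * I) (by simpa using le_of_lt ht) (by simpa using h1) (by simpa using h2)
  have hlim : ∀ y, y₁ ≤ y → y ≤ y₂ → Tendsto (fun T : ℝ => ∫ t in x..T, ψ (t + y * I)) atTop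
      (𝓝 (∫ t in Ioi x, ψ (t + y * I))) := fun y h1 h2 =>
    intervalIntegral_tendsto_integral_Ioi x (hint y h1 h2) tendsto_id
  have hright : Tendsto (fun T : ℝ => I * ∫ b in y₁..y₂, ψ (T + b * I)) atTop (𝓝 0) := by
    have h0 : Tendsto (fun T : ℝ => B * Real.exp (-ε * T) * |y₂ - y₁|) atTop (𝓝 0) := by
      have : Tendsto (fun T : ℝ => Real.exp (-ε * T)) atTop (𝓝 0) := by
        refine Real.tendsto_exp_atBot.comp ?_
        exact tendsto_id.const_mul_atTop_of_neg (by linarith)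
      simpa using (this.const_mul B).mul_const |y₂ - y₁|
    refine squeeze_zero_norm' ?_ h0
    filter_upwards [eventually_ge_atTop x] with T hT
    rw [norm_mul, norm_I, one_mul]
    refine intervalIntegral.norm_integral_le_of_norm_le_const fun b hb => ?_
    rw [uIoc_of_le hy] at hb
    simpa using hB (T + b * I) (by simpa using hT) (by simpa using hb.1.le) (by simpa using hb.2)
  have hsum := ((hlim y₁ le_rfl hy).sub (hlim y₂ hy le_rfl)).add hright |>.sub
    (tendsto_const_nhds (x := I * ∫ b in y₁..y₂, ψ (x + b * I)))
  rw [add_zero] at hsum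
  refine tendsto_nhds_unique hsum (tendsto_const_nhds.congr' ?_)
  filter_upwards [eventually_ge_atTop x] with T hT
  have := integral_boundary_rect_eq_zero_of_differentiableOn ψ (x + y₁ * I) (T + y₂ * I) (by
    refine hψ.mono ?_
    intro w hw
    rw [mem_reProdIm] at hw
    simp [uIcc_of_le hT, uIcc_of_le hy] at hw
    exact ⟨hw.1.1, hw.2.1, hw.2.2⟩)
  simp at this
  simp [← this]

/-- The factor σ turns the segment away from the negative axis, so that a principal logarithm is a
primitive along it; it cancels in the derivative. -/
lemma intervalIntegral_inv_sub_eq_log (z v : ℂ) (a b : ℝ) (σ : ℂ) (hσ : σ ≠ 0)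
    (h : ∀ t ∈ uIcc a b, σ * (z + t * v) ∈ slitPlane) :
    ∫ t in a..b, v / (z + t * v) = log (σ * (z + b * v)) - log (σ * (z + a * v)) := by
  refine intervalIntegral.integral_eq_sub_of_hasDerivAt (f := fun t : ℝ => log (σ * (z + t * v)))
    (fun t ht => ?_) ?_
  · have h1 : HasDerivAt (fun t : ℝ => σ * (z + t * v)) (σ * v) t := by
      have : HasDerivAt (fun t : ℝ => (t : ℂ)) 1 t := Complex.ofRealCLM.hasDerivAt
      simpa using ((this.mul_const v).const_add z).const_mul σ
    have := h1.clog_real (h t ht)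
    rwa [mul_div_mul_left _ _ hσ] at this
  · refine ContinuousOn.intervalIntegrable ?_
    refine continuousOn_const.div (by fun_prop) ?_
    intro t ht h0
    have := h t ht
    rw [h0, mul_zero] at this
    exact zero_notMem_slitPlane this

/-- The winding number of the boundary of a rectangle around an interior point. -/
lemma integral_boundary_rect_inv_sub {x₁ x₂ y₁ y₂ : ℝ} {w₀ : ℂ} (hx₁ : x₁ < w₀.re)
    (hx₂ : w₀.re < x₂) (hy₁ : y₁ < w₀.im) (hy₂ : w₀.im < y₂) :
    (∫ t in x₁..x₂, 1 / ((t + y₁ * I) - w₀)) - (∫ t in x₁..x₂, 1 / ((t + y₂ * I) - w₀))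
      + I * (∫ b in y₁..y₂, 1 / ((x₂ + b * I) - w₀))
      - I * (∫ b in y₁..y₂, 1 / ((x₁ + b * I) - w₀)) = 2 * Real.pi * I := by
  have hbot : ∫ t in x₁..x₂, 1 / ((t + y₁ * I) - w₀)
      = log (x₂ + y₁ * I - w₀) - log (x₁ + y₁ * I - w₀) := by
    have := intervalIntegral_inv_sub_eq_log (y₁ * I - w₀) 1 x₁ x₂ 1 one_ne_zero
      (fun t _ => Or.inr <| by simp; linarith)
    convert! this using 2
    · ext t; ring_nf
    · ring_nf
    · ring_nf
  have htop : ∫ t in x₁..x₂, 1 / ((t + y₂ * I) - w₀)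
      = log (x₂ + y₂ * I - w₀) - log (x₁ + y₂ * I - w₀) := by
    have := intervalIntegral_inv_sub_eq_log (y₂ * I - w₀) 1 x₁ x₂ 1 one_ne_zero
      (fun t _ => Or.inr <| by simp; linarith)
    convert! this using 2
    · ext t; ring_nf
    · ring_nf
    · ring_nf
  have hright : I * ∫ b in y₁..y₂, 1 / ((x₂ + b * I) - w₀)
      = log (x₂ + y₂ * I - w₀) - log (x₂ + y₁ * I - w₀) := by
    have := intervalIntegral_inv_sub_eq_log (x₂ - w₀) I y₁ y₂ 1 one_ne_zero
      (fun t _ => Or.inl <| by simp; linarith)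
    rw [← intervalIntegral.integral_const_mul]
    convert! this using 2
    · ext t; ring_nf
    · ring_nf
    · ring_nf
  have hleft : I * ∫ b in y₁..y₂, 1 / ((x₁ + b * I) - w₀)
      = log (-(x₁ + y₂ * I - w₀)) - log (-(x₁ + y₁ * I - w₀)) := by
    have := intervalIntegral_inv_sub_eq_log (x₁ - w₀) I y₁ y₂ (-1) (by simp)
      (fun t _ => Or.inl <| by simp; linarith)
    rw [← intervalIntegral.integral_const_mul]
    convert! this using 2
    · ext t; ring_nf
    · ring_nf
    · ring_nf
  -- On the left side the primitive is log(-z), as the side crosses the branch cut of log z. Its two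
  -- ends differ from log z by opposite multiples of πi, and these add up to 2πi; everything else
  -- telescopes.
  have e1 : log (-(x₁ + y₂ * I - w₀)) = log (x₁ + y₂ * I - w₀) - Real.pi * I := by
    unfold log
    rw [norm_neg, arg_neg_eq_arg_sub_pi_of_im_pos (by simp; linarith)]
    push_cast; ring
  have e2 : log (-(x₁ + y₁ * I - w₀)) = log (x₁ + y₁ * I - w₀) + Real.pi * I := by
    unfold log
    rw [norm_neg, arg_neg_eq_arg_add_pi_of_im_neg (by simp; linarith)]
    push_cast; ring
  rw [hbot, htop, hright, hleft, e1, e2]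
  ring

end Rectangle

/-! ### Cauchy integrals over the boundary of a half-strip. -/

/-- The boundary of the half-strip of half-width `d` around `[0, ∞)`. -/
def stripFrame (d : ℝ) : Set ℂ :=
  {w | -d ≤ w.re ∧ |w.im| ≤ d ∧ ¬(-d < w.re ∧ |w.im| < d)}

/-- The integral over the boundary of the half-strip of half-width `d` around `[0, ∞)`. -/
noncomputable def stripInt (ψ : ℂ → ℂ) (d : ℝ) : ℂ :=
  -(∫ t in Ioi (-d), ψ (t - d * I)) + I * (∫ b in (-d)..d, ψ (-d + b * I))
    + ∫ t in Ioi (-d), ψ (t + d * I)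

/-- The Cauchy integral over the boundary of the half-strip of half-width `d` around `[0, ∞)`. -/
noncomputable def stripCauchy (Φ : ℂ → ℂ) (d : ℝ) (w : ℂ) : ℂ :=
  (2 * Real.pi * I)⁻¹ * stripInt (fun s => Φ s / (s - w)) d

section Frame

variable {Φ : ℂ → ℂ} {d B ε : ℝ}

lemma lower_mem_stripFrame (hd : 0 < d) {t : ℝ} (ht : -d ≤ t) :
    (t - d * I : ℂ) ∈ stripFrame d := by
  simp [stripFrame, abs_of_pos hd, ht]

lemma upper_mem_stripFrame (hd : 0 < d) {t : ℝ} (ht : -d ≤ t) :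
    (t + d * I : ℂ) ∈ stripFrame d := by
  simp [stripFrame, abs_of_pos hd, ht]

lemma left_mem_stripFrame {b : ℝ} (hb : |b| ≤ d) :
    (-d + b * I : ℂ) ∈ stripFrame d := by
  simp [stripFrame, hb]

lemma bound_nonneg (hd : 0 < d)
    (hB : ∀ w ∈ stripFrame d, ‖Φ w‖ ≤ B * Real.exp (-ε * w.re)) : 0 ≤ B := by
  have := (norm_nonneg _).trans (hB _ (left_mem_stripFrame (d := d) (b := 0) (by simpa using hd.le)))
  exact nonneg_of_mul_nonneg_left this (Real.exp_pos _)

lemma integrableOn_lower (hd : 0 < d) (hε : 0 < ε) (hc : ContinuousOn Φ (stripFrame d))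
    (hB : ∀ w ∈ stripFrame d, ‖Φ w‖ ≤ B * Real.exp (-ε * w.re)) :
    IntegrableOn (fun t : ℝ => Φ (t - d * I)) (Ioi (-d)) := by
  refine ((exp_neg_integrableOn_Ioi (-d) hε).const_mul B).mono' ?_ ?_
  · exact (hc.comp (by fun_prop) fun t ht =>
      lower_mem_stripFrame hd (le_of_lt ht)).aestronglyMeasurable measurableSet_Ioi
  · refine (ae_restrict_iff' measurableSet_Ioi).2 (Eventually.of_forall fun t ht => ?_)
    simpa using hB _ (lower_mem_stripFrame hd (le_of_lt ht))

lemma integrableOn_upper (hd : 0 < d) (hε : 0 < ε) (hc : ContinuousOn Φ (stripFrame d))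
    (hB : ∀ w ∈ stripFrame d, ‖Φ w‖ ≤ B * Real.exp (-ε * w.re)) :
    IntegrableOn (fun t : ℝ => Φ (t + d * I)) (Ioi (-d)) := by
  refine ((exp_neg_integrableOn_Ioi (-d) hε).const_mul B).mono' ?_ ?_
  · exact (hc.comp (by fun_prop) fun t ht =>
      upper_mem_stripFrame hd (le_of_lt ht)).aestronglyMeasurable measurableSet_Ioi
  · refine (ae_restrict_iff' measurableSet_Ioi).2 (Eventually.of_forall fun t ht => ?_)
    simpa using hB _ (upper_mem_stripFrame hd (le_of_lt ht))

lemma continuousOn_left (hc : ContinuousOn Φ (stripFrame d)) :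
    ContinuousOn (fun b : ℝ => Φ (-d + b * I)) (Icc (-d) d) :=
  hc.comp (by fun_prop) fun _ hb => left_mem_stripFrame (abs_le.2 hb)

lemma integrableOn_left (hc : ContinuousOn Φ (stripFrame d)) :
    IntegrableOn (fun b : ℝ => Φ (-d + b * I)) (Ioc (-d) d) :=
  (continuousOn_left hc).integrableOn_Icc.mono_set Ioc_subset_Icc_self

variable {w : ℂ} {ρ : ℝ}

lemma ae_lower (hd : 0 < d) (hw : ∀ s ∈ stripFrame d, ρ ≤ ‖s - w‖) :
    ∀ᵐ t : ℝ ∂volume.restrict (Ioi (-d)), ρ ≤ ‖(t - d * I : ℂ) - w‖ :=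
  (ae_restrict_iff' measurableSet_Ioi).2 (Eventually.of_forall fun _ ht =>
    hw _ (lower_mem_stripFrame hd (le_of_lt ht)))

lemma ae_upper (hd : 0 < d) (hw : ∀ s ∈ stripFrame d, ρ ≤ ‖s - w‖) :
    ∀ᵐ t : ℝ ∂volume.restrict (Ioi (-d)), ρ ≤ ‖(t + d * I : ℂ) - w‖ :=
  (ae_restrict_iff' measurableSet_Ioi).2 (Eventually.of_forall fun _ ht =>
    hw _ (upper_mem_stripFrame hd (le_of_lt ht)))

lemma ae_left (hw : ∀ s ∈ stripFrame d, ρ ≤ ‖s - w‖) :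
    ∀ᵐ b : ℝ ∂volume.restrict (Ioc (-d) d), ρ ≤ ‖(-d + b * I : ℂ) - w‖ :=
  (ae_restrict_iff' measurableSet_Ioc).2 (Eventually.of_forall fun _ hb =>
    hw _ (left_mem_stripFrame (abs_le.2 ⟨hb.1.le, hb.2⟩)))

lemma aesm_of_continuous {γ : ℝ → ℂ} (hγ : Continuous γ) (s : Set ℝ) :
    AEStronglyMeasurable γ (volume.restrict s) := hγ.aestronglyMeasurable

lemma differentiableAt_stripCauchy (hd : 0 < d) (hε : 0 < ε)
    (hc : ContinuousOn Φ (stripFrame d))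
    (hB : ∀ w ∈ stripFrame d, ‖Φ w‖ ≤ B * Real.exp (-ε * w.re)) (hρ : 0 < ρ)
    (hw : ∀ s ∈ stripFrame d, ρ ≤ ‖s - w‖) :
    DifferentiableAt ℂ (stripCauchy Φ d) w := by
  have h1 := differentiableAt_cauchyType (integrableOn_lower hd hε hc hB)
    (aesm_of_continuous (by fun_prop) _) hρ (ae_lower hd hw)
  have h2 := differentiableAt_cauchyType (integrableOn_left hc)
    (aesm_of_continuous (by fun_prop) _) hρ (ae_left hw)
  have h3 := differentiableAt_cauchyType (integrableOn_upper hd hε hc hB)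
    (aesm_of_continuous (by fun_prop) _) hρ (ae_upper hd hw)
  have h4 := ((h1.neg.add (h2.const_mul I)).add h3).const_mul (2 * Real.pi * I)⁻¹
  refine h4.congr_of_eventuallyEq (Eventually.of_forall fun q => ?_)
  simp [stripCauchy, stripInt, intervalIntegral.integral_of_le (show -d ≤ d by linarith)]

lemma norm_two_pi_I_inv_le : ‖(2 * Real.pi * I : ℂ)⁻¹‖ ≤ 1 := by
  rw [norm_inv, norm_mul, norm_mul, norm_I, mul_one]
  refine inv_le_one_of_one_le₀ ?_
  have := Real.pi_gt_three
  simp only [Complex.norm_ofNat, norm_real, Real.norm_eq_abs, abs_of_pos Real.pi_pos]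
  linarith

lemma norm_stripCauchy_le_aux {a b c : ℂ} {x y z : ℝ} (ha : ‖a‖ ≤ x) (hb : ‖b‖ ≤ y) (hc : ‖c‖ ≤ z) :
    ‖(2 * Real.pi * I : ℂ)⁻¹ * (-a + I * b + c)‖ ≤ x + y + z := by
  rw [norm_mul]
  have h1 : ‖-a + I * b + c‖ ≤ x + y + z := by
    refine (norm_add₃_le).trans ?_
    rw [norm_neg, norm_mul, norm_I, one_mul]
    gcongr
  calc _ ≤ 1 * (x + y + z) := by
        gcongr
        exact norm_two_pi_I_inv_le
    _ = _ := one_mul _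

lemma norm_stripCauchy_le (hd : 0 < d) (hε : 0 < ε)
    (hc : ContinuousOn Φ (stripFrame d))
    (hB : ∀ w ∈ stripFrame d, ‖Φ w‖ ≤ B * Real.exp (-ε * w.re)) (hρ : 0 < ρ)
    (hw : ∀ s ∈ stripFrame d, ρ ≤ ‖s - w‖) :
    ‖stripCauchy Φ d w‖ ≤ 2 * Real.exp (ε * d) * (1 / ε + d) / ρ * B := by
  have hB0 := bound_nonneg hd hB
  have hI : ∫ t in Ioi (-d), B * Real.exp (-ε * t) = B * (Real.exp (ε * d) / ε) := by
    rw [integral_const_mul, integral_exp_mul_Ioi (by linarith : -ε < 0)]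
    field_simp
  have hexp := (exp_neg_integrableOn_Ioi (-d) hε).const_mul B
  have h1 : ‖∫ t in Ioi (-d), Φ (t - d * I) / ((t - d * I) - w)‖ ≤ B * (Real.exp (ε * d) / ε) / ρ := by
    refine (norm_cauchyType_le (integrableOn_lower hd hε hc hB) hρ (ae_lower hd hw)).trans ?_
    gcongr
    rw [← hI]
    refine setIntegral_mono_on (integrableOn_lower hd hε hc hB).norm hexp measurableSet_Ioi ?_
    intro t ht
    simpa using hB _ (lower_mem_stripFrame hd (le_of_lt ht))
  have h3 : ‖∫ t in Ioi (-d), Φ (t + d * I) / ((t + d * I) - w)‖ ≤ B * (Real.exp (ε * d) / ε) / ρ := by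
    refine (norm_cauchyType_le (integrableOn_upper hd hε hc hB) hρ (ae_upper hd hw)).trans ?_
    gcongr
    rw [← hI]
    refine setIntegral_mono_on (integrableOn_upper hd hε hc hB).norm hexp measurableSet_Ioi ?_
    intro t ht
    simpa using hB _ (upper_mem_stripFrame hd (le_of_lt ht))
  have h2 : ‖∫ b in (-d)..d, Φ (-d + b * I) / ((-d + b * I) - w)‖
      ≤ B * Real.exp (ε * d) / ρ * |d - -d| := by
    refine intervalIntegral.norm_integral_le_of_norm_le_const fun b hb => ?_
    rw [uIoc_of_le (by linarith)] at hb
    have hm : (-d + b * I : ℂ) ∈ stripFrame d := left_mem_stripFrame (abs_le.2 ⟨hb.1.le, hb.2⟩)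
    rw [norm_div]
    have := hB _ hm
    simp only [add_re, neg_re, ofReal_re, mul_re, I_re, mul_zero, ofReal_im, I_im, mul_one,
      sub_self, add_zero, neg_mul, mul_neg, neg_neg] at this
    gcongr
    exact hw _ hm
  refine (norm_stripCauchy_le_aux h1 h2 h3).trans (le_of_eq ?_)
  rw [sub_neg_eq_add, abs_of_pos (by linarith)]
  field_simp
  ring

lemma exists_norm_mul_stripCauchy_le (hd : 0 < d) (hε : 0 < ε)
    (hc : ContinuousOn Φ (stripFrame d))
    (hB : ∀ w ∈ stripFrame d, ‖Φ w‖ ≤ B * Real.exp (-ε * w.re)) (hρ : 0 < ρ) :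
    ∃ C, ∀ w, (∀ s ∈ stripFrame d, ρ ≤ ‖s - w‖) → ‖w‖ * ‖stripCauchy Φ d w‖ ≤ C := by
  have hB0 := bound_nonneg hd hB
  -- Half of the decay rate is spent on the factor |s|, since t + 3d ≤ (2/ε) e^{(ε/2)(t + 3d)}; the
  -- other half keeps the first moment integrable.
  have hdec : ∀ t : ℝ, -d ≤ t → ∀ s : ℂ, ‖s‖ ≤ |t| + d →
      B * Real.exp (-ε * t) * ‖s‖ ≤ B * (2 / ε * Real.exp (ε / 2 * (3 * d))) * Real.exp (-(ε / 2) * t) := by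
    intro t ht s hs
    have h1 : |t| ≤ t + 2 * d := abs_le.2 ⟨by linarith, by linarith⟩
    have h2 : ε / 2 * (t + 3 * d) ≤ Real.exp (ε / 2 * (t + 3 * d)) :=
      (by linarith : ε / 2 * (t + 3 * d) ≤ ε / 2 * (t + 3 * d) + 1).trans (Real.add_one_le_exp _)
    have h3 : ‖s‖ ≤ 2 / ε * Real.exp (ε / 2 * (t + 3 * d)) := by
      calc ‖s‖ ≤ t + 3 * d := by linarith
        _ = 2 / ε * (ε / 2 * (t + 3 * d)) := by field_simp
        _ ≤ _ := by gcongr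
    calc B * Real.exp (-ε * t) * ‖s‖
        ≤ B * Real.exp (-ε * t) * (2 / ε * Real.exp (ε / 2 * (t + 3 * d))) := by gcongr
      _ = B * (2 / ε) * (Real.exp (-ε * t) * Real.exp (ε / 2 * (t + 3 * d))) := by ring
      _ = B * (2 / ε) * (Real.exp (ε / 2 * (3 * d)) * Real.exp (-(ε / 2) * t)) := by
        rw [← Real.exp_add, ← Real.exp_add]; ring_nf
      _ = _ := by ring
  have hexp : IntegrableOn (fun t : ℝ =>
      B * (2 / ε * Real.exp (ε / 2 * (3 * d))) * Real.exp (-(ε / 2) * t)) (Ioi (-d)) :=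
    (exp_neg_integrableOn_Ioi (-d) (half_pos hε)).const_mul _
  have g1 : Integrable (fun t : ℝ => ‖Φ (t - d * I)‖ * ‖(t - d * I : ℂ)‖)
      (volume.restrict (Ioi (-d))) := by
    refine hexp.mono' ((integrableOn_lower hd hε hc hB).1.norm.mul
      (aesm_of_continuous (by fun_prop) _).norm) ?_
    refine (ae_restrict_iff' measurableSet_Ioi).2 (Eventually.of_forall fun t ht => ?_)
    have h1 := hB _ (lower_mem_stripFrame hd (le_of_lt ht))
    have h2 : ‖(t - d * I : ℂ)‖ ≤ |t| + d := by
      refine (norm_sub_le _ _).trans ?_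
      simp [abs_of_pos hd]
    rw [Real.norm_of_nonneg (by positivity)]
    refine le_trans ?_ (hdec t (le_of_lt ht) _ h2)
    gcongr
    simpa using h1
  have g3 : Integrable (fun t : ℝ => ‖Φ (t + d * I)‖ * ‖(t + d * I : ℂ)‖)
      (volume.restrict (Ioi (-d))) := by
    refine hexp.mono' ((integrableOn_upper hd hε hc hB).1.norm.mul
      (aesm_of_continuous (by fun_prop) _).norm) ?_
    refine (ae_restrict_iff' measurableSet_Ioi).2 (Eventually.of_forall fun t ht => ?_)
    have h1 := hB _ (upper_mem_stripFrame hd (le_of_lt ht))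
    have h2 : ‖(t + d * I : ℂ)‖ ≤ |t| + d := by
      refine (norm_add_le _ _).trans ?_
      simp [abs_of_pos hd]
    rw [Real.norm_of_nonneg (by positivity)]
    refine le_trans ?_ (hdec t (le_of_lt ht) _ h2)
    gcongr
    simpa using h1
  have g2 : Integrable (fun b : ℝ => ‖Φ (-d + b * I)‖ * ‖(-d + b * I : ℂ)‖)
      (volume.restrict (Ioc (-d) d)) := by
    have : ContinuousOn (fun b : ℝ => ‖Φ (-d + b * I)‖ * ‖(-d + b * I : ℂ)‖) (Icc (-d) d) :=
      (continuousOn_left hc).norm.mul (by fun_prop)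
    exact this.integrableOn_Icc.mono_set Ioc_subset_Icc_self
  refine ⟨(∫ t in Ioi (-d), (‖Φ (t - d * I)‖ + ‖Φ (t - d * I)‖ * ‖(t - d * I : ℂ)‖ / ρ))
    + (∫ b in Ioc (-d) d, (‖Φ (-d + b * I)‖ + ‖Φ (-d + b * I)‖ * ‖(-d + b * I : ℂ)‖ / ρ))
    + ∫ t in Ioi (-d), (‖Φ (t + d * I)‖ + ‖Φ (t + d * I)‖ * ‖(t + d * I : ℂ)‖ / ρ),
    fun w hw => ?_⟩
  have h1 := norm_mul_norm_cauchyType_le (integrableOn_lower hd hε hc hB) g1 hρ (ae_lower hd hw)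
  have h2 := norm_mul_norm_cauchyType_le (integrableOn_left hc) g2 hρ (ae_left hw)
  have h3 := norm_mul_norm_cauchyType_le (integrableOn_upper hd hε hc hB) g3 hρ (ae_upper hd hw)
  rw [← norm_mul] at h1 h2 h3
  have := norm_stripCauchy_le_aux h1 h2 h3
  refine le_trans (le_of_eq ?_) this
  rw [stripCauchy, stripInt, intervalIntegral.integral_of_le (show -d ≤ d by linarith), ← norm_mul]
  congr 1
  ring

end Frame

/-! ### Deformation of the contour and the jump of the Cauchy integral. -/

/-- The closed strip of half-width `D` without the open strip of half-width `d`. -/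
def stripRegion (d D : ℝ) : Set ℂ :=
  {w | -D ≤ w.re ∧ |w.im| ≤ D ∧ ¬(-d < w.re ∧ |w.im| < d)}

lemma stripFrame_inner_subset {d D : ℝ} (hdD : d ≤ D) : stripFrame d ⊆ stripRegion d D :=
  fun _ hw => ⟨by linarith [hw.1], hw.2.1.trans hdD, hw.2.2⟩

lemma stripFrame_outer_subset {d D : ℝ} (hdD : d ≤ D) : stripFrame D ⊆ stripRegion d D :=
  fun _ hw => ⟨hw.1, hw.2.1, fun h => hw.2.2 ⟨by linarith [h.1], h.2.trans_le hdD⟩⟩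

/-- The region between the two boundaries is cut into an upper and a lower half-infinite strip and a
rectangle on the left; Cauchy's theorem holds in each of them, and the inner sides cancel. -/
lemma stripInt_eq_of_differentiableOn {ψ : ℂ → ℂ} {d D B ε : ℝ} (hd : 0 < d) (hdD : d < D)
    (hε : 0 < ε) (hψ : DifferentiableOn ℂ ψ (stripRegion d D))
    (hB : ∀ w ∈ stripRegion d D, ‖ψ w‖ ≤ B * Real.exp (-ε * w.re)) :
    stripInt ψ d = stripInt ψ D := by
  have htop := integral_boundary_halfStrip_eq_zero (ψ := ψ) (x := -D) (y₁ := d) (y₂ := D) hε hdD.le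
    (hψ.mono fun w hw => ⟨hw.1, abs_le.2 ⟨by linarith [hw.2.1], hw.2.2⟩,
      fun h => absurd ((le_abs_self _).trans_lt h.2) (not_lt.2 hw.2.1)⟩)
    (fun w h1 h2 h3 => hB w ⟨h1, abs_le.2 ⟨by linarith, h3⟩,
      fun h => absurd ((le_abs_self _).trans_lt h.2) (not_lt.2 h2)⟩)
  have hbot := integral_boundary_halfStrip_eq_zero (ψ := ψ) (x := -D) (y₁ := -D) (y₂ := -d) hε
    (by linarith)
    (hψ.mono fun w hw => ⟨hw.1, abs_le.2 ⟨hw.2.1, by linarith [hw.2.2]⟩,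
      fun h => absurd ((neg_le_abs _).trans_lt h.2) (not_lt.2 (by linarith [hw.2.2]))⟩)
    (fun w h1 h2 h3 => hB w ⟨h1, abs_le.2 ⟨h2, by linarith⟩,
      fun h => absurd ((neg_le_abs _).trans_lt h.2) (not_lt.2 (by linarith))⟩)
  have hleft := integral_boundary_rect_eq_zero_of_differentiableOn ψ (-D + (-d : ℝ) * I)
    ((-d : ℝ) + d * I) (by
      refine hψ.mono ?_
      intro w hw
      rw [mem_reProdIm] at hw
      simp [uIcc_of_le (show -D ≤ -d by linarith), uIcc_of_le (show -d ≤ d by linarith)] at hw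
      exact ⟨hw.1.1, (abs_le.2 hw.2).trans hdD.le, fun h => by linarith [h.1, hw.1.2]⟩)
  simp only [add_re, neg_re, ofReal_re, mul_re, I_re, mul_zero, ofReal_im, I_im, mul_one, sub_self,
    add_zero, add_im, neg_im, mul_im, zero_add, neg_zero, smul_eq_mul] at hleft
  have hbd : ∀ y : ℝ, |y| ≤ D → d ≤ |y| → IntegrableOn (fun t : ℝ => ψ (t + y * I)) (Ioi (-D)) := by
    intro y h1 h2
    have hm : ∀ t : ℝ, -D < t → (t + y * I : ℂ) ∈ stripRegion d D := fun t ht => by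
      simp only [stripRegion, mem_ofPred_eq, add_re, ofReal_re, mul_re, I_re, mul_zero, ofReal_im,
        I_im, mul_one, sub_self, add_zero, add_im, mul_im, zero_add]
      exact ⟨ht.le, h1, fun h => absurd h.2 (not_lt.2 h2)⟩
    refine ((exp_neg_integrableOn_Ioi (-D) hε).const_mul B).mono' ?_ ?_
    · exact (hψ.continuousOn.comp (by fun_prop) fun t ht => hm t ht).aestronglyMeasurable
        measurableSet_Ioi
    · refine (ae_restrict_iff' measurableSet_Ioi).2 (Eventually.of_forall fun t ht => ?_)
      simpa using hB _ (hm t ht)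
  have hsplit : ∀ y : ℝ, |y| ≤ D → d ≤ |y| → ∫ t in Ioi (-D), ψ (t + y * I)
      = (∫ t in (-D)..(-d), ψ (t + y * I)) + ∫ t in Ioi (-d), ψ (t + y * I) := by
    intro y h1 h2
    exact (intervalIntegral.integral_interval_add_Ioi (hbd y h1 h2)
      ((hbd y h1 h2).mono_set (Ioi_subset_Ioi (by linarith)))).symm
  have s1 := hsplit d (by rw [abs_of_pos hd]; exact hdD.le) (le_abs_self d)
  have s2 := hsplit (-d) (by rw [abs_neg, abs_of_pos hd]; exact hdD.le) (by rw [abs_neg]; exact le_abs_self d)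
  have hcont : ContinuousOn (fun b : ℝ => ψ (-D + b * I)) (Icc (-D) D) := by
    refine hψ.continuousOn.comp (by fun_prop) ?_
    intro b hb
    simp only [stripRegion, mem_ofPred_eq, add_re, ofReal_re, mul_re, I_re, mul_zero, ofReal_im,
        I_im, mul_one, sub_self, add_zero, add_im, mul_im, zero_add, neg_re, neg_im, neg_zero]
    exact ⟨le_rfl, abs_le.2 hb, fun h => by linarith [h.1]⟩
  have hii : ∀ a b, -D ≤ a → a ≤ b → b ≤ D →
      IntervalIntegrable (fun b : ℝ => ψ (-D + b * I)) volume a b := by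
    intro a b h1 h2 h3
    refine ContinuousOn.intervalIntegrable (hcont.mono ?_)
    rw [uIcc_of_le h2]
    exact Icc_subset_Icc h1 h3
  have s3 : ∫ b in (-D)..D, ψ (-D + b * I) = (∫ b in (-D)..(-d), ψ (-D + b * I))
      + (∫ b in (-d)..d, ψ (-D + b * I)) + ∫ b in d..D, ψ (-D + b * I) := by
    rw [intervalIntegral.integral_add_adjacent_intervals (hii _ _ le_rfl (by linarith) (by linarith))
      (hii _ _ (by linarith) (by linarith) (by linarith)),
      intervalIntegral.integral_add_adjacent_intervals (hii _ _ le_rfl (by linarith) (by linarith))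
      (hii _ _ (by linarith) (by linarith) (by linarith))]
  rw [stripInt, stripInt, s3]
  simp only [s1, s2] at htop hbot
  push_cast at *
  simp only [neg_mul, ← sub_eq_add_neg] at *
  linear_combination htop + hbot + hleft

section Exponential

variable {d ε ρ : ℝ} {w₀ : ℂ}

lemma differentiableAt_expKernel {w : ℂ} (hw : w ≠ w₀) :
    DifferentiableAt ℂ (fun s => exp (-ε * (s - w₀)) / (s - w₀)) w :=
  DifferentiableAt.div (by fun_prop) (by fun_prop) (sub_ne_zero.2 hw)

lemma norm_expKernel_le {w : ℂ} (hρ : 0 < ρ) (hw : ρ ≤ ‖w - w₀‖) :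
    ‖exp (-ε * (w - w₀)) / (w - w₀)‖ ≤ Real.exp (ε * w₀.re) / ρ * Real.exp (-ε * w.re) := by
  have : Real.exp (ε * w₀.re) / ρ * Real.exp (-ε * w.re) = Real.exp (-ε * (w.re - w₀.re)) / ρ := by
    rw [div_mul_eq_mul_div, ← Real.exp_add]; ring_nf
  rw [norm_div, Complex.norm_exp, this]
  simp only [mul_re, sub_re, neg_re, ofReal_re, sub_im, neg_im, ofReal_im, neg_zero, zero_mul,
    sub_zero]
  gcongr

/-- This kernel has residue 1 at w₀ like 1/(s - w₀), but its exponential factor makes it decay along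
the strip, which the plain kernel does not do fast enough for absolute convergence. -/
lemma stripInt_expKernel_of_notMem (hε : 0 < ε) (hd : 0 < d) (hρ : 0 < ρ)
    (hw : ∀ w : ℂ, -d ≤ w.re → |w.im| ≤ d → ρ ≤ ‖w - w₀‖) :
    stripInt (fun s => exp (-ε * (s - w₀)) / (s - w₀)) d = 0 := by
  have := integral_boundary_halfStrip_eq_zero (ψ := fun s => exp (-ε * (s - w₀)) / (s - w₀))
    (x := -d) (y₁ := -d) (y₂ := d) hε (by linarith)
    (fun w h => (differentiableAt_expKernel <| by
      rintro rfl
      have := hw w h.1 (abs_le.2 h.2)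
      rw [sub_self, norm_zero] at this
      linarith).differentiableWithinAt)
    (fun w h1 h2 h3 => norm_expKernel_le hρ (hw w h1 (abs_le.2 ⟨h2, h3⟩)))
  rw [stripInt]
  push_cast at this
  simp only [neg_mul (d : ℂ) I, ← sub_eq_add_neg] at this
  linear_combination -this

lemma stripInt_expKernel_of_mem (hε : 0 < ε) (hd : -d < w₀.re) (hw₀ : |w₀.im| < d) :
    stripInt (fun s => exp (-ε * (s - w₀)) / (s - w₀)) d = -(2 * Real.pi * I) := by
  set E : ℂ → ℂ := fun s => exp (-ε * (s - w₀)) / (s - w₀) with hE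
  have hd0 : 0 < d := (abs_nonneg _).trans_lt hw₀
  obtain ⟨hw1, hw2⟩ := abs_lt.1 hw₀
  -- The vertical line Re w = T separates the pole from infinity. Beyond it Cauchy's theorem in a
  -- half-infinite strip applies. Before it lies a rectangle, where the kernel is an entire
  -- difference quotient plus 1/(s - w₀). The sign of the result is negative because the contour has
  -- the strip on its right.
  set T : ℝ := max (w₀.re + 1) 1 with hT
  have hT1 : w₀.re + 1 ≤ T := le_max_left _ _
  have hT2 : -d < T := by have := le_max_right (w₀.re + 1) 1; linarith
  have hdist : ∀ w : ℂ, T ≤ w.re → 1 ≤ ‖w - w₀‖ := by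
    intro w hw
    have := (le_abs_self _).trans (abs_re_le_norm (w - w₀))
    rw [sub_re] at this
    linarith
  have hinf := integral_boundary_halfStrip_eq_zero (ψ := E)
    (x := T) (y₁ := -d) (y₂ := d) hε (by linarith)
    (fun w h => (differentiableAt_expKernel <| by
      rintro rfl
      have := hdist w h.1
      rw [sub_self, norm_zero] at this
      linarith).differentiableWithinAt)
    (fun w h1 h2 h3 => norm_expKernel_le one_pos (hdist w h1))
  have hwind := integral_boundary_rect_inv_sub hd (by linarith : w₀.re < T) hw1 hw2
  set e : ℂ → ℂ := fun s => exp (-ε * (s - w₀)) with he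
  have hed : Differentiable ℂ e := by fun_prop
  have hds : Differentiable ℂ (dslope e w₀) := by
    rw [← differentiableOn_univ, differentiableOn_dslope univ_mem]
    exact hed.differentiableOn
  have hrect := integral_boundary_rect_eq_zero_of_differentiableOn (dslope e w₀)
    ((-d : ℝ) + (-d : ℝ) * I) (T + d * I) hds.differentiableOn
  simp only [add_re, ofReal_re, mul_re, I_re, mul_zero, ofReal_im, I_im, mul_one, sub_self,
    add_zero, add_im, mul_im, zero_add, smul_eq_mul] at hrect
  have hsplit : ∀ w, w ≠ w₀ → dslope e w₀ w = E w - 1 / (w - w₀) := by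
    intro w hw
    rw [dslope_of_ne _ hw, slope_def_field]
    simp only [hE, he, sub_self, mul_zero, exp_zero]
    rw [sub_div]
  have hEi : ∀ γ : ℝ → ℂ, Continuous γ → (∀ t, γ t ≠ w₀) → ∀ a b,
      (∫ t in a..b, dslope e w₀ (γ t)) = (∫ t in a..b, E (γ t)) - ∫ t in a..b, 1 / (γ t - w₀) := by
    intro γ hγ hne a b
    rw [← intervalIntegral.integral_sub]
    · exact intervalIntegral.integral_congr fun t _ => hsplit _ (hne t)
    · refine Continuous.intervalIntegrable ?_ _ _
      exact Continuous.div (by fun_prop) (by fun_prop) fun t => sub_ne_zero.2 (hne t)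
    · refine Continuous.intervalIntegrable ?_ _ _
      exact Continuous.div (by fun_prop) (by fun_prop) fun t => sub_ne_zero.2 (hne t)
  rw [hEi (fun x => x + (-d : ℝ) * I) (by fun_prop) (fun t h => by rw [← h] at hw1; simp at hw1),
    hEi (fun x => x + d * I) (by fun_prop) (fun t h => by rw [← h] at hw2; simp at hw2),
    hEi (fun y => T + y * I) (by fun_prop) (fun t h => by rw [← h] at hT1; simp at hT1; linarith),
    hEi (fun y => (-d : ℝ) + y * I) (by fun_prop) (fun t h => by rw [← h] at hd; simp at hd)]
    at hrect
  have hE0 : ∀ y : ℝ, |y| = d → IntegrableOn (fun t : ℝ => E (t + y * I)) (Ioi (-d)) := by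
    intro y hy
    have hpos : 0 < d - |w₀.im| := by linarith
    have hm : ∀ t : ℝ, d - |w₀.im| ≤ ‖(t + y * I : ℂ) - w₀‖ := by
      intro t
      have h1 := abs_im_le_norm ((t + y * I : ℂ) - w₀)
      simp only [sub_im, add_im, ofReal_im, mul_im, ofReal_re, I_im, mul_one, I_re, mul_zero,
        add_zero, zero_add] at h1
      have h2 := abs_sub_abs_le_abs_sub y w₀.im
      linarith
    refine ((exp_neg_integrableOn_Ioi (-d) hε).const_mul
      (Real.exp (ε * w₀.re) / (d - |w₀.im|))).mono' ?_ ?_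
    · refine (Continuous.div (by fun_prop) (by fun_prop) fun t => ?_).aestronglyMeasurable
      exact norm_pos_iff.1 (hpos.trans_le (hm t))
    · refine (ae_restrict_iff' measurableSet_Ioi).2 (Eventually.of_forall fun t ht => ?_)
      exact (norm_expKernel_le (ε := ε) hpos (hm t)).trans (le_of_eq (by simp))
  have hadd : ∀ y : ℝ, |y| = d → ∫ t in Ioi (-d), E (t + y * I)
      = (∫ t in (-d)..T, E (t + y * I)) + ∫ t in Ioi T, E (t + y * I) := by
    intro y hy
    exact (intervalIntegral.integral_interval_add_Ioi (hE0 y hy)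
      ((hE0 y hy).mono_set (Ioi_subset_Ioi hT2.le))).symm
  have a1 := hadd d (abs_of_pos hd0)
  have a2 := hadd (-d) (by rw [abs_neg, abs_of_pos hd0])
  rw [stripInt, a1]
  push_cast at *
  simp only [neg_mul (d : ℂ) I, ← sub_eq_add_neg] at *
  rw [a2]
  linear_combination -hinf - hrect - hwind

end Exponential

section Jump

variable {d ε ρ : ℝ} {w : ℂ} {Φ : ℂ → ℂ}

lemma stripInt_sub_const_mul {ψ₁ ψ₂ ψ : ℂ → ℂ} {d B₁ B₂ ε : ℝ} (c : ℂ) (hd : 0 < d) (hε : 0 < ε)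
    (h₁ : ContinuousOn ψ₁ (stripFrame d)) (h₂ : ContinuousOn ψ₂ (stripFrame d))
    (hB₁ : ∀ w ∈ stripFrame d, ‖ψ₁ w‖ ≤ B₁ * Real.exp (-ε * w.re))
    (hB₂ : ∀ w ∈ stripFrame d, ‖ψ₂ w‖ ≤ B₂ * Real.exp (-ε * w.re))
    (h : ∀ w ∈ stripFrame d, ψ w = ψ₁ w - c * ψ₂ w) :
    stripInt ψ d = stripInt ψ₁ d - c * stripInt ψ₂ d := by
  have e1 : ∫ t in Ioi (-d), ψ (t - d * I)
      = (∫ t in Ioi (-d), ψ₁ (t - d * I)) - c * ∫ t in Ioi (-d), ψ₂ (t - d * I) := by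
    rw [← integral_const_mul, ← integral_sub (integrableOn_lower hd hε h₁ hB₁)
      ((integrableOn_lower hd hε h₂ hB₂).const_mul c)]
    exact setIntegral_congr_fun measurableSet_Ioi fun t ht => h _ (lower_mem_stripFrame hd (le_of_lt ht))
  have e3 : ∫ t in Ioi (-d), ψ (t + d * I)
      = (∫ t in Ioi (-d), ψ₁ (t + d * I)) - c * ∫ t in Ioi (-d), ψ₂ (t + d * I) := by
    rw [← integral_const_mul, ← integral_sub (integrableOn_upper hd hε h₁ hB₁)
      ((integrableOn_upper hd hε h₂ hB₂).const_mul c)]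
    exact setIntegral_congr_fun measurableSet_Ioi fun t ht => h _ (upper_mem_stripFrame hd (le_of_lt ht))
  have e2 : ∫ t in (-d)..d, ψ (-d + t * I)
      = (∫ t in (-d)..d, ψ₁ (-d + t * I)) - c * ∫ t in (-d)..d, ψ₂ (-d + t * I) := by
    rw [intervalIntegral.integral_of_le (by linarith), intervalIntegral.integral_of_le (by linarith),
      intervalIntegral.integral_of_le (by linarith), ← integral_const_mul,
      ← integral_sub (integrableOn_left h₁) ((integrableOn_left h₂).const_mul c)]
    exact setIntegral_congr_fun measurableSet_Ioc fun t ht =>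
      h _ (left_mem_stripFrame (abs_le.2 ⟨ht.1.le, ht.2⟩))
  rw [stripInt, e1, e2, e3, stripInt, stripInt]
  ring

/-- The Cauchy integrals over the boundaries of two half-strips differ, between these boundaries,
by the integrated function. -/
lemma stripCauchy_eq_add {U : Set ℂ} {D B : ℝ} {w₀ : ℂ} (hd : 0 < d) (hdD : d < D) (hε : 0 < ε)
    (hU : IsOpen U) (hRU : stripRegion d D ⊆ U) (hΦ : DifferentiableOn ℂ Φ U)
    (hB : ∀ w ∈ stripRegion d D, ‖Φ w‖ ≤ B * Real.exp (-ε * w.re))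
    (h1 : -D < w₀.re) (h2 : |w₀.im| < D) (h3 : ¬(-d ≤ w₀.re ∧ |w₀.im| ≤ d)) :
    stripCauchy Φ d w₀ = stripCauchy Φ D w₀ + Φ w₀ := by
  have hD : 0 < D := hd.trans hdD
  have hw₀R : w₀ ∈ stripRegion d D := ⟨h1.le, h2.le, fun h => h3 ⟨h.1.le, h.2.le⟩⟩
  have hw₀U : w₀ ∈ U := hRU hw₀R
  set E : ℂ → ℂ := fun s => exp (-ε * (s - w₀)) / (s - w₀) with hE
  -- Subtracting the constant Φ(w₀) would remove the pole but destroy the decay at infinity.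
  -- Subtracting Φ(w₀) e^{-ε(s - w₀)} removes the pole and keeps the decay.
  set P : ℂ → ℂ := fun s => Φ s - Φ w₀ * exp (-ε * (s - w₀)) with hP
  have hPU : DifferentiableOn ℂ P U := hΦ.sub (by fun_prop)
  have hψ : DifferentiableOn ℂ (dslope P w₀) U :=
    (differentiableOn_dslope (hU.mem_nhds hw₀U)).2 hPU
  have hclosed : IsClosed {w : ℂ | -d ≤ w.re ∧ |w.im| ≤ d} :=
    (isClosed_le continuous_const continuous_re).inter
      (isClosed_le continuous_im.abs continuous_const)
  have hopen : IsOpen {w : ℂ | -D < w.re ∧ |w.im| < D} :=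
    (isOpen_lt continuous_const continuous_re).inter
      (isOpen_lt continuous_im.abs continuous_const)
  obtain ⟨ρ, hρ, hball⟩ : ∃ ρ > 0, Metric.closedBall w₀ ρ ⊆
      U ∩ {w : ℂ | -D < w.re ∧ |w.im| < D} ∩ {w : ℂ | -d ≤ w.re ∧ |w.im| ≤ d}ᶜ :=
    Metric.nhds_basis_closedBall.mem_iff.1 <|
      ((hU.inter hopen).inter hclosed.isOpen_compl).mem_nhds ⟨⟨hw₀U, h1, h2⟩, h3⟩
  have hfar : ∀ w, w ∉ Metric.closedBall w₀ ρ → ρ ≤ ‖w - w₀‖ := by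
    intro w hw
    rw [mem_closedBall_iff_norm, not_le] at hw
    exact hw.le
  have hFd : ∀ w ∈ stripFrame d, ρ ≤ ‖w - w₀‖ := fun w hw =>
    hfar w fun h => (hball h).2 ⟨hw.1, hw.2.1⟩
  have hFD : ∀ w ∈ stripFrame D, ρ ≤ ‖w - w₀‖ := fun w hw =>
    hfar w fun h => hw.2.2 (hball h).1.2
  obtain ⟨M, hM⟩ := (isCompact_closedBall w₀ ρ).exists_bound_of_continuousOn
    (hψ.continuousOn.mono fun w hw => (hball hw).1.1)
  have hB0 : 0 ≤ B :=
    bound_nonneg hd fun w hw => hB w (stripFrame_inner_subset hdD.le hw)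
  have hM0 : 0 ≤ M := (norm_nonneg _).trans (hM w₀ (Metric.mem_closedBall_self hρ.le))
  have hsl : ∀ w, w ≠ w₀ → dslope P w₀ w = Φ w / (w - w₀) - Φ w₀ * E w := by
    intro w hw
    rw [dslope_of_ne _ hw, slope_def_field]
    simp only [hP, hE, sub_self, mul_zero, exp_zero, mul_one, sub_zero]
    rw [sub_div, mul_div_assoc]
  have hbd1 : ∀ w ∈ stripRegion d D, ρ ≤ ‖w - w₀‖ →
      ‖Φ w / (w - w₀)‖ ≤ B / ρ * Real.exp (-ε * w.re) := by
    intro w hw hwρ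
    rw [norm_div, div_mul_eq_mul_div]
    gcongr
    exact hB w hw
  -- The first two terms of the constant serve outside the disk around w₀, where the quotient can be
  -- split; the third serves inside it, where compactness bounds the removable singularity.
  have hbd : ∀ w ∈ stripRegion d D, ‖dslope P w₀ w‖ ≤
      (B / ρ + ‖Φ w₀‖ * (Real.exp (ε * w₀.re) / ρ) + M * Real.exp (ε * (w₀.re + ρ)))
        * Real.exp (-ε * w.re) := by
    intro w hw
    by_cases hwb : w ∈ Metric.closedBall w₀ ρ
    · have hre : w.re ≤ w₀.re + ρ := by
        have := (le_abs_self _).trans (abs_re_le_norm (w - w₀))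
        rw [mem_closedBall_iff_norm] at hwb
        rw [sub_re] at this
        linarith
      have hone : 1 ≤ Real.exp (ε * (w₀.re + ρ)) * Real.exp (-ε * w.re) := by
        rw [← Real.exp_add]
        refine Real.one_le_exp ?_
        nlinarith
      calc ‖dslope P w₀ w‖ ≤ M * 1 := by rw [mul_one]; exact hM w hwb
        _ ≤ M * (Real.exp (ε * (w₀.re + ρ)) * Real.exp (-ε * w.re)) := by gcongr
        _ = M * Real.exp (ε * (w₀.re + ρ)) * Real.exp (-ε * w.re) := by ring
        _ ≤ _ := by
          gcongr
          have : 0 ≤ B / ρ + ‖Φ w₀‖ * (Real.exp (ε * w₀.re) / ρ) := by positivity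
          linarith
    · have hwρ := hfar w hwb
      have hne : w ≠ w₀ := fun h => hwb (h ▸ Metric.mem_closedBall_self hρ.le)
      rw [hsl w hne]
      calc ‖Φ w / (w - w₀) - Φ w₀ * E w‖ ≤ ‖Φ w / (w - w₀)‖ + ‖Φ w₀‖ * ‖E w‖ := by
            rw [← norm_mul]; exact norm_sub_le _ _
        _ ≤ B / ρ * Real.exp (-ε * w.re)
            + ‖Φ w₀‖ * (Real.exp (ε * w₀.re) / ρ * Real.exp (-ε * w.re)) := by
          gcongr
          · exact hbd1 w hw hwρ
          · exact norm_expKernel_le hρ hwρ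
        _ = (B / ρ + ‖Φ w₀‖ * (Real.exp (ε * w₀.re) / ρ)) * Real.exp (-ε * w.re) := by ring
        _ ≤ _ := by
          refine mul_le_mul_of_nonneg_right ?_ (Real.exp_pos _).le
          have : 0 ≤ M * Real.exp (ε * (w₀.re + ρ)) := by positivity
          linarith
  have hmain := stripInt_eq_of_differentiableOn hd hdD hε (hψ.mono hRU) hbd
  have hdecomp : ∀ r, 0 < r → stripFrame r ⊆ stripRegion d D →
      (∀ w ∈ stripFrame r, ρ ≤ ‖w - w₀‖) →
      stripInt (dslope P w₀) r = stripInt (fun s => Φ s / (s - w₀)) r - Φ w₀ * stripInt E r := by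
    intro r hr hsub hF
    have hne : ∀ w ∈ stripFrame r, w - w₀ ≠ 0 := fun w hw => norm_pos_iff.1 (hρ.trans_le (hF w hw))
    refine stripInt_sub_const_mul (Φ w₀) hr hε ?_ ?_ (fun w hw => hbd1 w (hsub hw) (hF w hw))
      (fun w hw => norm_expKernel_le hρ (hF w hw)) (fun w hw => hsl w (sub_ne_zero.1 (hne w hw)))
    · exact (hΦ.continuousOn.mono (hsub.trans hRU)).div (by fun_prop) hne
    · exact ContinuousOn.div (by fun_prop) (by fun_prop) hne
  -- The point w₀ lies outside the inner contour and inside the outer one, so the exponential kernel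
  -- contributes 0 to the first and -2πi to the second.
  rw [hdecomp d hd (stripFrame_inner_subset hdD.le) hFd,
    hdecomp D hD (stripFrame_outer_subset hdD.le) hFD,
    stripInt_expKernel_of_mem hε h1 h2,
    stripInt_expKernel_of_notMem hε hd hρ fun w hw1 hw2 => hfar w fun h => (hball h).2 ⟨hw1, hw2⟩]
    at hmain
  rw [stripCauchy, stripCauchy]
  have hpi : (2 * Real.pi * I : ℂ) ≠ 0 := two_pi_I_ne_zero
  rw [inv_mul_eq_div, inv_mul_eq_div, div_add' _ _ _ hpi, div_left_inj' hpi]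
  linear_combination hmain

end Jump

/-! ### From weighted L¹ bounds on rays to pointwise bounds. -/

lemma measurable_indicator_enorm {f : ℂ → ℂ} {s : Set ℂ} (hs : MeasurableSet s)
    (hf : ContinuousOn f s) : Measurable (s.indicator fun z => ‖f z‖ₑ) := by
  classical
  have := hf.enorm.measurable_piecewise (continuousOn_const (c := (0 : ℝ≥0∞)) (s := sᶜ)) hs
  convert! this using 1

lemma lintegral_eq_lintegral_polar {g : ℂ → ℝ≥0∞} :
    ∫⁻ z, g z = ∫⁻ q in Ioi (0 : ℝ) ×ˢ Ioo (-Real.pi) Real.pi,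
      ENNReal.ofReal q.1 * g (q.1 * exp (q.2 * I)) := by
  rw [← Complex.lintegral_comp_polarCoord_symm, polarCoord_target]
  refine lintegral_congr fun q => ?_
  rw [Complex.polarCoord_symm_apply, exp_mul_I, smul_eq_mul, ofReal_cos, ofReal_sin]

lemma measurable_polar {g : ℂ → ℝ≥0∞} (hg : Measurable g) :
    Measurable fun q : ℝ × ℝ => ENNReal.ofReal q.1 * g (q.1 * exp (q.2 * I)) := by
  refine (measurable_fst.ennreal_ofReal).mul (hg.comp ?_)
  exact Continuous.measurable (by fun_prop)

lemma mul_enorm_le_lintegral_circle {f : ℂ → ℂ} {p : ℂ} {ρ r : ℝ}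
    (hf : DifferentiableOn ℂ f (Metric.ball p ρ)) (hr : 0 < r) (hrρ : r < ρ) :
    ENNReal.ofReal (2 * Real.pi) * ‖f p‖ₑ ≤
      ∫⁻ θ in Ioo (-Real.pi) Real.pi, ‖f (p + r * exp (θ * I))‖ₑ := by
  have hmean := DiffContOnCl.circleAverage (f := f) (c := p) (R := r)
    (hf.diffContOnCl_ball (by
      rw [abs_of_pos hr]
      exact (Metric.closedBall_subset_ball hrρ)))
  have hper : Function.Periodic (fun θ : ℝ => f (circleMap p r θ)) (2 * Real.pi) := fun θ => by
    simp only [periodic_circleMap p r θ]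
  have hint : ∫ θ in 0..2 * Real.pi, f (circleMap p r θ)
      = ∫ θ in Ioo (-Real.pi) Real.pi, f (circleMap p r θ) := by
    have := hper.intervalIntegral_add_eq 0 (-Real.pi)
    rw [zero_add] at this
    rw [this, intervalIntegral.integral_of_le (by linarith [Real.pi_pos]),
      integral_Ioc_eq_integral_Ioo]
    ring_nf
  rw [Real.circleAverage_def, hint, inv_smul_eq_iff₀ (by positivity)] at hmean
  have h1 : ENNReal.ofReal (2 * Real.pi) * ‖f p‖ₑ = ‖(2 * Real.pi) • f p‖ₑ := by
    rw [enorm_smul, Real.enorm_of_nonneg (by positivity)]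
  rw [h1, ← hmean]
  exact enorm_integral_le_lintegral_enorm _

/-- The circle mean value inequality, multiplied by the radius and integrated over 0 < r < ρ in
polar coordinates centred at p. -/
lemma mul_enorm_le_lintegral_ball {f : ℂ → ℂ} {p : ℂ} {ρ : ℝ} (hρ : 0 < ρ)
    (hf : DifferentiableOn ℂ f (Metric.ball p ρ)) :
    ENNReal.ofReal (Real.pi * ρ ^ 2) * ‖f p‖ₑ ≤
      ∫⁻ z, (Metric.ball p ρ).indicator (fun z => ‖f z‖ₑ) z := by
  set g := (Metric.ball p ρ).indicator (fun z => ‖f z‖ₑ) with hg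
  have hgm : Measurable g := measurable_indicator_enorm measurableSet_ball hf.continuousOn
  rw [← lintegral_add_left_eq_self (μ := volume) g p,
    lintegral_eq_lintegral_polar (g := fun z => g (p + z)), Measure.volume_eq_prod,
    ← Measure.prod_restrict, lintegral_prod _
      (measurable_polar (g := fun z => g (p + z)) (hgm.comp (by fun_prop))).aemeasurable]
  calc ENNReal.ofReal (Real.pi * ρ ^ 2) * ‖f p‖ₑ
      = ∫⁻ r in Ioo 0 ρ, ENNReal.ofReal r * (ENNReal.ofReal (2 * Real.pi) * ‖f p‖ₑ) := by
        have hr : ∫⁻ r in Ioo 0 ρ, ENNReal.ofReal r = ENNReal.ofReal (ρ ^ 2 / 2) := by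
          have hi : IntegrableOn (fun r : ℝ => r) (Ioo 0 ρ) :=
            (continuous_id.integrableOn_Icc (a := 0) (b := ρ)).mono_set Ioo_subset_Icc_self
          rw [← ofReal_integral_eq_lintegral_ofReal hi ((ae_restrict_iff' measurableSet_Ioo).2 (Eventually.of_forall fun r hr => hr.1.le))]
          rw [← integral_Ioc_eq_integral_Ioo, ← intervalIntegral.integral_of_le hρ.le, integral_id]
          ring_nf
        rw [lintegral_mul_const _ (by fun_prop), hr, ← mul_assoc,
          ← ENNReal.ofReal_mul (by positivity)]
        ring_nf
    _ ≤ ∫⁻ r in Ioo 0 ρ, ∫⁻ θ in Ioo (-Real.pi) Real.pi,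
          ENNReal.ofReal r * g (p + r * exp (θ * I)) := by
        refine setLIntegral_mono' measurableSet_Ioo fun r hr => ?_
        rw [lintegral_const_mul' _ _ ENNReal.ofReal_ne_top]
        gcongr
        refine (mul_enorm_le_lintegral_circle hf hr.1 hr.2).trans (le_of_eq ?_)
        refine lintegral_congr fun θ => ?_
        rw [hg, indicator_of_mem]
        rw [mem_ball_iff_norm, add_sub_cancel_left, norm_mul, norm_exp_ofReal_mul_I, mul_one,
          norm_real, Real.norm_of_nonneg hr.1.le]
        exact hr.2
    _ ≤ _ := lintegral_mono_set Ioo_subset_Ioi_self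

/-- Seen from the origin, a disk of radius ρ at distance s subtends an angle of order ρ/s: inside it
r ≥ s/2 and r |sin φ| < ρ, and Jordan's inequality bounds |φ| by (π/2)|sin φ|. -/
lemma abs_le_of_mem_ball {s ρ r φ : ℝ} (hs : 2 * ρ ≤ s) (hρ : 0 < ρ) (hr : 0 < r)
    (hφ : φ ∈ Ioo (-Real.pi) Real.pi) (h : (r * exp (φ * I) : ℂ) ∈ Metric.ball (s : ℂ) ρ) :
    |φ| ≤ Real.pi * ρ / s := by
  rw [mem_ball_iff_norm] at h
  have hs0 : 0 < s := by linarith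
  have hre := (abs_re_le_norm _).trans_lt h
  have him := (abs_im_le_norm _).trans_lt h
  simp only [sub_re, sub_im, mul_re, mul_im, ofReal_re, ofReal_im, zero_mul, sub_zero, add_zero,
    exp_ofReal_mul_I_re, exp_ofReal_mul_I_im] at hre him
  have hr2 : s / 2 ≤ r := by
    have h1 := norm_sub_norm_le (s : ℂ) (r * exp (φ * I))
    rw [norm_sub_rev, norm_mul, norm_exp_ofReal_mul_I, mul_one, norm_real, norm_real,
      Real.norm_of_nonneg hr.le, Real.norm_of_nonneg hs0.le, ] at h1
    linarith
  have hcos : 0 < Real.cos φ := by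
    have := (abs_lt.1 hre).1
    exact (mul_pos_iff_of_pos_left hr).1 (by linarith)
  have hφ2 : |φ| ≤ Real.pi / 2 := by
    by_contra hcon
    rw [not_le] at hcon
    have : Real.cos |φ| ≤ 0 := Real.cos_nonpos_of_pi_div_two_le_of_le hcon.le
      (by have := abs_lt.2 hφ; linarith [Real.pi_pos])
    rw [Real.cos_abs] at this
    linarith
  have hsin := Real.mul_abs_le_abs_sin hφ2
  rw [abs_mul, abs_of_pos hr] at him
  have h2 : s / 2 * (2 / Real.pi * |φ|) < ρ := by
    calc s / 2 * (2 / Real.pi * |φ|) ≤ r * |Real.sin φ| := by gcongr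
      _ < ρ := him
  rw [le_div_iff₀ hs0]
  have hpi := Real.pi_pos
  have h3 : s / 2 * (2 / Real.pi * |φ|) = |φ| * s / Real.pi := by field_simp
  rw [h3, div_lt_iff₀ hpi] at h2
  linarith

/-- In polar coordinates about the origin, the Jacobian r ≤ s + ρ is compensated by the small angle
under which the disk is seen, so no power of s is lost besides the exponential weight. -/
lemma lintegral_ball_le {f : ℂ → ℂ} {s ρ ν : ℝ} {M : ℝ≥0∞} (hν : 0 ≤ ν) (hρ : 0 < ρ) (hs : 0 ≤ s)
    (hf : ContinuousOn f (Metric.ball (s : ℂ) ρ))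
    (hM : ∀ φ : ℝ, ∫⁻ r in Ioi (0 : ℝ), ‖f (r * exp (φ * I))‖ₑ * ENNReal.ofReal (Real.exp (-ν * r))
      ≤ M) :
    ∫⁻ z, (Metric.ball (s : ℂ) ρ).indicator (fun z => ‖f z‖ₑ) z ≤
      ENNReal.ofReal (6 * Real.pi * ρ * Real.exp (ν * (s + ρ))) * M := by
  set g := (Metric.ball (s : ℂ) ρ).indicator (fun z => ‖f z‖ₑ) with hg
  have hgm : Measurable g := measurable_indicator_enorm measurableSet_ball hf
  -- c bounds the arguments of points of the disk: πρ/s for a distant disk, and π when s < 2ρ. The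
  -- constant 6π is attained as a bound in the second case, where s + ρ < 3ρ.
  obtain ⟨c, hc0, hc, hcs⟩ : ∃ c : ℝ, 0 ≤ c ∧ (∀ r φ : ℝ, 0 < r → φ ∈ Ioo (-Real.pi) Real.pi →
      (r * exp (φ * I) : ℂ) ∈ Metric.ball (s : ℂ) ρ → φ ∈ Icc (-c) c) ∧
      2 * c * (s + ρ) ≤ 6 * Real.pi * ρ := by
    have hpi := Real.pi_pos
    rcases le_or_gt (2 * ρ) s with h | h
    · have hs0 : 0 < s := by linarith
      refine ⟨Real.pi * ρ / s, by positivity, fun r φ hr hφ hm =>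
        abs_le.1 (abs_le_of_mem_ball h hρ hr hφ hm), ?_⟩
      rw [mul_div_assoc', div_mul_eq_mul_div, div_le_iff₀ hs0]
      nlinarith [mul_pos hpi hρ]
    · refine ⟨Real.pi, hpi.le, fun r φ hr hφ _ => ⟨hφ.1.le, hφ.2.le⟩, ?_⟩
      nlinarith
  rw [lintegral_eq_lintegral_polar, Measure.volume_eq_prod,
    ← Measure.prod_restrict, lintegral_prod_symm _ (measurable_polar hgm).aemeasurable]
  calc ∫⁻ φ in Ioo (-Real.pi) Real.pi, ∫⁻ r in Ioi (0 : ℝ),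
        ENNReal.ofReal r * g (r * exp (φ * I))
      ≤ ∫⁻ φ in Ioo (-Real.pi) Real.pi, (Icc (-c) c).indicator
          (fun _ => ENNReal.ofReal ((s + ρ) * Real.exp (ν * (s + ρ))) * M) φ := by
        refine setLIntegral_mono' measurableSet_Ioo fun φ hφ => ?_
        by_cases hφc : φ ∈ Icc (-c) c
        · rw [indicator_of_mem hφc]
          refine le_trans ?_ (mul_le_mul_right (hM φ) _)
          rw [← lintegral_const_mul' _ _ ENNReal.ofReal_ne_top]
          refine setLIntegral_mono' measurableSet_Ioi fun r hr => ?_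
          by_cases hm : (r * exp (φ * I) : ℂ) ∈ Metric.ball (s : ℂ) ρ
          · rw [hg, indicator_of_mem hm, mul_comm ‖_‖ₑ, ← mul_assoc,
              ← ENNReal.ofReal_mul (by positivity)]
            gcongr
            have hrs : r ≤ s + ρ := by
              rw [mem_ball_iff_norm] at hm
              have h1 := norm_sub_norm_le (r * exp (φ * I) : ℂ) (s : ℂ)
              rw [norm_mul, norm_exp_ofReal_mul_I, mul_one, norm_real, norm_real,
                Real.norm_of_nonneg (le_of_lt hr), Real.norm_of_nonneg hs] at h1
              linarith
            rw [mul_assoc, ← Real.exp_add]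
            have h1 : 1 ≤ Real.exp (ν * (s + ρ) + -ν * r) := Real.one_le_exp (by nlinarith)
            nlinarith [show 0 < r from hr]
          · rw [hg, indicator_of_notMem hm, mul_zero]
            exact zero_le
        · rw [indicator_of_notMem hφc]
          refine le_of_eq ?_
          refine (setLIntegral_congr_fun measurableSet_Ioi fun r hr => ?_).trans lintegral_zero
          rw [hg, indicator_of_notMem fun hm => hφc (hc r φ hr hφ hm), mul_zero]
    _ ≤ ∫⁻ φ, (Icc (-c) c).indicator
          (fun _ => ENNReal.ofReal ((s + ρ) * Real.exp (ν * (s + ρ))) * M) φ :=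
        setLIntegral_le_lintegral _ _
    _ = ENNReal.ofReal (2 * c * (s + ρ) * Real.exp (ν * (s + ρ))) * M := by
        rw [lintegral_indicator_const measurableSet_Icc, Real.volume_Icc, mul_right_comm,
          ← ENNReal.ofReal_mul (by positivity)]
        ring_nf
    _ ≤ _ := by gcongr

/-- A pointwise exponential bound for holomorphic functions with a finite weighted norm on rays. -/
lemma norm_le_of_rayNorm_le {f : ℂ → ℂ} {ρ ν : ℝ} {M : ℝ≥0} (hν : 0 ≤ ν) (hρ : 0 < ρ)
    (hM : rayNorm ν f ≤ M) {p : ℂ} (hf : DifferentiableOn ℂ f (Metric.ball p ρ)) :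
    ‖f p‖ ≤ 6 / ρ * Real.exp (ν * ρ) * M * Real.exp (ν * ‖p‖) := by
  set e : ℂ := exp (arg p * I) with he
  have hen : ‖e‖ = 1 := norm_exp_ofReal_mul_I _
  have hp : (‖p‖ : ℂ) * e = p := norm_mul_exp_arg_mul_I p
  have hf' : DifferentiableOn ℂ (fun z => f (z * e)) (Metric.ball (‖p‖ : ℂ) ρ) := by
    refine hf.comp (by fun_prop) fun z hz => ?_
    rw [mem_ball_iff_norm] at hz ⊢
    calc ‖z * e - p‖ = ‖(z - ‖p‖) * e‖ := by rw [sub_mul, hp]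
      _ < ρ := by rwa [norm_mul, hen, mul_one]
  have hM' : ∀ φ : ℝ, ∫⁻ r in Ioi (0 : ℝ), ‖f (r * exp (φ * I) * e)‖ₑ *
      ENNReal.ofReal (Real.exp (-ν * r)) ≤ M := by
    intro φ
    refine le_trans (le_of_eq ?_) ((le_iSup (fun φ : ℝ => ∫⁻ r in Ioi (0 : ℝ),
      ‖f (r * exp (φ * I))‖ₑ * ENNReal.ofReal (Real.exp (-ν * r))) (φ + arg p)).trans hM)
    refine lintegral_congr fun r => ?_
    rw [mul_assoc, he, ← exp_add]
    push_cast
    ring_nf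
  have h1 := (mul_enorm_le_lintegral_ball hρ hf').trans
    (lintegral_ball_le hν hρ (norm_nonneg p) hf'.continuousOn hM')
  rw [hp] at h1
  have hpi := Real.pi_pos
  rw [← ofReal_norm, ← ENNReal.ofReal_mul (by positivity), ← ENNReal.ofReal_coe_nnreal,
    ← ENNReal.ofReal_mul (by positivity), ENNReal.ofReal_le_ofReal_iff (by positivity),
    mul_add, Real.exp_add] at h1
  have h2 : Real.pi * ρ ^ 2 * (6 / ρ * Real.exp (ν * ρ) * M * Real.exp (ν * ‖p‖))
      = 6 * Real.pi * ρ * (Real.exp (ν * ‖p‖) * Real.exp (ν * ρ)) * M := by field_simp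
  rw [← h2] at h1
  exact le_of_mul_le_mul_left h1 (by positivity)

/-! ### Growth and stability of Frobenius-type expansions. -/

section Frobenius

/-- One power of |z| tames each logarithm and ⌈|Re α|⌉ powers tame z^α; the bounded argument
contributes only the constants e^{π|Im α|} and π. -/
lemma exists_norm_pow_mul_cpow_mul_log_le (α : ℂ) (m : ℕ) :
    ∃ (k : ℕ) (C : ℝ), ∀ z : ℂ, z ≠ 0 → ‖z‖ ≤ 1 → ‖z‖ ^ k * ‖z ^ α * log z ^ m‖ ≤ C := by
  refine ⟨⌈|α.re|⌉₊ + m, Real.exp (Real.pi * |α.im|) * (1 + Real.pi) ^ m, fun z hz hz1 => ?_⟩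
  have hz0 : 0 < ‖z‖ := norm_pos_iff.2 hz
  have h1 : ‖z‖ ^ ⌈|α.re|⌉₊ * ‖z ^ α‖ ≤ Real.exp (Real.pi * |α.im|) := by
    have harg : -(arg z * α.im) ≤ Real.pi * |α.im| := by
      refine (neg_le_abs _).trans ?_
      rw [abs_mul]
      gcongr
      exact abs_arg_le_pi z
    calc ‖z‖ ^ ⌈|α.re|⌉₊ * ‖z ^ α‖
        ≤ ‖z‖ ^ ⌈|α.re|⌉₊ * (‖z‖ ^ α.re / Real.exp (arg z * α.im)) := by
          gcongr
          exact norm_cpow_le z α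
      _ = ‖z‖ ^ ((⌈|α.re|⌉₊ : ℝ) + α.re) * Real.exp (-(arg z * α.im)) := by
          rw [Real.rpow_add hz0, Real.rpow_natCast, Real.exp_neg]
          ring
      _ ≤ 1 * Real.exp (Real.pi * |α.im|) := by
          gcongr
          refine Real.rpow_le_one hz0.le hz1 ?_
          have := Nat.le_ceil |α.re|
          have := neg_abs_le α.re
          linarith
      _ = _ := one_mul _
  have h2 : ‖z‖ * ‖log z‖ ≤ 1 + Real.pi := by
    have h3 : ‖log z‖ ≤ |Real.log ‖z‖| + Real.pi := by
      refine (Complex.norm_le_abs_re_add_abs_im _).trans ?_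
      rw [log_re, log_im]
      gcongr
      exact abs_arg_le_pi z
    have h4 := (Real.abs_log_mul_self_lt _ hz0 hz1).le
    rw [abs_mul, abs_of_pos hz0] at h4
    calc ‖z‖ * ‖log z‖ ≤ ‖z‖ * (|Real.log ‖z‖| + Real.pi) := by gcongr
      _ = |Real.log ‖z‖| * ‖z‖ + ‖z‖ * Real.pi := by ring
      _ ≤ 1 + 1 * Real.pi := by
        have := Real.pi_pos
        gcongr
      _ = _ := by ring
  calc ‖z‖ ^ (⌈|α.re|⌉₊ + m) * ‖z ^ α * log z ^ m‖
      = (‖z‖ ^ ⌈|α.re|⌉₊ * ‖z ^ α‖) * (‖z‖ * ‖log z‖) ^ m := by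
        rw [norm_mul, norm_pow, pow_add, mul_pow]; ring
    _ ≤ _ := by
      have := Real.pi_pos
      gcongr

lemma self_mem_cut (ω u : ℂ) : ω ∈ cut ω u := ⟨0, le_rfl, by simp⟩

lemma IsFrobeniusAt.exists_bound {f : ℂ → ℂ} {ω u : ℂ} (hu : ‖u‖ = 1) (hf : IsFrobeniusAt f ω u) :
    ∃ (m : ℕ) (r C : ℝ), 0 < r ∧
      ∀ p ∈ Metric.ball ω r, p ∉ cut ω u → ‖(p - ω) ^ m * f p‖ ≤ C := by
  obtain ⟨r, hr, N, α, m, A, hA, hfA⟩ := hf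
  choose k C hC using fun l => exists_norm_pow_mul_cpow_mul_log_le (α l) (m l)
  have hAb : ∀ l, ∃ B, ∀ p ∈ Metric.closedBall ω (r / 2), ‖A l p‖ ≤ B := fun l =>
    (isCompact_closedBall ω (r / 2)).exists_bound_of_continuousOn
      ((hA l).continuousOn.mono (Metric.closedBall_subset_ball (by linarith)))
  choose B hB using hAb
  refine ⟨∑ l, k l, min (r / 2) 1, ∑ l, B l * C l, by positivity, fun p hp hpc => ?_⟩
  rw [mem_ball_iff_norm, lt_min_iff] at hp
  have hne : p - ω ≠ 0 := fun h => hpc (sub_eq_zero.1 h ▸ self_mem_cut ω u)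
  have hu0 : u ≠ 0 := norm_pos_iff.1 (by rw [hu]; exact one_pos)
  set z : ℂ := -(p - ω) / u with hz
  have hz0 : z ≠ 0 := div_ne_zero (neg_ne_zero.2 hne) hu0
  have hzn : ‖z‖ = ‖p - ω‖ := by rw [hz, norm_div, norm_neg, hu, div_one]
  rw [hfA p (mem_ball_iff_norm.2 (by linarith [hp.1])) hpc, norm_mul, norm_pow]
  calc ‖p - ω‖ ^ (∑ l, k l) * ‖∑ l, A l p * z ^ α l * log z ^ m l‖
      ≤ ‖z‖ ^ (∑ l, k l) * ∑ l, ‖A l p * z ^ α l * log z ^ m l‖ := by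
        rw [hzn]
        gcongr
        exact norm_sum_le _ _
    _ = ∑ l, ‖z‖ ^ (∑ l, k l) * ‖A l p * z ^ α l * log z ^ m l‖ := Finset.mul_sum _ _ _
    _ ≤ ∑ l, B l * C l := by
        refine Finset.sum_le_sum fun l _ => ?_
        have h1 : ‖z‖ ^ (∑ l, k l) ≤ ‖z‖ ^ k l :=
          pow_le_pow_of_le_one (norm_nonneg z) (by rw [hzn]; exact hp.2.le)
            (Finset.single_le_sum (f := k) (fun _ _ => Nat.zero_le _) (Finset.mem_univ l))
        have h2 := hC l z hz0 (by rw [hzn]; exact hp.2.le)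
        have h3 := hB l p (mem_closedBall_iff_norm.2 hp.1.le)
        calc ‖z‖ ^ (∑ l, k l) * ‖A l p * z ^ α l * log z ^ m l‖
            ≤ ‖z‖ ^ k l * ‖A l p * z ^ α l * log z ^ m l‖ := by gcongr
          _ = ‖A l p‖ * (‖z‖ ^ k l * ‖z ^ α l * log z ^ m l‖) := by
            rw [mul_assoc (A l p), norm_mul]; ring
          _ ≤ B l * C l := by
            have := (norm_nonneg _).trans h3
            gcongr

/-- The holomorphic function g enters as one more term of the sum, with exponent 0 and no logarithm.
-/
lemma IsFrobeniusAt.mul_add {f f' E g : ℂ → ℂ} {ω u : ℂ} {r₀ : ℝ} (hf : IsFrobeniusAt f ω u)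
    (hr₀ : 0 < r₀) (hE : DifferentiableOn ℂ E (Metric.ball ω r₀))
    (hg : DifferentiableOn ℂ g (Metric.ball ω r₀))
    (h : ∀ p ∈ Metric.ball ω r₀, p ∉ cut ω u → f' p = f p * E p + g p) :
    IsFrobeniusAt f' ω u := by
  obtain ⟨r, hr, N, α, m, A, hA, hfA⟩ := hf
  have hs : Metric.ball ω (min r r₀) ⊆ Metric.ball ω r := Metric.ball_subset_ball (min_le_left _ _)
  have hs₀ : Metric.ball ω (min r r₀) ⊆ Metric.ball ω r₀ :=
    Metric.ball_subset_ball (min_le_right _ _)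
  refine ⟨min r r₀, lt_min hr hr₀, N + 1, Fin.cons 0 α, Fin.cons 0 m,
    Fin.cons g fun l p => A l p * E p, fun l => ?_, fun p hp hpc => ?_⟩
  · refine Fin.cases ?_ (fun l => ?_) l
    · exact hg.mono hs₀
    · exact ((hA l).mono hs).mul (hE.mono hs₀)
  · rw [h p (hs₀ hp) hpc, hfA p (hs hp) hpc, Fin.sum_univ_succ, Finset.sum_mul]
    simp only [Fin.cons_zero, Fin.cons_succ, cpow_zero, pow_zero, mul_one]
    rw [add_comm]
    congr 1
    refine Finset.sum_congr rfl fun l _ => ?_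
    ring

end Frobenius

/-! ### Laplace transforms of entire functions of exponential type. -/

section Laplace

lemma integrableOn_pow_mul_exp_neg {b : ℝ} (hb : 0 < b) (m : ℕ) :
    IntegrableOn (fun t : ℝ => t ^ m * Real.exp (-b * t)) (Ioi 0) := by
  have := integrableOn_rpow_mul_exp_neg_mul_rpow (s := m) (p := 1)
    (by have := Nat.cast_nonneg (α := ℝ) m; linarith) one_pos hb
  simpa using this

lemma integrableOn_pow_mul_cexp_neg {z : ℂ} (hz : 0 < z.re) (m : ℕ) :
    IntegrableOn (fun t : ℝ => (t : ℂ) ^ m * exp (-z * t)) (Ioi 0) := by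
  refine (integrableOn_pow_mul_exp_neg hz m).mono' (by fun_prop) ?_
  refine (ae_restrict_iff' measurableSet_Ioi).2 (Eventually.of_forall fun t ht => ?_)
  rw [norm_mul, norm_pow, norm_real, Real.norm_of_nonneg (le_of_lt ht), Complex.norm_exp]
  simp

lemma integral_pow_mul_cexp_neg {z : ℂ} (hz : 0 < z.re) (m : ℕ) :
    ∫ t in Ioi (0 : ℝ), (t : ℂ) ^ m * exp (-z * t) = m.factorial / z ^ (m + 1) := by
  have hz0 : z ≠ 0 := fun h => by rw [h] at hz; simp at hz
  induction m with
  | zero =>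
    have := integral_exp_mul_complex_Ioi (a := -z) (by simpa using hz) 0
    simp only [pow_zero, one_mul, this]
    simp [neg_div_neg_eq]
  | succ m ih =>
    have hderiv : ∀ t ∈ Ici (0 : ℝ), HasDerivAt (fun t : ℝ => (t : ℂ) ^ (m + 1) * exp (-z * t))
        ((m + 1) * ((t : ℂ) ^ m * exp (-z * t)) - z * ((t : ℂ) ^ (m + 1) * exp (-z * t))) t := by
      intro t _
      have h1 : HasDerivAt (fun t : ℝ => (t : ℂ)) 1 t := Complex.ofRealCLM.hasDerivAt
      have h2 := (h1.pow (m + 1)).mul (h1.const_mul (-z)).cexp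
      refine h2.congr_deriv ?_
      simp
      ring
    have hlim : Tendsto (fun t : ℝ => (t : ℂ) ^ (m + 1) * exp (-z * t)) atTop (𝓝 0) := by
      have h1 := tendsto_rpow_mul_exp_neg_mul_atTop_nhds_zero ((m + 1 : ℕ) : ℝ) z.re hz
      refine squeeze_zero_norm' ?_ h1
      filter_upwards [eventually_ge_atTop 0] with t ht
      rw [norm_mul, norm_pow, norm_real, Real.norm_of_nonneg ht, Complex.norm_exp, Real.rpow_natCast]
      simp
    have hi1 := (integrableOn_pow_mul_cexp_neg hz m).const_mul (m + 1 : ℂ)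
    have hi2 := (integrableOn_pow_mul_cexp_neg hz (m + 1)).const_mul z
    have := integral_Ioi_of_hasDerivAt_of_tendsto' hderiv (hi1.sub hi2) hlim
    rw [integral_sub hi1 hi2, integral_const_mul, integral_const_mul, ih] at this
    simp only [ofReal_zero, ne_eq, Nat.add_eq_zero_iff, one_ne_zero, and_false, not_false_eq_true,
      zero_pow, zero_mul, sub_zero] at this
    rw [Nat.factorial_succ]
    push_cast
    have h2 := sub_eq_zero.1 this
    rw [eq_div_iff (pow_ne_zero _ hz0), pow_succ z (m + 1)]
    rw [mul_div_assoc', div_eq_iff (pow_ne_zero _ hz0)] at h2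
    linear_combination -h2

lemma integral_pow_mul_exp_neg {b : ℝ} (hb : 0 < b) (m : ℕ) :
    ∫ t in Ioi (0 : ℝ), t ^ m * Real.exp (-b * t) = m.factorial / b ^ (m + 1) := by
  have := integral_pow_mul_cexp_neg (z := b) (by simpa using hb) m
  have h2 : ((∫ t in Ioi (0 : ℝ), t ^ m * Real.exp (-b * t) : ℝ) : ℂ)
      = ∫ t in Ioi (0 : ℝ), (t : ℂ) ^ m * exp (-b * t) := by
    rw [← integral_complex_ofReal]
    refine integral_congr_ae (Eventually.of_forall fun t => ?_)
    push_cast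
    rfl
  rw [← ofReal_inj, h2, this]
  push_cast
  rfl

/-- Instead of choosing an optimal radius in Cauchy's estimate, the estimate for all R is integrated
against R^m e^{-bR}. The factor m! then cancels and the bound is exactly geometric in b. -/
lemma norm_iteratedDeriv_le_of_exp_bound {G : ℂ → ℂ} {C a b : ℝ} (hG : Differentiable ℂ G)
    (hC : ∀ p, ‖G p‖ ≤ C * Real.exp (a * ‖p‖)) (hb : 0 < b) (hab : a < b) (m : ℕ) :
    ‖iteratedDeriv m G 0‖ ≤ C / (b - a) * b ^ (m + 1) := by
  have hpt : ∀ R ∈ Ioi (0 : ℝ), ‖iteratedDeriv m G 0‖ * (R ^ m * Real.exp (-b * R)) ≤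
      m.factorial * C * Real.exp (-(b - a) * R) := by
    intro R hR
    have hR0 : (0 : ℝ) < R := hR
    have h1 := norm_iteratedDeriv_le_of_forall_mem_sphere_norm_le (c := 0) (C := C * Real.exp (a * R))
      m hR hG.diffContOnCl fun z hz => by
        have := hC z
        rwa [mem_sphere_zero_iff_norm.1 hz] at this
    rw [le_div_iff₀ (by positivity)] at h1
    calc ‖iteratedDeriv m G 0‖ * (R ^ m * Real.exp (-b * R))
        = ‖iteratedDeriv m G 0‖ * R ^ m * Real.exp (-b * R) := by ring
      _ ≤ m.factorial * (C * Real.exp (a * R)) * Real.exp (-b * R) := by gcongr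
      _ = m.factorial * C * (Real.exp (a * R) * Real.exp (-b * R)) := by ring
      _ = _ := by rw [← Real.exp_add]; ring_nf
  have hi := setIntegral_mono_on ((integrableOn_pow_mul_exp_neg hb m).const_mul _)
    ((exp_neg_integrableOn_Ioi 0 (sub_pos.2 hab)).const_mul (m.factorial * C)) measurableSet_Ioi hpt
  rw [integral_const_mul, integral_const_mul, integral_pow_mul_exp_neg hb,
    integral_exp_mul_Ioi (by linarith : -(b - a) < 0)] at hi
  simp only [mul_zero, Real.exp_zero] at hi
  have hf : (0 : ℝ) < m.factorial := by exact_mod_cast m.factorial_pos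
  have hba : 0 < b - a := sub_pos.2 hab
  rw [mul_div_assoc', div_le_iff₀ (by positivity)] at hi
  have h3 : (m.factorial : ℝ) * C * (-1 / -(b - a)) * b ^ (m + 1)
      = C / (b - a) * b ^ (m + 1) * m.factorial := by
    rw [neg_div_neg_eq]
    field_simp
  rw [h3] at hi
  exact le_of_mul_le_mul_right hi hf

variable {G : ℂ → ℂ} {C a : ℝ}

lemma summable_iteratedDeriv_div (hG : Differentiable ℂ G) (ha : 0 < a)
    (hC : ∀ p, ‖G p‖ ≤ C * Real.exp (a * ‖p‖)) {x : ℂ} (hx : a < ‖x‖) :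
    Summable fun m : ℕ => iteratedDeriv m G 0 / x ^ (m + 1) := by
  obtain ⟨b, hab, hbx⟩ := exists_between hx
  have hb : 0 < b := ha.trans hab
  have hx0 : 0 < ‖x‖ := hb.trans hbx
  refine Summable.of_norm_bounded (g := fun m : ℕ => C / (b - a) * (b / ‖x‖) * (b / ‖x‖) ^ m)
    ((summable_geometric_of_lt_one (by positivity) ((div_lt_one hx0).2 hbx)).mul_left _) fun m => ?_
  rw [norm_div, norm_pow, div_le_iff₀ (by positivity)]
  refine (norm_iteratedDeriv_le_of_exp_bound hG hC hb hab m).trans (le_of_eq ?_)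
  rw [div_pow]
  field_simp
  ring

lemma laplaceConverges_of_exp_bound (hG : Differentiable ℂ G)
    (hC : ∀ p, ‖G p‖ ≤ C * Real.exp (a * ‖p‖)) {φ : ℝ} {x : ℂ} (hx : a < (x * exp (φ * I)).re) :
    LaplaceConverges φ G x := by
  have hGc := hG.continuous
  refine ((exp_neg_integrableOn_Ioi 0 (sub_pos.2 hx)).const_mul C).mono'
    (by unfold laplaceIntegrand; exact (Continuous.aestronglyMeasurable (by fun_prop))) ?_
  refine (ae_restrict_iff' measurableSet_Ioi).2 (Eventually.of_forall fun r hr => ?_)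
  have hn : ‖(r * exp (φ * I) : ℂ)‖ = r := by
    rw [norm_mul, norm_exp_ofReal_mul_I, mul_one, norm_real, Real.norm_of_nonneg (le_of_lt hr)]
  have h1 := hC (r * exp (φ * I))
  rw [hn] at h1
  have h2 : (-x * (r * exp (φ * I))).re = -((x * exp (φ * I)).re * r) := by
    rw [show -x * (r * exp (φ * I)) = -((x * exp (φ * I)) * r) by ring, neg_re, re_mul_ofReal]
  rw [laplaceIntegrand, norm_mul, norm_exp_ofReal_mul_I, mul_one, norm_mul, Complex.norm_exp, h2]
  calc _ ≤ Real.exp (-((x * exp (φ * I)).re * r)) * (C * Real.exp (a * r)) := by gcongr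
    _ = C * (Real.exp (-((x * exp (φ * I)).re * r)) * Real.exp (a * r)) := by ring
    _ = _ := by rw [← Real.exp_add]; ring_nf

/-- The Taylor series is integrated term by term along the ray. Any b strictly between the type a
and Re(x e^{iφ}) makes the norms of the terms a geometric series of ratio b / Re(x e^{iφ}). -/
lemma hasSum_laplace_of_exp_bound (hG : Differentiable ℂ G) (ha : 0 < a)
    (hC : ∀ p, ‖G p‖ ≤ C * Real.exp (a * ‖p‖)) {φ : ℝ} {x : ℂ} (hx : a < (x * exp (φ * I)).re) :
    HasSum (fun m : ℕ => iteratedDeriv m G 0 / x ^ (m + 1)) (laplace φ G x) := by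
  set e : ℂ := exp (φ * I) with he
  have he0 : e ≠ 0 := exp_ne_zero _
  have hen : ‖e‖ = 1 := norm_exp_ofReal_mul_I φ
  set z : ℂ := x * e with hz
  have hz0 : 0 < z.re := ha.trans hx
  obtain ⟨b, hab, hbz⟩ := exists_between hx
  have hb : 0 < b := ha.trans hab
  have hx0 : x ≠ 0 := by
    rintro rfl
    rw [hz, zero_mul, zero_re] at hz0
    exact lt_irrefl _ hz0
  set T : ℕ → ℝ → ℂ := fun m r =>
    iteratedDeriv m G 0 / m.factorial * e ^ (m + 1) * ((r : ℂ) ^ m * exp (-z * r)) with hT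
  have hTi : ∀ m, Integrable (T m) (volume.restrict (Ioi 0)) := fun m =>
    (integrableOn_pow_mul_cexp_neg hz0 m).const_mul _
  have hTint : ∀ m, ∫ r in Ioi 0, T m r = iteratedDeriv m G 0 / x ^ (m + 1) := by
    intro m
    have hf : (m.factorial : ℂ) ≠ 0 := by exact_mod_cast m.factorial_ne_zero
    rw [hT, integral_const_mul, integral_pow_mul_cexp_neg hz0, hz, mul_pow]
    field_simp
  have hTnorm : ∀ m, ∫ r in Ioi 0, ‖T m r‖ ≤ C / (b - a) * (b / z.re) * (b / z.re) ^ m := by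
    intro m
    have hf : (0 : ℝ) < m.factorial := by exact_mod_cast m.factorial_pos
    have h1 : ∫ r in Ioi 0, ‖T m r‖
        = ∫ r in Ioi (0 : ℝ), ‖iteratedDeriv m G 0‖ / m.factorial * (r ^ m * Real.exp (-z.re * r)) := by
      refine setIntegral_congr_fun measurableSet_Ioi fun r hr => ?_
      simp only [hT, norm_mul, norm_div, norm_pow, hen, one_pow, mul_one, norm_natCast, norm_real,
        Real.norm_of_nonneg (le_of_lt (show (0 : ℝ) < r from hr)), Complex.norm_exp, neg_re, mul_re,
        ofReal_re, ofReal_im, mul_zero, sub_zero]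
    rw [h1, integral_const_mul, integral_pow_mul_exp_neg hz0]
    have h2 := norm_iteratedDeriv_le_of_exp_bound hG hC hb hab m
    calc ‖iteratedDeriv m G 0‖ / m.factorial * (m.factorial / z.re ^ (m + 1))
        = ‖iteratedDeriv m G 0‖ / z.re ^ (m + 1) := by field_simp
      _ ≤ C / (b - a) * b ^ (m + 1) / z.re ^ (m + 1) := by gcongr
      _ = _ := by rw [mul_assoc, ← pow_succ', div_pow, mul_div_assoc]
  have hsum : Summable fun m => ∫ r in Ioi 0, ‖T m r‖ :=
    Summable.of_nonneg_of_le (fun m => integral_nonneg fun r => norm_nonneg _) hTnorm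
      ((summable_geometric_of_lt_one (by positivity) ((div_lt_one hz0).2 hbz)).mul_left _)
  have key := hasSum_integral_of_summable_integral_norm hTi hsum
  simp only [hTint] at key
  convert! key using 1
  rw [laplace]
  refine setIntegral_congr_fun measurableSet_Ioi fun r hr => ?_
  have htay := (Complex.hasSum_taylorSeries_of_entire hG 0 (r * e)).mul_left (exp (-z * r) * e)
  rw [laplaceIntegrand, ← he]
  have h4 : exp (-x * (r * e)) * G (r * e) * e = exp (-z * r) * e * G (r * e) := by
    rw [hz, show -x * (r * e) = -(x * e) * r by ring]; ring
  rw [h4, ← htay.tsum_eq]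
  refine tsum_congr fun m => ?_
  simp only [hT, sub_zero, smul_eq_mul]
  rw [mul_pow]
  ring

end Laplace

/-! ### The resurgent element at a single cut. -/

/-- The interior of the half-strip `halfStrip ω u d`. -/
def openStrip (ω u : ℂ) (d : ℝ) : Set ℂ :=
  {p | -d < ((p - ω) / u).re ∧ |((p - ω) / u).im| < d}

/-- The function `F(s) e^{-m s}` in the coordinate `w` given by `s = ω + u w`. -/
noncomputable def transplant (F : ℂ → ℂ) (m ω u w : ℂ) : ℂ :=
  F (ω + u * w) * exp (-m * (ω + u * w))

section Strips

variable {ω u p q : ℂ} {d e η : ℝ}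

lemma isClosed_halfStrip : IsClosed (halfStrip ω u d) :=
  (isClosed_le (f := fun _ => -d) (g := fun p => ((p - ω) / u).re) continuous_const
      (by fun_prop)).inter
    (isClosed_le (f := fun p => |((p - ω) / u).im|) (g := fun _ => d) (by fun_prop) continuous_const)

lemma isOpen_openStrip : IsOpen (openStrip ω u d) :=
  (isOpen_lt (f := fun _ => -d) (g := fun p => ((p - ω) / u).re) continuous_const
      (by fun_prop)).inter
    (isOpen_lt (f := fun p => |((p - ω) / u).im|) (g := fun _ => d) (by fun_prop) continuous_const)

lemma openStrip_subset_halfStrip : openStrip ω u d ⊆ halfStrip ω u d :=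
  fun _ h => ⟨h.1.le, h.2.le⟩

lemma halfStrip_subset_openStrip (h : d < e) : halfStrip ω u d ⊆ openStrip ω u e :=
  fun _ hp => ⟨by linarith [hp.1], hp.2.trans_lt h⟩

lemma halfStrip_mono (h : d ≤ e) : halfStrip ω u d ⊆ halfStrip ω u e :=
  fun _ hp => ⟨by linarith [hp.1], hp.2.trans h⟩

lemma mem_openStrip_of_norm_sub_lt (hu : ‖u‖ = 1) (hp : p ∈ halfStrip ω u d) (h : ‖p - q‖ < η) :
    q ∈ openStrip ω u (d + η) := by
  have hn : ‖(p - ω) / u - (q - ω) / u‖ < η := by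
    rw [← sub_div, sub_sub_sub_cancel_right, norm_div, hu, div_one]
    exact h
  have h1 := (abs_re_le_norm _).trans_lt hn
  have h2 := (abs_im_le_norm _).trans_lt hn
  rw [sub_re, abs_lt] at h1
  rw [sub_im] at h2
  refine ⟨by linarith [hp.1, h1.2], ?_⟩
  have := abs_sub_abs_le_abs_sub ((q - ω) / u).im ((p - ω) / u).im
  rw [abs_sub_comm] at this
  linarith [hp.2]

lemma mem_cut_iff (hu : u ≠ 0) : p ∈ cut ω u ↔ 0 ≤ ((p - ω) / u).re ∧ ((p - ω) / u).im = 0 := by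
  constructor
  · rintro ⟨t, ht, rfl⟩
    rw [add_sub_cancel_left, mul_div_cancel_right₀ _ hu]
    simpa using ht
  · rintro ⟨h1, h2⟩
    refine ⟨((p - ω) / u).re, h1, ?_⟩
    have h3 : (((p - ω) / u).re : ℂ) = (p - ω) / u := Complex.ext (by simp) (by simp [h2])
    rw [h3, div_mul_cancel₀ _ hu, add_sub_cancel]

lemma isClosed_cut (hu : u ≠ 0) : IsClosed (cut ω u) := by
  have : cut ω u = {p | 0 ≤ ((p - ω) / u).re} ∩ {p | ((p - ω) / u).im = 0} := by
    ext p; exact mem_cut_iff hu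
  rw [this]
  exact (isClosed_le continuous_const (by fun_prop)).inter
    (isClosed_eq (by fun_prop) continuous_const)

lemma cut_subset_halfStrip (hu : u ≠ 0) (hd : 0 ≤ d) : cut ω u ⊆ halfStrip ω u d := fun p hp => by
  rw [mem_cut_iff hu] at hp
  exact ⟨by linarith [hp.1], by rw [hp.2, abs_zero]; exact hd⟩

lemma exists_mem_cut_norm_sub_le (hu : ‖u‖ = 1) (hp : p ∈ halfStrip ω u d) :
    ∃ q ∈ cut ω u, ‖p - q‖ ≤ 2 * d := by
  have hu0 : u ≠ 0 := norm_pos_iff.1 (by rw [hu]; exact one_pos)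
  set w := (p - ω) / u with hw
  have hd : 0 ≤ d := (abs_nonneg _).trans hp.2
  refine ⟨ω + (max w.re 0 : ℝ) * u, ⟨_, le_max_right _ _, rfl⟩, ?_⟩
  have h1 : p - (ω + (max w.re 0 : ℝ) * u) = (w - (max w.re 0 : ℝ)) * u := by
    rw [sub_mul, hw, div_mul_cancel₀ _ hu0]; ring
  rw [h1, norm_mul, hu, mul_one]
  refine (Complex.norm_le_abs_re_add_abs_im _).trans ?_
  rw [sub_re, sub_im, ofReal_re, ofReal_im, sub_zero]
  have h2 : |w.re - max w.re 0| ≤ d := by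
    have h3 : -d ≤ w.re := hp.1
    rcases le_total w.re 0 with h | h
    · rw [max_eq_right h, sub_zero, abs_of_nonpos h]; linarith
    · rw [max_eq_left h, sub_self, abs_zero]; exact hd
  linarith [hp.2]

lemma le_norm_sub_of_mem_stripFrame_of_lt {s w : ℂ} (hs : s ∈ stripFrame d)
    (hw : ¬(-e ≤ w.re ∧ |w.im| ≤ e)) : e - d ≤ ‖s - w‖ := by
  by_contra! hcon
  have h1 := (abs_re_le_norm _).trans_lt hcon
  have h2 := (abs_im_le_norm _).trans_lt hcon
  rw [sub_re, abs_lt] at h1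
  rw [sub_im] at h2
  have := abs_sub_abs_le_abs_sub w.im s.im
  rw [abs_sub_comm] at this
  exact hw ⟨by linarith [hs.1], by linarith [hs.2.1]⟩

lemma le_norm_sub_of_mem_stripFrame_of_gt {s w : ℂ} (hs : s ∈ stripFrame d)
    (hw : -e ≤ w.re ∧ |w.im| ≤ e) : d - e ≤ ‖s - w‖ := by
  by_contra! hcon
  have h1 := (abs_re_le_norm _).trans_lt hcon
  have h2 := (abs_im_le_norm _).trans_lt hcon
  rw [sub_re, abs_lt] at h1
  rw [sub_im] at h2
  have := abs_sub_abs_le_abs_sub s.im w.im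
  exact hs.2.2 ⟨by linarith [hw.1], by linarith [hw.2]⟩

end Strips

/-- The Cauchy kernel ds/(s - p) is invariant under s = ω + u w, so every contour reduces to the one
around [0, ∞). -/
lemma hankelCauchy_eq_stripCauchy {F : ℂ → ℂ} {m ω u p : ℂ} {d : ℝ} (hu : u ≠ 0) :
    hankelCauchy F m ω u d p = stripCauchy (transplant F m ω u) d ((p - ω) / u) := by
  have key : ∀ w : ℂ, F (ω + u * w) * exp (-m * (ω + u * w)) / (ω + u * w - p) * u
      = transplant F m ω u w / (w - (p - ω) / u) := by
    intro w
    have : ω + u * w - p = u * (w - (p - ω) / u) := by field_simp; ring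
    rw [this, transplant, div_mul_eq_mul_div, mul_comm _ u, mul_div_mul_left _ _ hu]
  rw [hankelCauchy, stripCauchy, hankel, stripInt]
  simp only [key, ← mul_assoc]
  congr 2
  rw [intervalIntegral.integral_mul_const, mul_comm I]

/-- The regular part of the element at `ω`: the Cauchy integral over the wider contour. -/
noncomputable def regPart (F : ℂ → ℂ) (m ω u : ℂ) (d : ℝ) (p : ℂ) : ℂ :=
  stripCauchy (transplant F m ω u) d ((p - ω) / u)

open Classical in
/-- The resurgent element at `ω`: the Cauchy integral over the boundary of the half-strip of
half-width `d`, continued to the half-strip. -/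
noncomputable def element (F : ℂ → ℂ) (m ω u : ℂ) (d : ℝ) (p : ℂ) : ℂ :=
  if p ∈ halfStrip ω u d then regPart F m ω u (2 * d) p + F p * exp (-m * p)
  else regPart F m ω u d p

/-- The data needed for the construction of the element of `F` at a single singular point. -/
structure SingleCut (F : ℂ → ℂ) (O : Set ℂ) (m ω u : ℂ) (d ε B : ℝ) : Prop where
  norm_dir : ‖u‖ = 1
  width_pos : 0 < d
  rate_pos : 0 < ε
  isOpen : IsOpen O
  holo : DifferentiableOn ℂ F O
  subset : openStrip ω u (3 * d) \ cut ω u ⊆ O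
  bound : ∀ w ∈ stripRegion d (2 * d), ‖transplant F m ω u w‖ ≤ B * Real.exp (-ε * w.re)

namespace SingleCut

variable {F : ℂ → ℂ} {O : Set ℂ} {m ω u p : ℂ} {d ε B : ℝ}

lemma dir_ne (h : SingleCut F O m ω u d ε B) : u ≠ 0 :=
  norm_pos_iff.1 (by rw [h.norm_dir]; exact one_pos)

lemma stripRegion_subset (h : SingleCut F O m ω u d ε B) :
    stripRegion d (2 * d) ⊆ (fun w => ω + u * w) ⁻¹' O := by
  intro w hw
  have hd := h.width_pos
  have hww : (ω + u * w - ω) / u = w := by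
    rw [add_sub_cancel_left, mul_div_cancel_left₀ _ h.dir_ne]
  refine h.subset ⟨⟨?_, ?_⟩, fun hc => ?_⟩
  · rw [hww]; linarith [hw.1]
  · rw [hww]; linarith [hw.2.1]
  · rw [mem_cut_iff h.dir_ne, hww] at hc
    exact hw.2.2 ⟨by linarith [hc.1], by rw [hc.2, abs_zero]; exact hd⟩

lemma isOpen_preimage (h : SingleCut F O m ω u d ε B) :
    IsOpen ((fun w => ω + u * w) ⁻¹' O) := h.isOpen.preimage (by fun_prop)

lemma holo_transplant (h : SingleCut F O m ω u d ε B) :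
    DifferentiableOn ℂ (transplant F m ω u) ((fun w => ω + u * w) ⁻¹' O) := by
  unfold transplant
  refine DifferentiableOn.mul ?_ (by fun_prop)
  exact h.holo.comp (by fun_prop) fun w hw => hw

lemma continuousOn_inner (h : SingleCut F O m ω u d ε B) :
    ContinuousOn (transplant F m ω u) (stripFrame d) :=
  h.holo_transplant.continuousOn.mono
    ((stripFrame_inner_subset (by linarith [h.width_pos])).trans h.stripRegion_subset)

lemma continuousOn_outer (h : SingleCut F O m ω u d ε B) :
    ContinuousOn (transplant F m ω u) (stripFrame (2 * d)) :=
  h.holo_transplant.continuousOn.mono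
    ((stripFrame_outer_subset (by linarith [h.width_pos])).trans h.stripRegion_subset)

lemma bound_inner (h : SingleCut F O m ω u d ε B) :
    ∀ w ∈ stripFrame d, ‖transplant F m ω u w‖ ≤ B * Real.exp (-ε * w.re) := fun w hw =>
  h.bound w (stripFrame_inner_subset (by linarith [h.width_pos]) hw)

lemma bound_outer (h : SingleCut F O m ω u d ε B) :
    ∀ w ∈ stripFrame (2 * d), ‖transplant F m ω u w‖ ≤ B * Real.exp (-ε * w.re) := fun w hw =>
  h.bound w (stripFrame_outer_subset (by linarith [h.width_pos]) hw)

lemma bound_nonneg (h : SingleCut F O m ω u d ε B) : 0 ≤ B :=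
  Resurgence.bound_nonneg h.width_pos h.bound_inner

lemma transplant_coord (h : SingleCut F O m ω u d ε B) (p : ℂ) :
    transplant F m ω u ((p - ω) / u) = F p * exp (-m * p) := by
  have : ω + u * ((p - ω) / u) = p := by rw [mul_div_cancel₀ _ h.dir_ne, add_sub_cancel]
  rw [transplant, this]

lemma differentiableAt_coord {g : ℂ → ℂ} (hg : DifferentiableAt ℂ g ((p - ω) / u)) :
    DifferentiableAt ℂ (fun p => g ((p - ω) / u)) p :=
  DifferentiableAt.comp (g := g) p hg
    (by fun_prop : DifferentiableAt ℂ (fun p : ℂ => (p - ω) / u) p)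

lemma differentiableAt_regPart_inner (h : SingleCut F O m ω u d ε B) (hp : p ∉ halfStrip ω u d) :
    DifferentiableAt ℂ (regPart F m ω u d) p := by
  obtain ⟨ρ, hρ, hball⟩ := Metric.isOpen_iff.1 (isClosed_halfStrip (ω := ω) (u := u) (d := d)).isOpen_compl p hp
  refine differentiableAt_coord (differentiableAt_stripCauchy h.width_pos h.rate_pos
    h.continuousOn_inner h.bound_inner hρ fun s hs => ?_)
  by_contra! hcon
  have hs' : ω + u * s ∈ Metric.ball p ρ := by
    rw [mem_ball_iff_norm]
    have : ω + u * s - p = u * (s - (p - ω) / u) := by have := h.dir_ne; field_simp; ring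
    rwa [this, norm_mul, h.norm_dir, one_mul]
  refine hball hs' ?_
  have hss : (ω + u * s - ω) / u = s := by
    rw [add_sub_cancel_left, mul_div_cancel_left₀ _ h.dir_ne]
  exact ⟨by rw [hss]; exact hs.1, by rw [hss]; exact hs.2.1⟩

lemma differentiableAt_regPart_outer (h : SingleCut F O m ω u d ε B)
    (hp : p ∈ openStrip ω u (2 * d)) :
    DifferentiableAt ℂ (regPart F m ω u (2 * d)) p := by
  obtain ⟨ρ, hρ, hball⟩ := Metric.isOpen_iff.1 (isOpen_openStrip (ω := ω) (u := u) (d := 2 * d)) p hp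
  refine differentiableAt_coord (differentiableAt_stripCauchy (by linarith [h.width_pos])
    h.rate_pos h.continuousOn_outer h.bound_outer hρ fun s hs => ?_)
  by_contra! hcon
  have hs' : ω + u * s ∈ Metric.ball p ρ := by
    rw [mem_ball_iff_norm]
    have : ω + u * s - p = u * (s - (p - ω) / u) := by have := h.dir_ne; field_simp; ring
    rwa [this, norm_mul, h.norm_dir, one_mul]
  have hss : (ω + u * s - ω) / u = s := by
    rw [add_sub_cancel_left, mul_div_cancel_left₀ _ h.dir_ne]
  have := hball hs'
  rw [openStrip, mem_ofPred_eq, hss] at this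
  exact hs.2.2 this

lemma element_of_notMem (hp : p ∉ halfStrip ω u d) :
    element F m ω u d p = regPart F m ω u d p := if_neg hp

/-- On the collar between half-widths d and 2d the two defining formulas agree by the jump of the
Cauchy integral. This consistency is what makes `element` an analytic continuation and not merely a
definition by cases. -/
lemma element_of_mem_openStrip (h : SingleCut F O m ω u d ε B) (hp : p ∈ openStrip ω u (2 * d)) :
    element F m ω u d p = regPart F m ω u (2 * d) p + F p * exp (-m * p) := by
  by_cases hpd : p ∈ halfStrip ω u d
  · exact if_pos hpd
  · rw [element_of_notMem hpd, regPart, regPart, ← h.transplant_coord p]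
    exact stripCauchy_eq_add h.width_pos (by linarith [h.width_pos]) h.rate_pos h.isOpen_preimage
      h.stripRegion_subset h.holo_transplant h.bound hp.1 hp.2 hpd

lemma differentiableAt_element (h : SingleCut F O m ω u d ε B) (hp : p ∉ cut ω u) :
    DifferentiableAt ℂ (element F m ω u d) p := by
  have hd := h.width_pos
  by_cases hp2 : p ∈ halfStrip ω u d
  · have hpo := halfStrip_subset_openStrip (show d < 2 * d by linarith) hp2
    have hpO : p ∈ O := h.subset ⟨halfStrip_subset_openStrip (by linarith) hp2, hp⟩
    have h1 : DifferentiableAt ℂ (fun p => regPart F m ω u (2 * d) p + F p * exp (-m * p)) p :=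
      (h.differentiableAt_regPart_outer hpo).add
        ((h.holo.differentiableAt (h.isOpen.mem_nhds hpO)).mul (by fun_prop))
    refine h1.congr_of_eventuallyEq ?_
    filter_upwards [isOpen_openStrip.mem_nhds hpo] with q hq using h.element_of_mem_openStrip hq
  · refine (h.differentiableAt_regPart_inner hp2).congr_of_eventuallyEq ?_
    filter_upwards [isClosed_halfStrip.isOpen_compl.mem_nhds hp2] with q hq
      using element_of_notMem hq

/-- The constant of the bounds for the element and its regular part. -/
noncomputable def boundConst (d ε : ℝ) : ℝ :=
  2 * Real.exp (ε * (2 * d)) * (1 / ε + 2 * d) / (d / 2)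

/-- The boundary of the strip of half-width 3d/2 runs midway between the two contours. Using the
inner contour outside this strip and the outer contour inside it keeps p at distance at least d/2
from the contour in use, which makes the bounds uniform. -/
lemma frame_inner (hp : p ∉ halfStrip ω u (3 / 2 * d)) :
    ∀ s ∈ stripFrame d, d / 2 ≤ ‖s - (p - ω) / u‖ := fun _ hs =>
  (by linarith : d / 2 ≤ 3 / 2 * d - d).trans (le_norm_sub_of_mem_stripFrame_of_lt hs hp)

lemma frame_outer (hp : p ∈ halfStrip ω u (3 / 2 * d)) :
    ∀ s ∈ stripFrame (2 * d), d / 2 ≤ ‖s - (p - ω) / u‖ := fun _ hs =>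
  (by linarith : d / 2 ≤ 2 * d - 3 / 2 * d).trans (le_norm_sub_of_mem_stripFrame_of_gt hs hp)

lemma norm_element_le (h : SingleCut F O m ω u d ε B) (hp : p ∉ halfStrip ω u (3 / 2 * d)) :
    ‖element F m ω u d p‖ ≤ boundConst d ε * B := by
  have hd := h.width_pos
  have hε := h.rate_pos
  have hB := h.bound_nonneg
  rw [element_of_notMem fun hp' => hp (halfStrip_mono (by linarith) hp'), regPart]
  refine (norm_stripCauchy_le hd hε h.continuousOn_inner h.bound_inner (half_pos hd)
    (frame_inner hp)).trans ?_
  unfold boundConst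
  gcongr <;> linarith

lemma norm_regPart_le (h : SingleCut F O m ω u d ε B) (hp : p ∈ halfStrip ω u (3 / 2 * d)) :
    ‖regPart F m ω u (2 * d) p‖ ≤ boundConst d ε * B :=
  norm_stripCauchy_le (by linarith [h.width_pos]) h.rate_pos h.continuousOn_outer h.bound_outer
    (half_pos h.width_pos) (frame_outer hp)

lemma exists_decay (h : SingleCut F O m ω u d ε B) : ∃ C,
    (∀ p, p ∉ halfStrip ω u (3 / 2 * d) → ‖p - ω‖ * ‖element F m ω u d p‖ ≤ C) ∧
    ∀ p, p ∈ halfStrip ω u (3 / 2 * d) → ‖p - ω‖ * ‖regPart F m ω u (2 * d) p‖ ≤ C := by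
  have hd := h.width_pos
  have hn : ∀ p, ‖(p - ω) / u‖ = ‖p - ω‖ := fun p => by rw [norm_div, h.norm_dir, div_one]
  obtain ⟨C₁, hC₁⟩ := exists_norm_mul_stripCauchy_le hd h.rate_pos h.continuousOn_inner
    h.bound_inner (half_pos hd)
  obtain ⟨C₂, hC₂⟩ := exists_norm_mul_stripCauchy_le (by linarith) h.rate_pos h.continuousOn_outer
    h.bound_outer (half_pos hd)
  refine ⟨max C₁ C₂, fun p hp => ?_, fun p hp => ?_⟩
  · rw [element_of_notMem fun hp' => hp (halfStrip_mono (by linarith) hp'), regPart, ← hn]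
    exact (hC₁ _ (frame_inner hp)).trans (le_max_left _ _)
  · rw [regPart, ← hn]
    exact (hC₂ _ (frame_outer hp)).trans (le_max_right _ _)

lemma continuesAcross_element (h : SingleCut F O m ω u d ε B) (hF : ContinuesAcross F ω u) :
    ContinuesAcross (element F m ω u d) ω u := by
  intro q hq hqω
  have hd := h.width_pos
  obtain ⟨r, hr, fl, fr, hfl, hfr, hl, hrr⟩ := hF q hq hqω
  have hqo : q ∈ openStrip ω u (2 * d) :=
    halfStrip_subset_openStrip (by linarith) (cut_subset_halfStrip h.dir_ne hd.le hq)
  obtain ⟨r', hr', hball⟩ := Metric.isOpen_iff.1 isOpen_openStrip q hqo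
  have hsub : Metric.ball q (min r r') ⊆ Metric.ball q r :=
    Metric.ball_subset_ball (min_le_left _ _)
  have hsub' : Metric.ball q (min r r') ⊆ openStrip ω u (2 * d) :=
    (Metric.ball_subset_ball (min_le_right _ _)).trans hball
  have hreg : DifferentiableOn ℂ (regPart F m ω u (2 * d)) (Metric.ball q (min r r')) :=
    fun p hp => (h.differentiableAt_regPart_outer (hsub' hp)).differentiableWithinAt
  refine ⟨min r r', lt_min hr hr', fun p => regPart F m ω u (2 * d) p + fl p * exp (-m * p),
    fun p => regPart F m ω u (2 * d) p + fr p * exp (-m * p), ?_, ?_, fun p hp hi => ?_,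
    fun p hp hi => ?_⟩
  · exact hreg.add ((hfl.mono hsub).mul (by fun_prop))
  · exact hreg.add ((hfr.mono hsub).mul (by fun_prop))
  · rw [h.element_of_mem_openStrip (hsub' hp), hl p (hsub hp) hi]
  · rw [h.element_of_mem_openStrip (hsub' hp), hrr p (hsub hp) hi]

lemma isFrobeniusAt_element (h : SingleCut F O m ω u d ε B) (hF : IsFrobeniusAt F ω u) :
    IsFrobeniusAt (element F m ω u d) ω u := by
  have hd := h.width_pos
  have hωo : ω ∈ openStrip ω u (2 * d) :=
    halfStrip_subset_openStrip (by linarith) (cut_subset_halfStrip h.dir_ne hd.le (self_mem_cut ω u))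
  obtain ⟨r, hr, hball⟩ := Metric.isOpen_iff.1 isOpen_openStrip ω hωo
  refine hF.mul_add hr (E := fun p => exp (-m * p)) (g := regPart F m ω u (2 * d)) (by fun_prop)
    (fun p hp => (h.differentiableAt_regPart_outer (hball hp)).differentiableWithinAt)
    fun p hp _ => ?_
  rw [h.element_of_mem_openStrip (hball hp), add_comm]

/-- The element of `F` at `ω` is a resurgent element. -/
lemma isElement (h : SingleCut F O m ω u d ε B) (hac : ContinuesAcross F ω u)
    (hF : IsFrobeniusAt F ω u)
    (hdec : ∃ C R : ℝ, ∀ p ∈ halfStrip ω u (2 * d), p ∉ cut ω u → R ≤ ((p - ω) / u).re →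
      ‖p - ω‖ * ‖F p * exp (-m * p)‖ ≤ C) :
    IsElement (element F m ω u d) ω u where
  holo := fun p hp => (h.differentiableAt_element hp).differentiableWithinAt
  across := h.continuesAcross_element hac
  regular := h.isFrobeniusAt_element hF
  bounded := (h.isFrobeniusAt_element hF).exists_bound h.norm_dir
  decay := by
    have hd := h.width_pos
    obtain ⟨C₁, hC₁, hC₁'⟩ := h.exists_decay
    obtain ⟨C₂, R, hC₂⟩ := hdec
    -- Inside the strip of half-width 3d/2 the coordinate has real part at least -3d/2, so a point
    -- this far from the origin must lie far out in the direction of the cut, where the hypothesis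
    -- on F applies.
    have key : ∀ p, p ∉ cut ω u → ‖ω‖ + |R| + 4 * d ≤ ‖p‖ →
        ‖p - ω‖ * ‖element F m ω u d p‖ ≤ |C₁| + |C₂| := by
      intro p hp hpR
      by_cases hp2 : p ∈ halfStrip ω u (3 / 2 * d)
      · have hp3 := halfStrip_subset_openStrip (show 3 / 2 * d < 2 * d by linarith) hp2
        have hre : R ≤ ((p - ω) / u).re := by
          have h1 : ‖p‖ ≤ ‖p - ω‖ + ‖ω‖ := by simpa using norm_add_le (p - ω) ω
          have h2 := Complex.norm_le_abs_re_add_abs_im ((p - ω) / u)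
          rw [norm_div, h.norm_dir, div_one] at h2
          have h3 := hp2.1
          have h4 := hp2.2
          have h5 := le_abs_self R
          have h6 := abs_nonneg R
          rcases abs_cases ((p - ω) / u).re with h7 | h7 <;> linarith
        rw [h.element_of_mem_openStrip hp3]
        calc ‖p - ω‖ * ‖regPart F m ω u (2 * d) p + F p * exp (-m * p)‖
            ≤ ‖p - ω‖ * (‖regPart F m ω u (2 * d) p‖ + ‖F p * exp (-m * p)‖) := by
              gcongr
              exact norm_add_le _ _
          _ = ‖p - ω‖ * ‖regPart F m ω u (2 * d) p‖ + ‖p - ω‖ * ‖F p * exp (-m * p)‖ := by ring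
          _ ≤ |C₁| + |C₂| := add_le_add ((hC₁' p hp2).trans (le_abs_self _))
              ((hC₂ p (openStrip_subset_halfStrip hp3) hp hre).trans (le_abs_self _))
      · linarith [hC₁ p hp2, le_abs_self C₁, abs_nonneg C₂]
    -- The term 2‖ω‖ ensures ‖p‖ ≤ 2 ‖p - ω‖, which converts decay in the distance from ω into decay
    -- in the distance from 0.
    refine ⟨2 * (|C₁| + |C₂|), 2 * ‖ω‖ + |R| + 4 * d, by positivity, fun p hp hpR => ?_⟩
    have h0 : 0 < ‖p‖ := by
      have := norm_nonneg ω
      have := abs_nonneg R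
      linarith
    rw [le_div_iff₀ h0]
    have h1 := key p hp (by linarith [norm_nonneg ω])
    have h2 : ‖p‖ ≤ 2 * ‖p - ω‖ := by
      have h3 : ‖p‖ ≤ ‖p - ω‖ + ‖ω‖ := by simpa using norm_add_le (p - ω) ω
      have := abs_nonneg R
      linarith
    calc ‖element F m ω u d p‖ * ‖p‖ ≤ ‖element F m ω u d p‖ * (2 * ‖p - ω‖) := by gcongr
      _ = 2 * (‖p - ω‖ * ‖element F m ω u d p‖) := by ring
      _ ≤ _ := by gcongr

end SingleCut

/-! ### A sheet with many separated cuts: summation of the elements and the entire remainder. -/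

/-- The plane without the cuts `ω i + u i [0, ∞)`. -/
def slitSheet {ι : Type*} (ω u : ι → ℂ) : Set ℂ := {p | ∀ i, p ∉ cut (ω i) (u i)}

lemma finite_norm_le_of_summable {ι : Type*} {ω : ι → ℂ}
    (h : Summable fun i => Real.exp (-1 * ‖ω i‖)) (R : ℝ) : {i | ‖ω i‖ ≤ R}.Finite := by
  have h2 := h.tendsto_cofinite_zero.eventually_lt_const (Real.exp_pos (-1 * R))
  rw [eventually_cofinite] at h2
  refine h2.subset fun i hi => ?_
  simp only [mem_ofPred_eq, not_lt] at hi ⊢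
  exact Real.exp_le_exp.2 (by linarith)

/-- A cut is nowhere closer to 0 than its starting point, and only finitely many starting points lie
in a given disk, so the family of closed cuts is locally finite. -/
lemma isOpen_slitSheet_of_summable {ι : Type*} {ω u : ι → ℂ} (hu : ∀ i, u i ≠ 0)
    (hn : ∀ i, ∀ q ∈ cut (ω i) (u i), ‖ω i‖ ≤ ‖q‖)
    (hs : Summable fun i => Real.exp (-1 * ‖ω i‖)) : IsOpen (slitSheet ω u) := by
  have hlf : LocallyFinite fun i => cut (ω i) (u i) := by
    intro p
    refine ⟨Metric.ball p 1, Metric.ball_mem_nhds p one_pos,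
      (finite_norm_le_of_summable hs (‖p‖ + 1)).subset ?_⟩
    rintro i ⟨q, hq, hqp⟩
    rw [mem_ball_iff_norm] at hqp
    have h1 := hn i q hq
    have h2 : ‖q‖ ≤ ‖q - p‖ + ‖p‖ := by simpa using norm_add_le (q - p) p
    simp only [mem_ofPred_eq]
    linarith
  have h1 := hlf.isClosed_iUnion fun i => isClosed_cut (hu i)
  have h2 : slitSheet ω u = (⋃ i, cut (ω i) (u i))ᶜ := by
    ext p
    simp [slitSheet]
  rw [h2]
  exact h1.isOpen_compl

/-- A function on a sheet with uniformly separated straight cuts, with the properties from which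
the decomposition into resurgent elements follows. -/
structure CutSystem {ι : Type*} (F : ℂ → ℂ) (ω u : ι → ℂ) (ν μ σ d : ℝ) (M : ℝ≥0) : Prop where
  norm_dir : ∀ i, ‖u i‖ = 1
  width_pos : 0 < d
  nu_pos : 0 < ν
  nu_lt_mu : ν < μ
  nu_lt : ν < μ * σ
  cos_le_one : σ ≤ 1
  re_div : ∀ i, (ω i / u i).re = σ * ‖ω i‖
  -- A strip of half-width e lies within 2e of its cut. The factor 16 leaves room for the
  -- disjointness of strips of half-width 2d and for strips of half-width 3d to avoid foreign cuts.
  separated : ∀ i i', i ≠ i' → ∀ q ∈ cut (ω i) (u i), ∀ q' ∈ cut (ω i') (u i'), 16 * d ≤ ‖q - q'‖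
  norm_le : ∀ i, ∀ q ∈ cut (ω i) (u i), ‖ω i‖ ≤ ‖q‖
  ray : ∀ i (φ : ℝ), {r : ℝ | (r * exp (φ * I) : ℂ) ∈ cut (ω i) (u i)}.Subsingleton
  summable : ∀ b : ℝ, 0 < b → Summable fun i => Real.exp (-b * ‖ω i‖)
  holo : DifferentiableOn ℂ F (slitSheet ω u)
  frobenius : ∀ i, IsFrobeniusAt F (ω i) (u i)
  across : ∀ i, ContinuesAcross F (ω i) (u i)
  -- The weighted norm gives no pointwise control next to a cut, so this bound is a separate
  -- condition; it serves the decay of the element inside its own strip.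
  near : ∀ i, ∃ C R : ℝ, ∀ p ∈ halfStrip (ω i) (u i) (2 * d), p ∉ cut (ω i) (u i) →
    R ≤ ((p - ω i) / u i).re → ‖F p‖ ≤ C * Real.exp (ν * ‖p‖)
  growth : rayNorm ν F ≤ M

namespace CutSystem

variable {ι : Type*} {F : ℂ → ℂ} {ω u : ι → ℂ} {ν μ σ d : ℝ} {M : ℝ≥0}

lemma dir_ne (h : CutSystem F ω u ν μ σ d M) (i : ι) : u i ≠ 0 :=
  norm_pos_iff.1 (by rw [h.norm_dir]; exact one_pos)

lemma mu_pos (h : CutSystem F ω u ν μ σ d M) : 0 < μ := h.nu_pos.trans h.nu_lt_mu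

lemma finite_norm_le (h : CutSystem F ω u ν μ σ d M) (R : ℝ) : {i | ‖ω i‖ ≤ R}.Finite :=
  finite_norm_le_of_summable (h.summable 1 one_pos) R

lemma isOpen_slitSheet (h : CutSystem F ω u ν μ σ d M) : IsOpen (slitSheet ω u) :=
  isOpen_slitSheet_of_summable h.dir_ne h.norm_le (h.summable 1 one_pos)

lemma le_norm_sub_of_mem_halfStrip (h : CutSystem F ω u ν μ σ d M) {i i' : ι} (hi : i ≠ i')
    {e : ℝ} {p q : ℂ} (hp : p ∈ halfStrip (ω i) (u i) e) (hq : q ∈ cut (ω i') (u i')) :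
    16 * d - 2 * e ≤ ‖p - q‖ := by
  obtain ⟨q', hq', hpq'⟩ := exists_mem_cut_norm_sub_le (h.norm_dir i) hp
  have h1 := h.separated i i' hi q' hq' q hq
  have h2 : ‖q' - q‖ ≤ ‖q' - p‖ + ‖p - q‖ := norm_sub_le_norm_sub_add_norm_sub _ _ _
  rw [norm_sub_rev q' p] at h2
  linarith

lemma disjoint_halfStrip (h : CutSystem F ω u ν μ σ d M) {i i' : ι} (hi : i ≠ i') :
    Disjoint (halfStrip (ω i) (u i) (2 * d)) (halfStrip (ω i') (u i') (2 * d)) := by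
  rw [Set.disjoint_left]
  intro p hp hp'
  obtain ⟨q', hq', hpq'⟩ := exists_mem_cut_norm_sub_le (h.norm_dir i') hp'
  have h1 := h.le_norm_sub_of_mem_halfStrip hi hp hq'
  linarith [h.width_pos]

lemma norm_sub_le_of_mem_halfStrip (h : CutSystem F ω u ν μ σ d M) {i : ι} {e : ℝ} {p : ℂ}
    (hp : p ∈ halfStrip (ω i) (u i) e) : ‖ω i‖ - 2 * e ≤ ‖p‖ := by
  obtain ⟨q', hq', hpq'⟩ := exists_mem_cut_norm_sub_le (h.norm_dir i) hp
  have h1 := h.norm_le i q' hq'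
  have h2 : ‖q'‖ ≤ ‖q' - p‖ + ‖p‖ := by simpa using norm_add_le (q' - p) p
  rw [norm_sub_rev q' p] at h2
  linarith

lemma notMem_cut_of_notMem_openStrip (h : CutSystem F ω u ν μ σ d M) {i : ι} {p q : ℂ}
    (hp : p ∉ openStrip (ω i) (u i) d) (hq : q ∈ Metric.ball p d) : q ∉ cut (ω i) (u i) := by
  intro hc
  rw [mem_ball_iff_norm] at hq
  have := mem_openStrip_of_norm_sub_lt (h.norm_dir i)
    (cut_subset_halfStrip (h.dir_ne i) le_rfl hc) hq
  rw [zero_add] at this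
  exact hp this

lemma ball_subset_slitSheet (h : CutSystem F ω u ν μ σ d M) {p : ℂ}
    (hp : ∀ i, p ∉ openStrip (ω i) (u i) d) : Metric.ball p d ⊆ slitSheet ω u :=
  fun _ hq i => h.notMem_cut_of_notMem_openStrip (hp i) hq

lemma ball_subset_slitSheet_of_mem (h : CutSystem F ω u ν μ σ d M) {p : ℂ} {i : ι}
    (hp : p ∈ halfStrip (ω i) (u i) (2 * d)) (hpo : p ∉ openStrip (ω i) (u i) d) :
    Metric.ball p d ⊆ slitSheet ω u := by
  refine h.ball_subset_slitSheet fun i' hi' => ?_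
  rcases eq_or_ne i i' with rfl | hne
  · exact hpo hi'
  · exact Set.disjoint_left.1 (h.disjoint_halfStrip hne) hp
      (halfStrip_mono (by linarith [h.width_pos]) (openStrip_subset_halfStrip hi'))

/-- The constant of the pointwise bound for `F` away from the cuts. -/
noncomputable def growthConst (ν d : ℝ) (M : ℝ≥0) : ℝ := 6 / d * Real.exp (ν * d) * M

lemma growthConst_nonneg (h : CutSystem F ω u ν μ σ d M) : 0 ≤ growthConst ν d M := by
  have := h.width_pos
  unfold growthConst
  positivity

lemma norm_le_of_ball_subset (h : CutSystem F ω u ν μ σ d M) {p : ℂ}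
    (hp : Metric.ball p d ⊆ slitSheet ω u) : ‖F p‖ ≤ growthConst ν d M * Real.exp (ν * ‖p‖) :=
  norm_le_of_rayNorm_le h.nu_pos.le h.width_pos h.growth (h.holo.mono hp)

/-- The growth e^{ν|s|} of F competes with |e^{-(μ/u)s}| = e^{-μ(σ|ω| + Re w)}. What is left is
decay at rate μ - ν along the strip, and a constant that is exponentially small in |ω| because μσ >
ν. -/
lemma singleCut (h : CutSystem F ω u ν μ σ d M) (i : ι) :
    SingleCut F (slitSheet ω u) (μ / u i) (ω i) (u i) d (μ - ν)
      (growthConst ν d M * Real.exp (6 * ν * d) * Real.exp (-(μ * σ - ν) * ‖ω i‖)) where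
  norm_dir := h.norm_dir i
  width_pos := h.width_pos
  rate_pos := sub_pos.2 h.nu_lt_mu
  isOpen := h.isOpen_slitSheet
  holo := h.holo
  subset := by
    rintro p ⟨hp, hpc⟩ i' hi'
    rcases eq_or_ne i i' with rfl | hne
    · exact hpc hi'
    · have := h.le_norm_sub_of_mem_halfStrip hne (openStrip_subset_halfStrip hp) hi'
      rw [sub_self, norm_zero] at this
      linarith [h.width_pos]
  bound := by
    intro w hw
    have hd := h.width_pos
    have hww : (ω i + u i * w - ω i) / u i = w := by
      rw [add_sub_cancel_left, mul_div_cancel_left₀ _ (h.dir_ne i)]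
    have h1 := h.norm_le_of_ball_subset (h.ball_subset_slitSheet_of_mem
      (p := ω i + u i * w) (i := i) (by rw [halfStrip, mem_ofPred_eq, hww]; exact ⟨hw.1, hw.2.1⟩)
      (by rw [openStrip, mem_ofPred_eq, hww]; exact hw.2.2))
    -- Here Re w ≥ -2d gives |Re w| ≤ Re w + 4d, and |Im w| ≤ 2d accounts for the rest of 6d.
    have h2 : ‖ω i + u i * w‖ ≤ ‖ω i‖ + (w.re + 6 * d) := by
      refine (norm_add_le _ _).trans ?_
      rw [norm_mul, h.norm_dir, one_mul]
      gcongr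
      refine (Complex.norm_le_abs_re_add_abs_im w).trans ?_
      have := hw.1
      have := hw.2.1
      rcases abs_cases w.re with h3 | h3 <;> linarith
    have h3 : (-(μ / u i) * (ω i + u i * w)).re = -μ * (σ * ‖ω i‖ + w.re) := by
      have : -(μ / u i) * (ω i + u i * w) = ((-μ : ℝ) : ℂ) * (ω i / u i + w) := by
        have := h.dir_ne i
        push_cast
        field_simp
      rw [this, re_ofReal_mul, add_re, h.re_div]
    rw [transplant, norm_mul, Complex.norm_exp, h3]
    have hK := h.growthConst_nonneg
    have hν := h.nu_pos
    calc ‖F (ω i + u i * w)‖ * Real.exp (-μ * (σ * ‖ω i‖ + w.re))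
        ≤ growthConst ν d M * Real.exp (ν * (‖ω i‖ + (w.re + 6 * d)))
          * Real.exp (-μ * (σ * ‖ω i‖ + w.re)) := by
          gcongr
          exact h1.trans (by gcongr)
      _ = growthConst ν d M * (Real.exp (6 * ν * d) * Real.exp (-(μ * σ - ν) * ‖ω i‖)
          * Real.exp (-(μ - ν) * w.re)) := by
          rw [mul_assoc, ← Real.exp_add, ← Real.exp_add, ← Real.exp_add]
          ring_nf
      _ = _ := by ring

/-- The constant of the bounds for the summands. -/
noncomputable def sumConst (ν μ d : ℝ) (M : ℝ≥0) : ℝ :=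
  SingleCut.boundConst d (μ - ν) * (growthConst ν d M * Real.exp (6 * ν * d))

lemma sumConst_nonneg (h : CutSystem F ω u ν μ σ d M) : 0 ≤ sumConst ν μ d M := by
  have h1 := h.growthConst_nonneg
  have h2 := h.width_pos
  have h3 := sub_pos.2 h.nu_lt_mu
  unfold sumConst SingleCut.boundConst
  positivity

end CutSystem

/-- The summand of the decomposition of `F` which carries its singularity at `ω`. -/
noncomputable def summand (F : ℂ → ℂ) (μ : ℝ) (ω u : ℂ) (d : ℝ) (p : ℂ) : ℂ :=
  exp (μ / u * p) * element F (μ / u) ω u d p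

namespace CutSystem

variable {ι : Type*} {F : ℂ → ℂ} {ω u : ι → ℂ} {ν μ σ d : ℝ} {M : ℝ≥0}

lemma norm_exp_le (h : CutSystem F ω u ν μ σ d M) (i : ι) (p : ℂ) :
    ‖exp (μ / u i * p)‖ ≤ Real.exp (μ * ‖p‖) := by
  refine (norm_exp_le_exp_norm _).trans (Real.exp_le_exp.2 (le_of_eq ?_))
  rw [norm_mul, norm_div, h.norm_dir, div_one, norm_real, Real.norm_of_nonneg h.mu_pos.le]

lemma summand_eq_of_mem_openStrip (h : CutSystem F ω u ν μ σ d M) {i : ι} {p : ℂ}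
    (hp : p ∈ openStrip (ω i) (u i) (2 * d)) :
    summand F μ (ω i) (u i) d p
      = F p + exp (μ / u i * p) * regPart F (μ / u i) (ω i) (u i) (2 * d) p := by
  rw [summand, (h.singleCut i).element_of_mem_openStrip hp, mul_add, add_comm]
  congr 1
  rw [mul_left_comm, ← exp_add]
  simp

lemma norm_summand_le (h : CutSystem F ω u ν μ σ d M) {i : ι} {p : ℂ}
    (hp : p ∉ halfStrip (ω i) (u i) (3 / 2 * d)) :
    ‖summand F μ (ω i) (u i) d p‖ ≤
      Real.exp (μ * ‖p‖) * (sumConst ν μ d M * Real.exp (-(μ * σ - ν) * ‖ω i‖)) := by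
  rw [summand, norm_mul]
  refine mul_le_mul (h.norm_exp_le i p) ?_ (norm_nonneg _) (Real.exp_pos _).le
  refine ((h.singleCut i).norm_element_le hp).trans (le_of_eq ?_)
  rw [sumConst]; ring

lemma norm_exp_mul_regPart_le (h : CutSystem F ω u ν μ σ d M) {i : ι} {p : ℂ}
    (hp : p ∈ halfStrip (ω i) (u i) (3 / 2 * d)) :
    ‖exp (μ / u i * p) * regPart F (μ / u i) (ω i) (u i) (2 * d) p‖ ≤
      Real.exp (μ * ‖p‖) * (sumConst ν μ d M * Real.exp (-(μ * σ - ν) * ‖ω i‖)) := by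
  rw [norm_mul]
  refine mul_le_mul (h.norm_exp_le i p) ?_ (norm_nonneg _) (Real.exp_pos _).le
  refine ((h.singleCut i).norm_regPart_le hp).trans (le_of_eq ?_)
  rw [sumConst]; ring

lemma differentiableAt_summand (h : CutSystem F ω u ν μ σ d M) {i : ι} {p : ℂ}
    (hp : p ∉ cut (ω i) (u i)) : DifferentiableAt ℂ (summand F μ (ω i) (u i) d) p := by
  unfold summand
  exact DifferentiableAt.mul (by fun_prop) ((h.singleCut i).differentiableAt_element hp)

lemma summable_bound (h : CutSystem F ω u ν μ σ d M) (C : ℝ) : Summable fun i =>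
    C * (sumConst ν μ d M * Real.exp (-(μ * σ - ν) * ‖ω i‖)) :=
  ((h.summable _ (sub_pos.2 h.nu_lt)).mul_left _).mul_left _

/-- Only finitely many strips meet a given disk. For all other cuts the bound off the strip holds on
the whole disk, so Weierstrass' test applies after finitely many terms. -/
lemma eventually_norm_summand_le (h : CutSystem F ω u ν μ σ d M) (R : ℝ) :
    ∀ᶠ i in cofinite, ∀ p ∈ Metric.ball (0 : ℂ) R, ‖summand F μ (ω i) (u i) d p‖ ≤
      Real.exp (μ * R) * (sumConst ν μ d M * Real.exp (-(μ * σ - ν) * ‖ω i‖)) := by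
  have hfin := h.finite_norm_le (R + 3 * d)
  filter_upwards [hfin.compl_mem_cofinite] with i hi p hp
  rw [mem_ball_zero_iff] at hp
  refine (h.norm_summand_le fun hps => hi ?_).trans ?_
  · have := h.norm_sub_le_of_mem_halfStrip hps
    simp only [mem_ofPred_eq]
    linarith
  · have := h.mu_pos
    have := h.sumConst_nonneg
    gcongr

/-- The entire function that remains after the subtraction of all summands. -/
noncomputable def remainder (F : ℂ → ℂ) (μ : ℝ) (ω u : ι → ℂ) (d : ℝ) (p : ℂ) : ℂ :=
  F p - ∑' i, summand F μ (ω i) (u i) d p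

lemma tendstoUniformlyOn_summand (h : CutSystem F ω u ν μ σ d M) (R : ℝ) :
    TendstoUniformlyOn (fun t p => ∑ i ∈ t, summand F μ (ω i) (u i) d p)
      (fun p => F p - remainder F μ ω u d p) atTop (Metric.ball 0 R) := by
  have := tendstoUniformlyOn_tsum_of_cofinite_eventually (h.summable_bound (Real.exp (μ * R)))
    (h.eventually_norm_summand_le R)
  simpa only [remainder, sub_sub_cancel] using this

lemma hasSum_summand (h : CutSystem F ω u ν μ σ d M) (p : ℂ) :
    HasSum (fun i => summand F μ (ω i) (u i) d p) (F p - remainder F μ ω u d p) :=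
  (h.tendstoUniformlyOn_summand (‖p‖ + 1)).tendsto_at (by simp)

lemma hasSumLocallyUniformlyOn_summand (h : CutSystem F ω u ν μ σ d M) (s : Set ℂ) :
    HasSumLocallyUniformlyOn (fun i => summand F μ (ω i) (u i) d)
      (fun p => F p - remainder F μ ω u d p) s := by
  rw [hasSumLocallyUniformlyOn_iff_tendstoLocallyUniformlyOn]
  refine tendstoLocallyUniformlyOn_of_forall_exists_nhds fun p _ =>
    ⟨Metric.ball 0 (‖p‖ + 1), mem_nhdsWithin_of_mem_nhds
      (Metric.isOpen_ball.mem_nhds (by simp)), h.tendstoUniformlyOn_summand _⟩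

open Classical in
-- The singular term F appears once in the remainder and once in the summand of this cut, and
-- cancels; what is left has no singularity in the strip.
lemma remainder_eq_of_mem_openStrip (h : CutSystem F ω u ν μ σ d M) {i₀ : ι} {p : ℂ}
    (hp : p ∈ openStrip (ω i₀) (u i₀) (2 * d)) :
    remainder F μ ω u d p = -(exp (μ / u i₀ * p) * regPart F (μ / u i₀) (ω i₀) (u i₀) (2 * d) p)
      - ∑' i, if i = i₀ then 0 else summand F μ (ω i) (u i) d p := by
  rw [remainder, (h.hasSum_summand p).summable.tsum_eq_add_tsum_ite i₀,
    h.summand_eq_of_mem_openStrip hp]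
  ring

lemma notMem_halfStrip_of_ne (h : CutSystem F ω u ν μ σ d M) {i i₀ : ι} (hi : i ≠ i₀) {p : ℂ}
    (hp : p ∈ openStrip (ω i₀) (u i₀) (2 * d)) {e : ℝ} (he : e ≤ 2 * d) :
    p ∉ halfStrip (ω i) (u i) e := fun hpi =>
  Set.disjoint_left.1 (h.disjoint_halfStrip hi) (halfStrip_mono he hpi)
    (openStrip_subset_halfStrip hp)

lemma differentiable_remainder (h : CutSystem F ω u ν μ σ d M) :
    Differentiable ℂ (remainder F μ ω u d) := by
  classical
  intro p₀
  have hd := h.width_pos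
  have hμ := h.mu_pos
  have hS := h.sumConst_nonneg
  have hbd : ∀ p ∈ Metric.ball (0 : ℂ) (‖p₀‖ + 1), ∀ i, p ∉ halfStrip (ω i) (u i) (3 / 2 * d) →
      ‖summand F μ (ω i) (u i) d p‖ ≤ Real.exp (μ * (‖p₀‖ + 1)) *
        (sumConst ν μ d M * Real.exp (-(μ * σ - ν) * ‖ω i‖)) := by
    intro p hp i hpi
    rw [mem_ball_zero_iff] at hp
    refine (h.norm_summand_le hpi).trans ?_
    gcongr
  have hb0 : p₀ ∈ Metric.ball (0 : ℂ) (‖p₀‖ + 1) := by simp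
  by_cases hex : ∃ i₀, p₀ ∈ openStrip (ω i₀) (u i₀) (2 * d)
  · obtain ⟨i₀, hi₀⟩ := hex
    set V := Metric.ball (0 : ℂ) (‖p₀‖ + 1) ∩ openStrip (ω i₀) (u i₀) (2 * d) with hV
    have hVo : IsOpen V := Metric.isOpen_ball.inter isOpen_openStrip
    have h1 : DifferentiableOn ℂ (fun p => ∑' i, if i = i₀ then 0 else
        summand F μ (ω i) (u i) d p) V := by
      refine differentiableOn_tsum_of_summable_norm (h.summable_bound (Real.exp (μ * (‖p₀‖ + 1))))
        (fun i p hp => ?_) hVo fun i p hp => ?_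
      · by_cases hi : i = i₀
        · simp only [hi, if_true]
          exact differentiableWithinAt_const 0
        · simp only [hi, if_false]
          refine (h.differentiableAt_summand fun hc => ?_).differentiableWithinAt
          exact h.notMem_halfStrip_of_ne hi hp.2 (by linarith)
            (cut_subset_halfStrip (h.dir_ne i) hd.le hc)
      · by_cases hi : i = i₀
        · simp only [hi, if_true, norm_zero]
          positivity
        · simp only [hi, if_false]
          exact hbd p hp.1 i (h.notMem_halfStrip_of_ne hi hp.2 (by linarith))
    have h2 : DifferentiableAt ℂ (fun p => -(exp (μ / u i₀ * p) *
        regPart F (μ / u i₀) (ω i₀) (u i₀) (2 * d) p)) p₀ :=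
      (DifferentiableAt.mul (by fun_prop)
        ((h.singleCut i₀).differentiableAt_regPart_outer hi₀)).neg
    refine (h2.sub (h1.differentiableAt (hVo.mem_nhds ⟨hb0, hi₀⟩))).congr_of_eventuallyEq ?_
    filter_upwards [hVo.mem_nhds ⟨hb0, hi₀⟩] with p hp using h.remainder_eq_of_mem_openStrip hp.2
  -- Away from all strips of half-width 2d, a disk of radius d/2 stays off those of half-width 3d/2,
  -- so F and the whole series are holomorphic there.
  · push Not at hex
    set V := Metric.ball (0 : ℂ) (‖p₀‖ + 1) ∩ Metric.ball p₀ (d / 2) with hV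
    have hVo : IsOpen V := Metric.isOpen_ball.inter Metric.isOpen_ball
    have hpV : p₀ ∈ V := ⟨hb0, Metric.mem_ball_self (half_pos hd)⟩
    have hVs : ∀ p ∈ V, ∀ i, p ∉ halfStrip (ω i) (u i) (3 / 2 * d) := by
      intro p hp i hpi
      have h1 := mem_openStrip_of_norm_sub_lt (h.norm_dir i) hpi (mem_ball_iff_norm.1 hp.2)
      rw [show 3 / 2 * d + d / 2 = 2 * d by ring] at h1
      exact hex i h1
    have hVc : ∀ p ∈ V, ∀ i, p ∉ cut (ω i) (u i) := fun p hp i hc =>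
      hVs p hp i (cut_subset_halfStrip (h.dir_ne i) (by linarith) hc)
    have h1 : DifferentiableOn ℂ (fun p => ∑' i, summand F μ (ω i) (u i) d p) V :=
      differentiableOn_tsum_of_summable_norm (h.summable_bound (Real.exp (μ * (‖p₀‖ + 1))))
        (fun i p hp => (h.differentiableAt_summand (hVc p hp i)).differentiableWithinAt) hVo
        fun i p hp => hbd p hp.1 i (hVs p hp i)
    exact ((h.holo.mono hVc).sub h1).differentiableAt (hVo.mem_nhds hpV)

lemma exists_norm_remainder_le (h : CutSystem F ω u ν μ σ d M) :
    ∃ C, ∀ p, ‖remainder F μ ω u d p‖ ≤ C * Real.exp (μ * ‖p‖) := by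
  classical
  have hd := h.width_pos
  have hμ := h.mu_pos
  have hS := h.sumConst_nonneg
  have hK := h.growthConst_nonneg
  set a : ι → ℝ := fun i => sumConst ν μ d M * Real.exp (-(μ * σ - ν) * ‖ω i‖) with ha
  have has : Summable a := by simpa only [one_mul] using h.summable_bound 1
  have ha0 : ∀ i, 0 ≤ a i := fun i => by positivity
  refine ⟨growthConst ν d M + 2 * ∑' i, a i, fun p => ?_⟩
  have hsum := has.hasSum.mul_left (Real.exp (μ * ‖p‖))
  have hA0 : 0 ≤ ∑' i, a i := tsum_nonneg ha0
  by_cases hex : ∃ i₀, p ∈ halfStrip (ω i₀) (u i₀) (3 / 2 * d)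
  · obtain ⟨i₀, hi₀⟩ := hex
    have hio := halfStrip_subset_openStrip (show 3 / 2 * d < 2 * d by linarith) hi₀
    rw [h.remainder_eq_of_mem_openStrip hio]
    have h1 : ‖∑' i, if i = i₀ then 0 else summand F μ (ω i) (u i) d p‖
        ≤ Real.exp (μ * ‖p‖) * ∑' i, a i := by
      refine tsum_of_norm_bounded hsum fun i => ?_
      by_cases hi : i = i₀
      · simp only [hi, if_true, norm_zero]
        have := ha0 i₀
        positivity
      · simp only [hi, if_false]
        exact h.norm_summand_le (h.notMem_halfStrip_of_ne hi hio (by linarith))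
    have h2 := h.norm_exp_mul_regPart_le hi₀
    have h3 : a i₀ ≤ ∑' i, a i := has.le_tsum i₀ fun i _ => ha0 i
    calc _ ≤ Real.exp (μ * ‖p‖) * a i₀ + Real.exp (μ * ‖p‖) * ∑' i, a i := by
          refine (norm_sub_le _ _).trans ?_
          rw [norm_neg]
          exact add_le_add h2 h1
      _ ≤ Real.exp (μ * ‖p‖) * (∑' i, a i) + Real.exp (μ * ‖p‖) * ∑' i, a i := by gcongr
      _ = (2 * ∑' i, a i) * Real.exp (μ * ‖p‖) := by ring
      _ ≤ _ := by
        gcongr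
        linarith
  · push Not at hex
    have h1 : ‖∑' i, summand F μ (ω i) (u i) d p‖ ≤ Real.exp (μ * ‖p‖) * ∑' i, a i :=
      tsum_of_norm_bounded hsum fun i => h.norm_summand_le (hex i)
    have h2 := h.norm_le_of_ball_subset (h.ball_subset_slitSheet fun i hi =>
      hex i (halfStrip_mono (by linarith) (openStrip_subset_halfStrip hi)))
    have h3 := h.nu_lt_mu
    calc _ ≤ growthConst ν d M * Real.exp (ν * ‖p‖) + Real.exp (μ * ‖p‖) * ∑' i, a i :=
          (norm_sub_le _ _).trans (add_le_add h2 h1)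
      _ ≤ growthConst ν d M * Real.exp (μ * ‖p‖) + Real.exp (μ * ‖p‖) * ∑' i, a i := by gcongr
      _ = (growthConst ν d M + ∑' i, a i) * Real.exp (μ * ‖p‖) := by ring
      _ ≤ _ := by
        gcongr
        linarith

/-- The constant of the weighted norm bounds for the summands. -/
noncomputable def rayConst (ν μ ν' d : ℝ) (M : ℝ≥0) : ℝ :=
  sumConst ν μ d M / (ν' - μ) + Real.exp ((ν' - ν) * (3 * d)) * M

/-- Off its strip the summand is bounded by a multiple of e^{μr}, which is integrable against
e^{-ν'r}. In the strip it is F plus such a term, and F is controlled only in the weighted L¹ norm.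
-/
lemma rayNorm_summand_le (h : CutSystem F ω u ν μ σ d M) {ν' : ℝ} (hν' : μ < ν') (i : ι) :
    rayNorm ν' (summand F μ (ω i) (u i) d) ≤
      ENNReal.ofReal (rayConst ν μ ν' d M * Real.exp (-(μ * σ - ν) * ‖ω i‖)) := by
  have hd := h.width_pos
  have hμ := h.mu_pos
  have hS := h.sumConst_nonneg
  have hνμ := h.nu_lt_mu
  set D := Real.exp (-(μ * σ - ν) * ‖ω i‖) with hD
  have hD0 : 0 < D := Real.exp_pos _
  refine iSup_le fun φ => ?_
  have hpt : ∀ r ∈ Ioi (0 : ℝ), ‖summand F μ (ω i) (u i) d (r * exp (φ * I))‖ₑ *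
      ENNReal.ofReal (Real.exp (-ν' * r)) ≤
      ENNReal.ofReal (sumConst ν μ d M * D * Real.exp (-(ν' - μ) * r)) +
      ENNReal.ofReal (Real.exp ((ν' - ν) * (3 * d)) * D) *
        (‖F (r * exp (φ * I))‖ₑ * ENNReal.ofReal (Real.exp (-ν * r))) := by
    intro r hr
    have hr0 : (0 : ℝ) < r := hr
    set p : ℂ := r * exp (φ * I) with hp
    have hpn : ‖p‖ = r := by
      rw [hp, norm_mul, norm_exp_ofReal_mul_I, mul_one, norm_real, Real.norm_of_nonneg hr0.le]
    have hexp : Real.exp (μ * r) * (sumConst ν μ d M * D) * Real.exp (-ν' * r)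
        = sumConst ν μ d M * D * Real.exp (-(ν' - μ) * r) := by
      rw [mul_comm (Real.exp (μ * r)), mul_assoc (sumConst ν μ d M * D), ← Real.exp_add]
      ring_nf
    have hfirst : ∀ z : ℂ, ‖z‖ ≤ Real.exp (μ * ‖p‖) * (sumConst ν μ d M * D) →
        ‖z‖ₑ * ENNReal.ofReal (Real.exp (-ν' * r)) ≤
          ENNReal.ofReal (sumConst ν μ d M * D * Real.exp (-(ν' - μ) * r)) := by
      intro z hz
      rw [hpn] at hz
      rw [← ofReal_norm, ← ENNReal.ofReal_mul (norm_nonneg _), ← hexp]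
      gcongr
    by_cases hps : p ∈ halfStrip (ω i) (u i) (3 / 2 * d)
    · have hpo := halfStrip_subset_openStrip (show 3 / 2 * d < 2 * d by linarith) hps
      have hnorm := h.norm_sub_le_of_mem_halfStrip hps
      rw [hpn] at hnorm
      rw [h.summand_eq_of_mem_openStrip hpo]
      have h1 := hfirst _ (h.norm_exp_mul_regPart_le hps)
      -- A ray meets the strip only at r ≥ |ω| - 3d, so passing from the weight ν to ν' gains
      -- e^{-(ν'-ν)r}. This yields the required factor exponentially small in |ω|, since ν' ≥ μσ.
      have h2 : ENNReal.ofReal (Real.exp (-ν' * r)) ≤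
          ENNReal.ofReal (Real.exp ((ν' - ν) * (3 * d)) * D) *
            ENNReal.ofReal (Real.exp (-ν * r)) := by
        rw [← ENNReal.ofReal_mul (by positivity), hD, ← Real.exp_add, ← Real.exp_add]
        refine ENNReal.ofReal_le_ofReal (Real.exp_le_exp.2 ?_)
        have h3 : μ * σ ≤ ν' := by nlinarith [h.cos_le_one]
        nlinarith [norm_nonneg (ω i)]
      calc _ ≤ (‖F p‖ₑ + ‖exp (μ / u i * p) * regPart F (μ / u i) (ω i) (u i) (2 * d) p‖ₑ) *
            ENNReal.ofReal (Real.exp (-ν' * r)) := by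
              gcongr
              exact enorm_add_le _ _
        _ = ‖F p‖ₑ * ENNReal.ofReal (Real.exp (-ν' * r)) +
            ‖exp (μ / u i * p) * regPart F (μ / u i) (ω i) (u i) (2 * d) p‖ₑ *
            ENNReal.ofReal (Real.exp (-ν' * r)) := add_mul _ _ _
        _ ≤ ‖F p‖ₑ * (ENNReal.ofReal (Real.exp ((ν' - ν) * (3 * d)) * D) *
            ENNReal.ofReal (Real.exp (-ν * r))) +
            ENNReal.ofReal (sumConst ν μ d M * D * Real.exp (-(ν' - μ) * r)) := by gcongr
        _ = _ := by ring
    · exact (hfirst _ (h.norm_summand_le hps)).trans le_self_add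
  have hint : IntegrableOn (fun r : ℝ => sumConst ν μ d M * D * Real.exp (-(ν' - μ) * r)) (Ioi 0) :=
    (exp_neg_integrableOn_Ioi 0 (sub_pos.2 hν')).const_mul _
  have hnn : 0 ≤ᵐ[volume.restrict (Ioi 0)]
      fun r : ℝ => sumConst ν μ d M * D * Real.exp (-(ν' - μ) * r) :=
    Eventually.of_forall fun r => by positivity
  refine (setLIntegral_mono' measurableSet_Ioi hpt).trans ?_
  rw [lintegral_add_left (by fun_prop), lintegral_const_mul' _ _ ENNReal.ofReal_ne_top,
    ← ofReal_integral_eq_lintegral_ofReal hint hnn, integral_const_mul,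
    integral_exp_mul_Ioi (by linarith : -(ν' - μ) < 0), mul_zero, Real.exp_zero]
  have h4 : ∫⁻ r in Ioi (0 : ℝ), ‖F (r * exp (φ * I))‖ₑ * ENNReal.ofReal (Real.exp (-ν * r)) ≤ M :=
    (le_iSup (fun φ : ℝ => ∫⁻ r in Ioi (0 : ℝ),
      ‖F (r * exp (φ * I))‖ₑ * ENNReal.ofReal (Real.exp (-ν * r))) φ).trans h.growth
  have hpos : 0 < ν' - μ := sub_pos.2 hν'
  calc _ ≤ ENNReal.ofReal (sumConst ν μ d M * D * (-1 / -(ν' - μ))) +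
        ENNReal.ofReal (Real.exp ((ν' - ν) * (3 * d)) * D) * ENNReal.ofReal M := by
        rw [ENNReal.ofReal_coe_nnreal]
        gcongr
    _ = _ := by
        rw [← ENNReal.ofReal_mul (by positivity), neg_div_neg_eq,
          ← ENNReal.ofReal_add (by positivity) (by positivity), rayConst]
        congr 1
        ring

end CutSystem

/-! ### Laplace transforms of the summands and the abstract decomposition. -/

lemma aestronglyMeasurable_ray {f : ℂ → ℂ} {O : Set ℂ} (hO : IsOpen O) (hf : ContinuousOn f O)
    (φ : ℝ) (hc : {r : ℝ | (r * exp (φ * I) : ℂ) ∉ O}.Countable) :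
    AEStronglyMeasurable (fun r : ℝ => f (r * exp (φ * I))) (volume.restrict (Ioi 0)) := by
  set A : Set ℝ := {r | (r * exp (φ * I) : ℂ) ∈ O} with hA
  have hAo : IsOpen A := hO.preimage (f := fun r : ℝ => (r * exp (φ * I) : ℂ)) (by fun_prop)
  have hfA : ContinuousOn (fun r : ℝ => f (r * exp (φ * I))) A :=
    hf.comp (by fun_prop) fun r hr => hr
  have h1 := hfA.aestronglyMeasurable (μ := volume) hAo.measurableSet
  have h2 : volume.restrict A = volume := by
    refine Measure.restrict_eq_self_of_ae_mem ?_
    rw [ae_iff]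
    exact hc.measure_zero _
  rw [h2] at h1
  exact h1.restrict

lemma laplaceConverges_of_rayNorm_le {f : ℂ → ℂ} {φ ν' K : ℝ} {x : ℂ}
    (hf : AEStronglyMeasurable (fun r : ℝ => f (r * exp (φ * I))) (volume.restrict (Ioi 0)))
    (hK : rayNorm ν' f ≤ ENNReal.ofReal K) (hK0 : 0 ≤ K) (hx : ν' < (x * exp (φ * I)).re) :
    LaplaceConverges φ f x ∧ ∫ r in Ioi (0 : ℝ), ‖laplaceIntegrand φ f x r‖ ≤ K := by
  have hm : AEStronglyMeasurable (laplaceIntegrand φ f x) (volume.restrict (Ioi 0)) := by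
    unfold laplaceIntegrand
    refine (AEStronglyMeasurable.mul ?_ hf).mul aestronglyMeasurable_const
    exact Continuous.aestronglyMeasurable (by fun_prop)
  have hle : ∫⁻ r in Ioi (0 : ℝ), ‖laplaceIntegrand φ f x r‖ₑ ≤ ENNReal.ofReal K := by
    refine le_trans ?_ ((le_iSup (fun φ : ℝ => ∫⁻ r in Ioi (0 : ℝ),
      ‖f (r * exp (φ * I))‖ₑ * ENNReal.ofReal (Real.exp (-ν' * r))) φ).trans hK)
    refine setLIntegral_mono' measurableSet_Ioi fun r hr => ?_
    have hr0 : (0 : ℝ) < r := hr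
    rw [← ofReal_norm, ← ofReal_norm, ← ENNReal.ofReal_mul (norm_nonneg _), laplaceIntegrand,
      norm_mul, norm_mul, norm_exp_ofReal_mul_I, mul_one, Complex.norm_exp, mul_comm]
    have h2 : (-x * (r * exp (φ * I))).re = -((x * exp (φ * I)).re * r) := by
      rw [show -x * (r * exp (φ * I)) = -((x * exp (φ * I)) * r) by ring, neg_re, re_mul_ofReal]
    rw [h2]
    gcongr
    nlinarith
  have hi : LaplaceConverges φ f x := ⟨hm, hle.trans_lt ENNReal.ofReal_lt_top⟩
  refine ⟨hi, ?_⟩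
  rw [integral_norm_eq_lintegral_enorm hm]
  exact (ENNReal.toReal_le_of_le_ofReal hK0 hle)

lemma laplaceIntegrand_shift (φ : ℝ) (f : ℂ → ℂ) (x m : ℂ) :
    laplaceIntegrand φ f (x - m) = laplaceIntegrand φ (fun p => exp (m * p) * f p) x := by
  ext r
  simp only [laplaceIntegrand]
  rw [← mul_assoc (exp (-x * _)), ← exp_add]
  ring_nf

namespace CutSystem

variable {ι : Type*} {F : ℂ → ℂ} {ω u : ι → ℂ} {ν μ σ d : ℝ} {M : ℝ≥0}

lemma rayConst_nonneg (h : CutSystem F ω u ν μ σ d M) {ν' : ℝ} (hν' : μ < ν') :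
    0 ≤ rayConst ν μ ν' d M := by
  have := h.sumConst_nonneg
  have := sub_pos.2 hν'
  unfold rayConst
  positivity

lemma laplaceConverges [Countable ι] (h : CutSystem F ω u ν μ σ d M) {φ : ℝ} {x : ℂ}
    (hx : ν < (x * exp (φ * I)).re) : LaplaceConverges φ F x := by
  refine (laplaceConverges_of_rayNorm_le (aestronglyMeasurable_ray h.isOpen_slitSheet
    h.holo.continuousOn φ ?_) (K := M) (by rw [ENNReal.ofReal_coe_nnreal]; exact h.growth)
    M.2 hx).1
  have : {r : ℝ | (r * exp (φ * I) : ℂ) ∉ slitSheet ω u}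
      = ⋃ i, {r : ℝ | (r * exp (φ * I) : ℂ) ∈ cut (ω i) (u i)} := by
    ext r
    simp [slitSheet]
  rw [this]
  exact countable_iUnion fun i => (h.ray i φ).countable

lemma laplace_summand (h : CutSystem F ω u ν μ σ d M) {ν' : ℝ} (hν' : μ < ν') {φ : ℝ} {x : ℂ}
    (hx : ν' < (x * exp (φ * I)).re) (i : ι) :
    LaplaceConverges φ (summand F μ (ω i) (u i) d) x ∧
      ∫ r in Ioi (0 : ℝ), ‖laplaceIntegrand φ (summand F μ (ω i) (u i) d) x r‖ ≤
        rayConst ν μ ν' d M * Real.exp (-(μ * σ - ν) * ‖ω i‖) := by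
  have := h.rayConst_nonneg hν'
  refine laplaceConverges_of_rayNorm_le (aestronglyMeasurable_ray
    (isClosed_cut (h.dir_ne i)).isOpen_compl
    (fun p hp => (h.differentiableAt_summand hp).continuousAt.continuousWithinAt) φ ?_)
    (h.rayNorm_summand_le hν' i) (by positivity) hx
  simpa using (h.ray i φ).countable

lemma hasSum_laplace_summand [Countable ι] (h : CutSystem F ω u ν μ σ d M) {ν' : ℝ} (hν' : μ < ν')
    {φ : ℝ} {x : ℂ} (hx : ν' < (x * exp (φ * I)).re) :
    HasSum (fun i => laplace φ (summand F μ (ω i) (u i) d) x)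
      (laplace φ F x - laplace φ (remainder F μ ω u d) x) := by
  obtain ⟨C, hC⟩ := h.exists_norm_remainder_le
  have hG : LaplaceConverges φ (remainder F μ ω u d) x :=
    laplaceConverges_of_exp_bound h.differentiable_remainder hC (hν'.trans hx)
  have hF : LaplaceConverges φ F x := h.laplaceConverges ((h.nu_lt_mu.trans hν').trans hx)
  have hsum : Summable fun i =>
      ∫ r in Ioi (0 : ℝ), ‖laplaceIntegrand φ (summand F μ (ω i) (u i) d) x r‖ :=
    Summable.of_nonneg_of_le (fun i => integral_nonneg fun r => norm_nonneg _)
      (fun i => (h.laplace_summand hν' hx i).2)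
      ((h.summable _ (sub_pos.2 h.nu_lt)).mul_left _)
  have key := hasSum_integral_of_summable_integral_norm
    (fun i => (h.laplace_summand hν' hx i).1) hsum
  -- The summable L¹ norms allow the exchange of sum and integral, and the pointwise decomposition
  -- identifies the integrand as that of F minus the remainder.
  convert! key using 1
  rw [laplace, laplace, ← integral_sub hF hG]
  refine integral_congr_ae (Eventually.of_forall fun r => ?_)
  have h1 := ((h.hasSum_summand (r * exp (φ * I))).mul_left
    (exp (-x * (r * exp (φ * I))))).mul_right (exp (φ * I))
  simp only [laplaceIntegrand]
  rw [h1.tsum_eq]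
  ring

/-- The decomposition of a function on a sheet with uniformly separated cuts into resurgent
elements and an entire function of exponential type. -/
theorem decomposition [Countable ι] (h : CutSystem F ω u ν μ σ d M) {ν' : ℝ} (hν' : μ < ν') :
    ∃ (f : ι → ℂ → ℂ) (G g : ℂ → ℂ),
      (Pairwise fun i i' => Disjoint (halfStrip (ω i) (u i) d) (halfStrip (ω i') (u i') d)) ∧
      (∀ i, IsElement (f i) (ω i) (u i)) ∧
      (∀ i, ∀ p, p ∉ halfStrip (ω i) (u i) d →
        f i p = hankelCauchy F (μ / u i) (ω i) (u i) d p) ∧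
      (∀ i, ∃ k : ℂ → ℂ, AnalyticAt ℂ k (ω i) ∧
        ∀ᶠ p in 𝓝 (ω i), p ∉ cut (ω i) (u i) → F p - exp (μ / u i * p) * f i p = k p) ∧
      (∃ C : ℝ, ∀ i, rayNorm ν' (fun p => exp (μ / u i * p) * f i p) ≤
        ENNReal.ofReal (C * Real.exp (-(μ * σ - ν) * ‖ω i‖))) ∧
      Differentiable ℂ G ∧
      (∃ C : ℝ, ∀ p, ‖G p‖ ≤ C * Real.exp (ν' * ‖p‖)) ∧
      HasSumLocallyUniformlyOn (fun i p => exp (μ / u i * p) * f i p)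
        (fun p => F p - G p) (slitSheet ω u) ∧
      (∀ x : ℂ, ν' < ‖x‖ → HasSum (fun m : ℕ => iteratedDeriv m G 0 / x ^ (m + 1)) (g x)) ∧
      (∀ (φ : ℝ) (x : ℂ), ν' < (x * exp (φ * I)).re →
        LaplaceConverges φ F x ∧
        LaplaceConverges φ G x ∧ laplace φ G x = g x ∧
        (∀ i, LaplaceConverges φ (f i) (x - μ / u i)) ∧
        HasSum (fun i => laplace φ (f i) (x - μ / u i)) (laplace φ F x - g x)) := by
  have hd := h.width_pos
  have hμ := h.mu_pos
  have hνμ := h.nu_lt_mu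
  obtain ⟨C, hC⟩ := h.exists_norm_remainder_le
  have hGd := h.differentiable_remainder
  have hlap : ∀ (φ : ℝ) (x : ℂ), ν' < (x * exp (φ * I)).re →
      laplace φ (remainder F μ ω u d) x =
        ∑' m : ℕ, iteratedDeriv m (remainder F μ ω u d) 0 / x ^ (m + 1) := fun φ x hx =>
    (hasSum_laplace_of_exp_bound hGd hμ hC (hν'.trans hx)).tsum_eq.symm
  have hshift : ∀ φ i x, laplaceIntegrand φ (element F (μ / u i) (ω i) (u i) d) (x - μ / u i)
      = laplaceIntegrand φ (summand F μ (ω i) (u i) d) x := fun φ i x =>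
    laplaceIntegrand_shift φ _ x _
  refine ⟨fun i => element F (μ / u i) (ω i) (u i) d, remainder F μ ω u d,
    fun x => ∑' m : ℕ, iteratedDeriv m (remainder F μ ω u d) 0 / x ^ (m + 1),
    fun i i' hi => (h.disjoint_halfStrip hi).mono (halfStrip_mono (by linarith))
      (halfStrip_mono (by linarith)), fun i => ?_, fun i p hp => ?_, fun i => ?_,
    ⟨rayConst ν μ ν' d M, fun i => h.rayNorm_summand_le hν' i⟩, hGd, ⟨C, fun p => ?_⟩,
    h.hasSumLocallyUniformlyOn_summand _,
    fun x hx => (summable_iteratedDeriv_div hGd hμ hC (hν'.trans hx)).hasSum,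
    fun φ x hx => ⟨h.laplaceConverges ((hνμ.trans hν').trans hx),
      laplaceConverges_of_exp_bound hGd hC (hν'.trans hx), hlap φ x hx, fun i => ?_, ?_⟩⟩
  · refine (h.singleCut i).isElement (h.across i) (h.frobenius i) ?_
    obtain ⟨C, R, hCR⟩ := h.near i
    -- The product |w| e^{ν|p|} e^{-μ Re w} is bounded, because |w| ≤ e^{(μ-ν)(Re w + 2d)}/(μ-ν)
    -- uses up exactly the surplus μ - ν of decay. The maximum with 0 makes Re w nonnegative, so
    -- that |w| ≤ Re w + 2d.
    refine ⟨|C| * (Real.exp (ν * (‖ω i‖ + 2 * d)) *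
      (1 / (μ - ν) * Real.exp ((μ - ν) * (2 * d)) * Real.exp (μ * |σ * ‖ω i‖|))), max R 0,
      fun p hp hpc hpR => ?_⟩
    set w := (p - ω i) / u i with hw
    have hpw : p = ω i + u i * w := by
      rw [hw, mul_div_cancel₀ _ (h.dir_ne i), add_sub_cancel]
    have hF := hCR p hp hpc ((le_max_left _ _).trans hpR)
    have hw0 : 0 ≤ w.re := (le_max_right _ _).trans hpR
    have hwn : ‖w‖ ≤ w.re + 2 * d := by
      refine (Complex.norm_le_abs_re_add_abs_im w).trans ?_
      rw [abs_of_nonneg hw0]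
      linarith [hp.2]
    have hpn : ‖p - ω i‖ = ‖w‖ := by rw [hw, norm_div, h.norm_dir, div_one]
    have hp2 : ‖p‖ ≤ ‖ω i‖ + (w.re + 2 * d) := by
      have h1 : ‖p‖ ≤ ‖p - ω i‖ + ‖ω i‖ := by simpa using norm_add_le (p - ω i) (ω i)
      linarith
    have h3 : (-(μ / u i) * p).re = -μ * (σ * ‖ω i‖ + w.re) := by
      have : -(μ / u i) * p = ((-μ : ℝ) : ℂ) * (ω i / u i + w) := by
        have := h.dir_ne i
        rw [hpw]
        push_cast
        field_simp
      rw [this, re_ofReal_mul, add_re, h.re_div]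
    have hlin : ‖w‖ ≤ 1 / (μ - ν) * Real.exp ((μ - ν) * (w.re + 2 * d)) := by
      have hpos := sub_pos.2 hνμ
      have h4 := Real.add_one_le_exp ((μ - ν) * (w.re + 2 * d))
      rw [one_div, inv_mul_eq_div, le_div_iff₀ hpos]
      nlinarith
    have hσ : -μ * (σ * ‖ω i‖ + w.re) ≤ μ * |σ * ‖ω i‖| - μ * w.re := by
      nlinarith [neg_abs_le (σ * ‖ω i‖)]
    rw [hpn, norm_mul, Complex.norm_exp, h3]
    have hpos := sub_pos.2 hνμ
    have hν := h.nu_pos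
    calc ‖w‖ * (‖F p‖ * Real.exp (-μ * (σ * ‖ω i‖ + w.re)))
        ≤ (1 / (μ - ν) * Real.exp ((μ - ν) * (w.re + 2 * d))) *
          ((|C| * Real.exp (ν * (‖ω i‖ + (w.re + 2 * d)))) *
          Real.exp (μ * |σ * ‖ω i‖| - μ * w.re)) := by
          gcongr
          refine hF.trans ?_
          gcongr
          exact le_abs_self C
      _ = |C| * (1 / (μ - ν)) * (Real.exp ((μ - ν) * (w.re + 2 * d)) *
          Real.exp (ν * (‖ω i‖ + (w.re + 2 * d))) *
          Real.exp (μ * |σ * ‖ω i‖| - μ * w.re)) := by ring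
      _ = |C| * (1 / (μ - ν)) * (Real.exp (ν * (‖ω i‖ + 2 * d)) * Real.exp ((μ - ν) * (2 * d)) *
          Real.exp (μ * |σ * ‖ω i‖|)) := by
          simp only [← Real.exp_add]
          ring_nf
      _ = _ := by ring
  · exact (SingleCut.element_of_notMem hp).trans (hankelCauchy_eq_stripCauchy (h.dir_ne i)).symm
  · have hωo : ω i ∈ openStrip (ω i) (u i) (2 * d) := halfStrip_subset_openStrip
      (by linarith) (cut_subset_halfStrip (h.dir_ne i) hd.le (self_mem_cut (ω i) (u i)))
    refine ⟨fun p => -(exp (μ / u i * p) * regPart F (μ / u i) (ω i) (u i) (2 * d) p), ?_, ?_⟩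
    · refine DifferentiableOn.analyticAt (s := openStrip (ω i) (u i) (2 * d)) ?_
        (isOpen_openStrip.mem_nhds hωo)
      intro p hp
      exact (DifferentiableAt.mul (by fun_prop)
        ((h.singleCut i).differentiableAt_regPart_outer hp)).neg.differentiableWithinAt
    · filter_upwards [isOpen_openStrip.mem_nhds hωo] with p hp _
      have := h.summand_eq_of_mem_openStrip hp
      rw [summand] at this
      rw [this]
      ring
  · have hC0 : 0 ≤ C := by
      have := (norm_nonneg _).trans (hC 0)
      exact nonneg_of_mul_nonneg_left this (Real.exp_pos _)
    exact (hC p).trans (by gcongr)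
  · rw [LaplaceConverges, hshift]
    exact (h.laplace_summand hν' hx i).1
  · have := h.hasSum_laplace_summand hν' hx
    simp only [← hlap φ x hx]
    simp only [laplace, hshift]
    simpa only [laplace] using this

end CutSystem

/-! ### Geometry of the tilted cuts. -/

section Angles

variable {x x' t t' θ θ' η : ℝ} {v v' : ℂ}

lemma le_norm_add_mul_exp_left (hθ : 0 ≤ Real.cos θ) (ht : 0 ≤ t) :
    x ≤ ‖(x + t * exp (θ * I) : ℂ)‖ := by
  refine le_trans ?_ ((le_abs_self _).trans (abs_re_le_norm _))
  rw [add_re, ofReal_re, re_ofReal_mul, exp_ofReal_mul_I_re]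
  linarith [mul_nonneg ht hθ]

lemma le_norm_add_mul_exp_right (hθ : 0 ≤ Real.cos θ) (hx : 0 ≤ x) :
    t ≤ ‖(x + t * exp (θ * I) : ℂ)‖ := by
  have h1 : (x + t * exp (θ * I) : ℂ) = (t + x * exp ((-θ : ℝ) * I)) * exp (θ * I) := by
    rw [add_mul, mul_assoc, ← exp_add]
    push_cast
    simp [add_comm]
  rw [h1, norm_mul, norm_exp_ofReal_mul_I, mul_one]
  exact le_norm_add_mul_exp_left (by rwa [Real.cos_neg]) hx

lemma norm_exp_sub_exp_le (θ θ' : ℝ) : ‖exp (θ * I) - exp (θ' * I)‖ ≤ |θ - θ'| := by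
  have h1 : exp (θ * I) - exp (θ' * I) = (exp (I * (θ - θ' : ℝ)) - 1) * exp (θ' * I) := by
    rw [sub_mul, ← exp_add, one_mul]
    push_cast
    ring_nf
  rw [h1, norm_mul, norm_exp_ofReal_mul_I, mul_one]
  exact Real.norm_exp_I_mul_ofReal_sub_one_le

/-- With D the distance of the two points, |x - x'| ≤ D, and moving one point along its ray to the
modulus of the other shows x‖v - v'‖ ≤ D + |x - x'| ≤ 2D, and likewise for x'. Adding the two gives
the factor 1/4. -/
lemma mul_add_le_norm_sub (hv : ‖v‖ = 1) (hv' : ‖v'‖ = 1) (hη : η ≤ ‖v - v'‖) (hx : 0 ≤ x)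
    (hx' : 0 ≤ x') : η / 4 * (x + x') ≤ ‖(v * x - v' * x' : ℂ)‖ := by
  have h1 : |x - x'| ≤ ‖(v * x - v' * x' : ℂ)‖ := by
    have := abs_norm_sub_norm_le (v * x : ℂ) (v' * x')
    rwa [norm_mul, norm_mul, hv, hv', one_mul, one_mul, norm_real, norm_real,
      Real.norm_of_nonneg hx, Real.norm_of_nonneg hx'] at this
  have h2 : x * ‖v - v'‖ ≤ ‖(v * x - v' * x' : ℂ)‖ + |x - x'| := by
    have e : (v - v') * x = (v * x - v' * x') + v' * (x' - x : ℝ) := by push_cast; ring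
    have := norm_add_le (v * x - v' * x' : ℂ) (v' * (x' - x : ℝ))
    rwa [← e, norm_mul, norm_mul, hv', one_mul, norm_real, norm_real, Real.norm_of_nonneg hx,
      Real.norm_eq_abs, abs_sub_comm, mul_comm] at this
  have h3 : x' * ‖v - v'‖ ≤ ‖(v * x - v' * x' : ℂ)‖ + |x - x'| := by
    have e : (v - v') * x' = (v * x - v' * x') + v * (x' - x : ℝ) := by push_cast; ring
    have := norm_add_le (v * x - v' * x' : ℂ) (v * (x' - x : ℝ))
    rwa [← e, norm_mul, norm_mul, hv, one_mul, norm_real, norm_real, Real.norm_of_nonneg hx',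
      Real.norm_eq_abs, abs_sub_comm, mul_comm] at this
  nlinarith

/-- Points in two narrow sectors around different directions are far from each other. -/
lemma mul_add_le_norm_sub_of_sector (hv : ‖v‖ = 1) (hv' : ‖v'‖ = 1) (hη : η ≤ ‖v - v'‖)
    (hx : 0 ≤ x) (hx' : 0 ≤ x') (ht : 0 ≤ t) (ht' : 0 ≤ t') (hθ : |θ| ≤ η / 8) (hθ' : |θ'| ≤ η / 8) :
    η / 8 * (x + t + (x' + t')) ≤
      ‖v * (x + t * exp (θ * I)) - v' * (x' + t' * exp (θ' * I))‖ := by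
  have h1 := mul_add_le_norm_sub hv hv' hη (add_nonneg hx ht) (add_nonneg hx' ht')
  -- Straightening t e^{iθ} to t moves a point by at most (η/8) t, so half of the factor η/4
  -- survives.
  have h2 : ∀ (w : ℂ) (s ψ : ℝ), ‖w‖ = 1 → 0 ≤ s → |ψ| ≤ η / 8 →
      ‖w * (s * (exp (ψ * I) - 1))‖ ≤ η / 8 * s := by
    intro w s ψ hw hs hψ
    have := norm_exp_sub_exp_le ψ 0
    simp only [ofReal_zero, zero_mul, exp_zero, sub_zero] at this
    rw [norm_mul, hw, one_mul, norm_mul, norm_real, Real.norm_of_nonneg hs, mul_comm]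
    exact mul_le_mul_of_nonneg_right (this.trans hψ) hs
  have e : (v * (x + t : ℝ) - v' * (x' + t' : ℝ) : ℂ) =
      (v * (x + t * exp (θ * I)) - v' * (x' + t' * exp (θ' * I)))
      - v * (t * (exp (θ * I) - 1)) + v' * (t' * (exp (θ' * I) - 1)) := by
    push_cast
    ring
  rw [e] at h1
  have h3 := (norm_add_le _ _).trans (add_le_add_left (norm_sub_le
    (v * (x + t * exp (θ * I)) - v' * (x' + t' * exp (θ' * I))) (v * (t * (exp (θ * I) - 1))))
    ‖v' * (t' * (exp (θ' * I) - 1))‖)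
  have h4 := h2 v t θ hv ht hθ
  have h5 := h2 v' t' θ' hv' ht' hθ'
  have hη0 : 0 ≤ η := by linarith [(abs_nonneg θ).trans hθ]
  nlinarith

end Angles

/-- Quantitative data on finitely many rays: a lower bound for the gaps between the directions and
a lower bound for the distances of the singular points. -/
structure RayData {n : ℕ} (lam : Fin n → ℂ) (c : Fin n → ℝ) (η x₀ : ℝ) : Prop where
  lam_ne : ∀ k, lam k ≠ 0
  eta_pos : 0 < η
  eta_le_one : η ≤ 1
  gap : ∀ k k', k ≠ k' → η ≤ ‖lam k / (‖lam k‖ : ℂ) - lam k' / (‖lam k'‖ : ℂ)‖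
  x_pos : 0 < x₀
  x_le_start : ∀ k, x₀ ≤ c k * ‖lam k‖
  x_le_step : ∀ k, x₀ ≤ ‖lam k‖

namespace RayData

variable {n : ℕ} {lam : Fin n → ℂ} {c : Fin n → ℝ} {η x₀ θ θ' : ℝ}

/-- The distance of a singular point from the origin. -/
noncomputable def pos (lam : Fin n → ℂ) (c : Fin n → ℝ) (i : Fin n × ℕ) : ℝ :=
  (c i.1 + i.2) * ‖lam i.1‖

/-- The direction of a ray. -/
noncomputable def unit (lam : Fin n → ℂ) (k : Fin n) : ℂ := lam k / (‖lam k‖ : ℂ)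

lemma norm_lam_pos (h : RayData lam c η x₀) (k : Fin n) : 0 < ‖lam k‖ := norm_pos_iff.2 (h.lam_ne k)

lemma norm_unit (h : RayData lam c η x₀) (k : Fin n) : ‖unit lam k‖ = 1 := by
  rw [unit, norm_div, norm_real, norm_norm, div_self (h.norm_lam_pos k).ne']

lemma unit_ne (h : RayData lam c η x₀) (k : Fin n) : unit lam k ≠ 0 :=
  norm_pos_iff.1 (by rw [h.norm_unit]; exact one_pos)

lemma x_le_pos (h : RayData lam c η x₀) (i : Fin n × ℕ) : x₀ ≤ pos lam c i := by
  refine (h.x_le_start i.1).trans ?_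
  unfold pos
  gcongr
  exact le_add_of_nonneg_right (Nat.cast_nonneg _)

lemma pos_pos (h : RayData lam c η x₀) (i : Fin n × ℕ) : 0 < pos lam c i :=
  h.x_pos.trans_le (h.x_le_pos i)

lemma sing_eq (h : RayData lam c η x₀) (i : Fin n × ℕ) :
    sing lam c i = unit lam i.1 * pos lam c i := by
  have : (‖lam i.1‖ : ℂ) ≠ 0 := by exact_mod_cast (h.norm_lam_pos i.1).ne'
  rw [sing, unit, pos]
  push_cast
  field_simp

lemma norm_sing (h : RayData lam c η x₀) (i : Fin n × ℕ) : ‖sing lam c i‖ = pos lam c i := by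
  rw [h.sing_eq, norm_mul, h.norm_unit, one_mul, norm_real, Real.norm_of_nonneg (h.pos_pos i).le]

lemma dir_eq (k : Fin n) : dir lam θ k = unit lam k * exp (θ * I) := mul_comm _ _

lemma norm_dir (h : RayData lam c η x₀) (k : Fin n) : ‖dir lam θ k‖ = 1 := by
  rw [dir_eq, norm_mul, h.norm_unit, norm_exp_ofReal_mul_I, one_mul]

lemma dir_ne (h : RayData lam c η x₀) (k : Fin n) : dir lam θ k ≠ 0 :=
  norm_pos_iff.1 (by rw [h.norm_dir]; exact one_pos)

lemma mem_cut (h : RayData lam c η x₀) {i : Fin n × ℕ} {q : ℂ} :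
    q ∈ cut (sing lam c i) (dir lam θ i.1) ↔
      ∃ t : ℝ, 0 ≤ t ∧ q = unit lam i.1 * (pos lam c i + t * exp (θ * I)) := by
  refine exists_congr fun t => and_congr_right fun _ => ?_
  rw [h.sing_eq, dir_eq]
  ring_nf

lemma sing_div_dir (h : RayData lam c η x₀) (i : Fin n × ℕ) :
    sing lam c i / dir lam θ i.1 = pos lam c i * exp ((-θ : ℝ) * I) := by
  rw [h.sing_eq, dir_eq, mul_div_mul_left _ _ (h.unit_ne i.1), div_eq_mul_inv, ← exp_neg]
  push_cast
  ring_nf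

lemma cos_nonneg (h : RayData lam c η x₀) (hθ : θ ∈ Ioc 0 (η / 8)) : 0 ≤ Real.cos θ := by
  have := h.eta_le_one
  exact Real.cos_nonneg_of_mem_Icc ⟨by linarith [hθ.1, Real.pi_pos],
    by linarith [hθ.2, Real.pi_gt_three]⟩

lemma sin_pos (h : RayData lam c η x₀) (hθ : θ ∈ Ioc 0 (η / 8)) : 0 < Real.sin θ := by
  have := h.eta_le_one
  exact Real.sin_pos_of_pos_of_lt_pi hθ.1 (by linarith [hθ.2, Real.pi_gt_three])

lemma abs_le_of_mem (hθ : θ ∈ Ioc 0 (η / 8)) : |θ| ≤ η / 8 := by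
  rw [abs_of_pos hθ.1]; exact hθ.2

lemma norm_sing_le (h : RayData lam c η x₀) (hθ : θ ∈ Ioc 0 (η / 8)) {i : Fin n × ℕ} {q : ℂ}
    (hq : q ∈ cut (sing lam c i) (dir lam θ i.1)) : ‖sing lam c i‖ ≤ ‖q‖ := by
  obtain ⟨t, ht, rfl⟩ := h.mem_cut.1 hq
  rw [h.norm_sing, norm_mul, h.norm_unit, one_mul]
  exact le_norm_add_mul_exp_left (h.cos_nonneg hθ) ht

lemma zero_notMem_cut (h : RayData lam c η x₀) (hθ : θ ∈ Ioc 0 (η / 8)) (i : Fin n × ℕ) :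
    (0 : ℂ) ∉ cut (sing lam c i) (dir lam θ i.1) := fun h0 => by
  have := h.norm_sing_le hθ h0
  rw [h.norm_sing, norm_zero] at this
  linarith [h.pos_pos i]

lemma summable (h : RayData lam c η x₀) {b : ℝ} (hb : 0 < b) :
    Summable fun i => Real.exp (-b * ‖sing lam c i‖) := by
  rw [summable_prod_of_nonneg fun i => (Real.exp_pos _).le]
  refine ⟨fun k => ?_, Summable.of_finite⟩
  have hq : Real.exp (-b * ‖lam k‖) < 1 := by
    rw [Real.exp_lt_one_iff]
    nlinarith [h.norm_lam_pos k]
  have := (summable_geometric_of_lt_one (Real.exp_pos _).le hq).mul_left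
    (Real.exp (-b * (c k * ‖lam k‖)))
  refine this.congr fun j => ?_
  rw [h.norm_sing, ← Real.exp_nat_mul, ← Real.exp_add, pos]
  congr 1
  ring

lemma isOpen_sheet (h : RayData lam c η x₀) (hθ : θ ∈ Ioc 0 (η / 8)) : IsOpen (sheet lam c θ) :=
  isOpen_slitSheet_of_summable (fun i => h.dir_ne i.1) (fun _ _ hq => h.norm_sing_le hθ hq)
    (h.summable one_pos)

/-- A lower bound for the distance of two cuts. -/
noncomputable def sep (η x₀ θ : ℝ) : ℝ := x₀ * η * Real.sin θ / 8

lemma sep_pos (h : RayData lam c η x₀) (hθ : θ ∈ Ioc 0 (η / 8)) : 0 < sep η x₀ θ := by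
  have := h.x_pos
  have := h.eta_pos
  have := h.sin_pos hθ
  unfold sep
  positivity

lemma sep_le (h : RayData lam c η x₀) : sep η x₀ θ ≤ x₀ * η / 8 := by
  have h1 := Real.sin_le_one θ
  have h2 := h.x_pos
  have h3 := h.eta_pos
  unfold sep
  have : x₀ * η * Real.sin θ ≤ x₀ * η * 1 := by gcongr
  linarith

lemma x_le_abs_sub (h : RayData lam c η x₀) {i i' : Fin n × ℕ} (hk : i.1 = i'.1) (hi : i ≠ i') :
    x₀ ≤ |pos lam c i - pos lam c i'| := by
  obtain ⟨k, j⟩ := i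
  obtain ⟨k', j'⟩ := i'
  simp only at hk
  subst hk
  have hj : (j : ℤ) - j' ≠ 0 := by
    intro h0
    apply hi
    have : j = j' := by omega
    rw [this]
  have h1 : (1 : ℝ) ≤ |(j : ℝ) - j'| := by exact_mod_cast Int.one_le_abs hj
  have h2 : pos lam c (k, j) - pos lam c (k, j') = (j - j') * ‖lam k‖ := by
    unfold pos; ring
  rw [h2, abs_mul, abs_norm]
  have := h.x_le_step k
  nlinarith [norm_nonneg (lam k)]

/-- Cuts from one ray are parallel, and tilting by θ turns their spacing along the ray into a
transverse distance of at least x₀ sin θ, read off as an imaginary part after rotation by -θ. Cuts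
from different rays are separated by their sectors. -/
lemma sep_le_norm_sub (h : RayData lam c η x₀) (hθ : θ ∈ Ioc 0 (η / 8)) {i i' : Fin n × ℕ}
    (hi : i ≠ i') {q q' : ℂ} (hq : q ∈ cut (sing lam c i) (dir lam θ i.1))
    (hq' : q' ∈ cut (sing lam c i') (dir lam θ i'.1)) : sep η x₀ θ ≤ ‖q - q'‖ := by
  obtain ⟨t, ht, rfl⟩ := h.mem_cut.1 hq
  obtain ⟨t', ht', rfl⟩ := h.mem_cut.1 hq'
  by_cases hk : i.1 = i'.1
  · have hx := h.x_le_abs_sub hk hi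
    have hs := h.sin_pos hθ
    rw [← hk, ← mul_sub, norm_mul, h.norm_unit, one_mul]
    have e : (pos lam c i + t * exp (θ * I) - (pos lam c i' + t' * exp (θ * I)) : ℂ)
        = (((pos lam c i - pos lam c i' : ℝ) : ℂ) * exp ((-θ : ℝ) * I) + (t - t' : ℝ))
          * exp (θ * I) := by
      rw [add_mul, mul_assoc, ← exp_add]
      push_cast
      ring_nf
      simp
    rw [e, norm_mul, norm_exp_ofReal_mul_I, mul_one]
    refine le_trans ?_ (abs_im_le_norm _)
    rw [add_im, im_ofReal_mul, exp_ofReal_mul_I_im, ofReal_im, add_zero, Real.sin_neg, abs_mul,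
      abs_neg, abs_of_pos hs]
    have h1 := h.eta_le_one
    have h2 := h.eta_pos
    have h3 := h.x_pos
    unfold sep
    have : x₀ * η / 8 ≤ x₀ := by nlinarith
    calc x₀ * η * Real.sin θ / 8 = x₀ * η / 8 * Real.sin θ := by ring
      _ ≤ |pos lam c i - pos lam c i'| * Real.sin θ := by gcongr; exact this.trans hx
  · have h1 := mul_add_le_norm_sub_of_sector (h.norm_unit i.1) (h.norm_unit i'.1)
      (h.gap i.1 i'.1 hk) (h.pos_pos i).le (h.pos_pos i').le ht ht' (abs_le_of_mem hθ)
      (abs_le_of_mem hθ)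
    have h2 := h.sep_le (θ := θ)
    have h3 := h.x_le_pos i
    have h4 := h.pos_pos i'
    have h5 := h.eta_pos
    nlinarith

/-- Rotating a cut by θ' - θ about its starting point moves the point at parameter t' by at most
t'|θ' - θ|, and t' ≤ ‖q'‖. Thus an angle inversely proportional to the distance preserves the
separation. -/
lemma sep_sub_le_norm_sub (h : RayData lam c η x₀) (hθ : θ ∈ Ioc 0 (η / 8))
    (hθ' : θ' ∈ Ioc 0 (η / 8)) {i i' : Fin n × ℕ}
    (hi : i ≠ i') {q q' : ℂ} (hq : q ∈ cut (sing lam c i) (dir lam θ i.1))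
    (hq' : q' ∈ cut (sing lam c i') (dir lam θ' i'.1)) :
    sep η x₀ θ - ‖q'‖ * |θ' - θ| ≤ ‖q - q'‖ := by
  obtain ⟨t', ht', rfl⟩ := h.mem_cut.1 hq'
  have h1 := h.sep_le_norm_sub hθ hi hq (q' := unit lam i'.1 * (pos lam c i' + t' * exp (θ * I)))
    (h.mem_cut.2 ⟨t', ht', rfl⟩)
  set q'' := unit lam i'.1 * (pos lam c i' + t' * exp (θ * I)) with hq''
  set z := unit lam i'.1 * (pos lam c i' + t' * exp (θ' * I)) with hz
  have h2 : t' ≤ ‖z‖ := by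
    rw [hz, norm_mul, h.norm_unit, one_mul]
    exact le_norm_add_mul_exp_right (h.cos_nonneg hθ') (h.pos_pos i').le
  have h3 : ‖z - q''‖ ≤ ‖z‖ * |θ' - θ| := by
    have e : z - q'' = unit lam i'.1 * (t' * (exp (θ' * I) - exp (θ * I))) := by
      rw [hz, hq'']; ring
    rw [e, norm_mul, h.norm_unit, one_mul, norm_mul, norm_real, Real.norm_of_nonneg ht']
    exact mul_le_mul h2 (norm_exp_sub_exp_le _ _) (norm_nonneg _) (norm_nonneg _)
  have h4 : ‖q - q''‖ ≤ ‖q - z‖ + ‖z - q''‖ := norm_sub_le_norm_sub_add_norm_sub _ _ _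
  linarith

lemma im_coord_of_mem_cut (h : RayData lam c η x₀) {i : Fin n × ℕ} {q : ℂ}
    (hq : q ∈ cut (sing lam c i) (dir lam θ' i.1)) :
    ((q - sing lam c i) / dir lam θ i.1).im = ‖q - sing lam c i‖ * Real.sin (θ' - θ) := by
  obtain ⟨t, ht, rfl⟩ := hq
  have e : (t : ℂ) * dir lam θ' i.1 / dir lam θ i.1 = t * exp ((θ' - θ : ℝ) * I) := by
    have h1 := h.unit_ne i.1
    rw [dir_eq, dir_eq, mul_div_assoc, mul_div_mul_left _ _ h1, ← exp_sub]
    push_cast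
    ring_nf
  rw [add_sub_cancel_left, e, im_ofReal_mul, exp_ofReal_mul_I_im, norm_mul, h.norm_dir, mul_one,
    norm_real, Real.norm_of_nonneg ht]

lemma sin_sub_mul_pos (h : RayData lam c η x₀) (hθ : θ ∈ Ioc 0 (η / 8))
    (hθ' : θ' ∈ Ioc 0 (η / 8)) (hne : θ' ≠ θ) : 0 < Real.sin (θ' - θ) * (θ' - θ) := by
  have := h.eta_le_one
  have hpi := Real.pi_gt_three
  rcases lt_or_gt_of_ne hne with hlt | hlt
  · exact mul_pos_of_neg_of_neg (Real.sin_neg_of_neg_of_neg_pi_lt (by linarith)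
      (by linarith [hθ.2, hθ'.1])) (by linarith)
  · exact mul_pos (Real.sin_pos_of_pos_of_lt_pi (by linarith) (by linarith [hθ'.2, hθ.1]))
      (by linarith)

/-- On the line of the cut, p/u has the constant imaginary part -|ω| sin θ, which is nonzero, while
along a ray from 0 this imaginary part is linear in r. -/
lemma ray_subsingleton (h : RayData lam c η x₀) (hθ : θ ∈ Ioc 0 (η / 8)) (i : Fin n × ℕ) (φ : ℝ) :
    {r : ℝ | (r * exp (φ * I) : ℂ) ∈ cut (sing lam c i) (dir lam θ i.1)}.Subsingleton := by
  have key : ∀ r : ℝ, (r * exp (φ * I) : ℂ) ∈ cut (sing lam c i) (dir lam θ i.1) →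
      r * (exp (φ * I) / dir lam θ i.1).im = -(pos lam c i * Real.sin θ) := by
    rintro r ⟨t, ht, hr⟩
    have h1 : (r : ℂ) * (exp (φ * I) / dir lam θ i.1)
        = pos lam c i * exp ((-θ : ℝ) * I) + t := by
      rw [mul_div_assoc', hr, add_div, h.sing_div_dir, mul_div_cancel_right₀ _ (h.dir_ne i.1)]
    have h2 := congrArg Complex.im h1
    rw [im_ofReal_mul, add_im, im_ofReal_mul, exp_ofReal_mul_I_im, Real.sin_neg, ofReal_im] at h2
    linarith
  intro r hr r' hr'
  have h1 := key r hr
  have h2 := key r' hr'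
  have h3 := mul_pos (h.pos_pos i) (h.sin_pos hθ)
  refine mul_right_cancel₀ (fun h0 => ?_) (h1.trans h2.symm)
  rw [h0, mul_zero] at h1
  linarith

end RayData

namespace RayData

variable {n : ℕ} {lam : Fin n → ℂ} {c : Fin n → ℝ} {η x₀ θ θ' : ℝ}

lemma mem_sheet_of_mem_halfStrip (h : RayData lam c η x₀) (hθ : θ ∈ Ioc 0 (η / 8))
    (hθ' : θ' ∈ Ioc 0 (η / 8)) {i : Fin n × ℕ} {p : ℂ}
    (hp : p ∈ halfStrip (sing lam c i) (dir lam θ i.1) (sep η x₀ θ / 4))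
    (hs : ‖p‖ * |θ' - θ| ≤ sep η x₀ θ / 4)
    (hown : p ∉ cut (sing lam c i) (dir lam θ' i.1)) : p ∈ sheet lam c θ' := by
  intro i' hi'
  rcases eq_or_ne i i' with rfl | hne
  · exact hown hi'
  · obtain ⟨q, hq, hpq⟩ := exists_mem_cut_norm_sub_le (h.norm_dir i.1) hp
    have h1 := h.sep_sub_le_norm_sub hθ hθ' hne hq hi'
    rw [norm_sub_rev] at hpq
    linarith [h.sep_pos hθ]

/-- The point lies a little behind the tip of the cut. Divided by the direction of λ, its imaginary
part b cos θ - (δ/4) sin θ is negative for such small b, whereas all cuts of that ray lie in the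
closed upper half-plane, whatever the angle. Cuts of other rays are excluded by the sectors. So 0
can be joined to this point inside every sheet at once. -/
lemma smul_mem_sheet (h : RayData lam c η x₀) (hθ : θ ∈ Ioc 0 (η / 8))
    (hθ' : θ' ∈ Ioc 0 (η / 8)) {i : Fin n × ℕ} {b s : ℝ} (hb : |b| ≤ sep η x₀ θ * Real.sin θ / 8)
    (hs : 0 ≤ s) :
    (s : ℂ) * (sing lam c i + dir lam θ i.1 * (-(sep η x₀ θ / 4 : ℝ) + b * I)) ∈ sheet lam c θ' := by
  have hδ := h.sep_pos hθ
  have hsin := h.sin_pos hθ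
  have hsin1 := Real.sin_le_one θ
  have hcos1 := Real.cos_le_one θ
  have hcos := h.cos_nonneg hθ
  set δ := sep η x₀ θ with hδdef
  set ζ : ℂ := sing lam c i + dir lam θ i.1 * (-(δ / 4 : ℝ) + b * I) with hζ
  have hζ' : ζ = unit lam i.1 * (pos lam c i + exp (θ * I) * (-(δ / 4 : ℝ) + b * I)) := by
    rw [hζ, h.sing_eq, dir_eq]; ring
  rcases hs.eq_or_lt with rfl | hs0
  · rw [ofReal_zero, zero_mul]
    exact fun i' => h.zero_notMem_cut hθ' i'
  intro i' hi'
  obtain ⟨t', ht', hq⟩ := h.mem_cut.1 hi'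
  by_cases hk : i.1 = i'.1
  · rw [hζ', ← hk, mul_left_comm] at hq
    have h1 := congrArg Complex.im (mul_left_cancel₀ (h.unit_ne i.1) hq)
    rw [im_ofReal_mul, add_im, add_im, ofReal_im, zero_add, ofReal_im, zero_add, im_ofReal_mul,
      mul_im, exp_ofReal_mul_I_im, exp_ofReal_mul_I_im, exp_ofReal_mul_I_re] at h1
    simp only [add_im, neg_im, ofReal_im, neg_zero, mul_im, ofReal_re, I_im, mul_one, I_re,
      mul_zero, add_zero, zero_add, add_re, neg_re, mul_re, sub_self] at h1
    have h2 : 0 ≤ t' * Real.sin θ' := mul_nonneg ht' (h.sin_pos hθ').le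
    have h3 : Real.cos θ * b ≤ δ * Real.sin θ / 8 := by
      refine ((mul_le_mul_of_nonneg_left (le_abs_self b) hcos).trans
        (mul_le_mul_of_nonneg_right hcos1 (abs_nonneg b))).trans ?_
      rw [one_mul]
      exact hb
    have h4 : 0 < δ * Real.sin θ := mul_pos hδ hsin
    have h5 : Real.cos θ * b + Real.sin θ * -(δ / 4) < 0 := by nlinarith
    have h6 := mul_neg_of_pos_of_neg hs0 h5
    linarith
  · have h1 := mul_add_le_norm_sub_of_sector (t := 0) (x := s * pos lam c i) (h.norm_unit i.1)
      (h.norm_unit i'.1) (h.gap i.1 i'.1 hk) (mul_nonneg hs (h.pos_pos i).le) (h.pos_pos i').le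
      le_rfl ht' (abs_le_of_mem hθ) (abs_le_of_mem hθ')
    rw [← hq, hζ'] at h1
    have e : unit lam i.1 * ((s * pos lam c i : ℝ) + (0 : ℝ) * exp (θ * I))
        - s * (unit lam i.1 * (pos lam c i + exp (θ * I) * (-(δ / 4 : ℝ) + b * I)))
        = (s : ℂ) * (unit lam i.1 * (exp (θ * I) * ((δ / 4 : ℝ) - b * I))) := by
      push_cast
      ring
    rw [e, norm_mul, norm_mul, norm_mul, h.norm_unit, norm_exp_ofReal_mul_I, one_mul, one_mul,
      norm_real, Real.norm_of_nonneg hs] at h1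
    have h2 : ‖((δ / 4 : ℝ) - b * I : ℂ)‖ ≤ δ / 4 + δ / 8 := by
      refine (norm_sub_le _ _).trans ?_
      rw [norm_mul, norm_I, mul_one, norm_real, norm_real, Real.norm_of_nonneg (by positivity),
        Real.norm_eq_abs]
      nlinarith
    have h3 := h.sep_le (θ := θ)
    have h4 := h.x_le_pos i
    have h5 := h.pos_pos i'
    have h6 := h.eta_pos
    have h7 : s * ‖((δ / 4 : ℝ) - b * I : ℂ)‖ ≤ s * (η / 8 * pos lam c i) := by
      gcongr
      nlinarith
    have h8 : 0 < η / 8 * (pos lam c i' + t') := by positivity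
    nlinarith

end RayData

/-- Here s has the sign of x and y the opposite one, so y and rs are on opposite sides of 0. -/
lemma abs_le_abs_sub_of_mul_neg {r s x y : ℝ} (hsx : 0 < s * x)
    (hxy : x * y < 0) (hr : 0 ≤ r) : |r * s| ≤ |r * s - y| := by
  have hx : 0 < x ^ 2 := by
    rcases eq_or_ne x 0 with rfl | h
    · simp at hxy
    · positivity
  have hsy : s * y ≤ 0 := by
    have h1 : x ^ 2 * (s * y) < 0 := by
      rw [show x ^ 2 * (s * y) = s * x * (x * y) by ring]
      exact mul_neg_of_pos_of_neg hsx hxy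
    exact (neg_of_mul_neg_right h1 hx.le).le
  have h2 : r * (s * y) ≤ 0 := mul_nonpos_of_nonneg_of_nonpos hr hsy
  refine sq_le_sq.1 ?_
  rw [sub_sq, mul_assoc 2 (r * s) y, mul_assoc r s y]
  linarith [sq_nonneg y]

/-! ### Rotation of the cuts: continuation and bounds up to a cut. -/

namespace AssumptionA

variable {n : ℕ} {lam : Fin n → ℂ} {c : Fin n → ℝ} {η x₀ θ θ' ν θ₀ : ℝ} {F : ℝ → ℂ → ℂ}

open RayData

/-- On one side of a cut, `F θ` coincides with the function obtained by a small rotation of the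
cuts away from this side. -/
lemma eq_of_rotate (hF : AssumptionA lam c ν θ₀ F) (h : RayData lam c η x₀)
    (hθ : θ ∈ Ioc 0 (η / 8)) (hθ' : θ' ∈ Ioc 0 (η / 8)) (hθ₀ : θ < θ₀) (hθ₀' : θ' < θ₀)
    {i : Fin n × ℕ} {p : ℂ} (hre : 0 ≤ ((p - sing lam c i) / dir lam θ i.1).re)
    (him : |((p - sing lam c i) / dir lam θ i.1).im| ≤ sep η x₀ θ * Real.sin θ / 8)
    (hside : (θ' - θ) * ((p - sing lam c i) / dir lam θ i.1).im < 0)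
    (hsmall : (‖sing lam c i‖ + ((p - sing lam c i) / dir lam θ i.1).re + sep η x₀ θ) * |θ' - θ| ≤
      sep η x₀ θ / 4) : F θ p = F θ' p := by
  have hδ := h.sep_pos hθ
  have hsin1 := Real.sin_le_one θ
  have hu := h.dir_ne (θ := θ) i.1
  set δ := sep η x₀ θ with hδdef
  set ω := sing lam c i with hω
  set u := dir lam θ i.1 with hudef
  set w := (p - ω) / u with hw
  have him4 : |w.im| ≤ δ / 4 := by nlinarith
  -- The path goes from 0 straight to ζ, slightly behind ω, and then parallel to the cut up to p, at
  -- constant distance from the cut and on the same side throughout.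
  set ζ : ℂ := ω + u * (-(δ / 4 : ℝ) + w.im * I) with hζ
  have hζw : (ζ - ω) / u = -(δ / 4 : ℝ) + w.im * I := by
    rw [hζ, add_sub_cancel_left, mul_div_cancel_left₀ _ hu]
  have hseg : ∀ z ∈ segment ℝ ζ p, ((z - ω) / u).im = w.im ∧ -(δ / 4) ≤ ((z - ω) / u).re ∧
      ((z - ω) / u).re ≤ w.re := by
    rintro z ⟨a, b, ha, hb, hab, rfl⟩
    have e : (a • ζ + b • p - ω) / u = a * ((ζ - ω) / u) + b * w := by
      have hab' : (a : ℂ) + b = 1 := by exact_mod_cast hab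
      rw [hw, mul_div_assoc', mul_div_assoc', ← add_div, real_smul, real_smul]
      congr 1
      linear_combination ω * hab'
    rw [e, hζw]
    simp only [add_im, add_re, neg_im, ofReal_im, neg_zero, mul_im, ofReal_re, I_im, mul_one, I_re, mul_zero, add_zero, zero_add, neg_re, mul_re, sub_self, zero_mul, sub_zero]
    exact ⟨by linear_combination w.im * hab, by nlinarith, by nlinarith⟩
  have hsegS : ∀ z ∈ segment ℝ ζ p, z ∈ halfStrip ω u (δ / 4) := fun z hz =>
    ⟨(hseg z hz).2.1, by rw [(hseg z hz).1]; exact him4⟩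
  have hwim : w.im ≠ 0 := fun h0 => by rw [h0, mul_zero] at hside; exact lt_irrefl _ hside
  have hne : θ' ≠ θ := fun h0 => by rw [h0, sub_self, zero_mul] at hside; exact lt_irrefl _ hside
  have hsegn : ∀ z ∈ segment ℝ ζ p, ‖z‖ ≤ ‖ω‖ + w.re + δ := by
    intro z hz
    obtain ⟨h1, h2, h3⟩ := hseg z hz
    have h4 := Complex.norm_le_abs_re_add_abs_im ((z - ω) / u)
    rw [norm_div, h.norm_dir, div_one, h1] at h4
    have h5 : ‖z‖ ≤ ‖z - ω‖ + ‖ω‖ := by simpa using norm_add_le (z - ω) ω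
    rcases abs_cases ((z - ω) / u).re with h6 | h6 <;> linarith
  have hseg1 : segment ℝ ζ p ⊆ sheet lam c θ := fun z hz =>
    h.mem_sheet_of_mem_halfStrip hθ hθ (hsegS z hz) (by rw [sub_self, abs_zero, mul_zero]; positivity)
      fun hc => hwim (by rw [← (hseg z hz).1]; exact ((mem_cut_iff hu).1 hc).2)
  -- The rotated cut from ω lies on the side opposite to p, by the sign condition; the other rotated
  -- cuts are excluded because the rotation moves them by too little at this distance.
  have hseg2 : segment ℝ ζ p ⊆ sheet lam c θ' := fun z hz => by
    refine h.mem_sheet_of_mem_halfStrip hθ hθ' (hsegS z hz) ?_ fun hc => ?_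
    · exact (mul_le_mul_of_nonneg_right (hsegn z hz) (abs_nonneg _)).trans hsmall
    · have h1 := h.im_coord_of_mem_cut (θ := θ) hc
      rw [← hω, ← hudef, (hseg z hz).1] at h1
      have h2 := h.sin_sub_mul_pos hθ hθ' hne
      have h3 := mul_nonneg (norm_nonneg (z - ω)) h2.le
      rw [h1] at hside
      nlinarith
  have hrad : ∀ ψ ∈ Ioc 0 (η / 8), segment ℝ 0 ζ ⊆ sheet lam c ψ := by
    rintro ψ hψ z ⟨a, b, ha, hb, hab, rfl⟩
    rw [smul_zero, zero_add, real_smul]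
    exact h.smul_mem_sheet hθ hψ him hb
  have hpre : IsPreconnected (segment ℝ 0 ζ ∪ segment ℝ ζ p) :=
    IsPreconnected.union ζ (right_mem_segment ℝ 0 ζ) (left_mem_segment ℝ ζ p)
      (convex_segment _ _).isPreconnected (convex_segment _ _).isPreconnected
  have han : ∀ ψ ∈ Ioc 0 (η / 8), ψ < θ₀ → segment ℝ ζ p ⊆ sheet lam c ψ →
      AnalyticOnNhd ℂ (F ψ) (segment ℝ 0 ζ ∪ segment ℝ ζ p) := fun ψ hψ hψ₀ hs =>
    ((hF.holo ψ ⟨hψ.1, hψ₀⟩).analyticOnNhd (h.isOpen_sheet hψ)).mono (union_subset (hrad ψ hψ) hs)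
  exact (han θ hθ hθ₀ hseg1).eqOn_of_preconnected_of_eventuallyEq (han θ' hθ' hθ₀' hseg2) hpre
    (Or.inl (left_mem_segment ℝ 0 ζ)) (hF.germ θ ⟨hθ.1, hθ₀⟩ θ' ⟨hθ'.1, hθ₀'⟩)
    (Or.inr (right_mem_segment ℝ ζ p))

/-- After the rotation q no longer lies on a cut, so F θ' is holomorphic in a full disk around it
and continues F θ from the side away from which the cut was turned. -/
lemma exists_ball_rotate (hF : AssumptionA lam c ν θ₀ F) (h : RayData lam c η x₀)
    (hθ : θ ∈ Ioc 0 (η / 8)) (hθ' : θ' ∈ Ioc 0 (η / 8)) (hθ₀ : θ < θ₀) (hθ₀' : θ' < θ₀)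
    (hne : θ' ≠ θ) {i : Fin n × ℕ} {q : ℂ} (hq : q ∈ cut (sing lam c i) (dir lam θ i.1))
    (hqω : q ≠ sing lam c i)
    (hsmall : (‖sing lam c i‖ + (((q - sing lam c i) / dir lam θ i.1).re + 1) + sep η x₀ θ)
      * |θ' - θ| ≤ sep η x₀ θ / 4) :
    ∃ r > 0, DifferentiableOn ℂ (F θ') (Metric.ball q r) ∧ ∀ p ∈ Metric.ball q r,
      (θ' - θ) * ((p - sing lam c i) / dir lam θ i.1).im < 0 → F θ p = F θ' p := by
  have hδ := h.sep_pos hθ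
  have hsin := h.sin_pos hθ
  have hu := h.dir_ne (θ := θ) i.1
  have hq' := (mem_cut_iff hu).1 hq
  set δ := sep η x₀ θ with hδdef
  set ω := sing lam c i with hω
  set u := dir lam θ i.1 with hudef
  have hqn : ‖q - ω‖ = ((q - ω) / u).re := by
    have h1 : (((q - ω) / u).re : ℂ) = (q - ω) / u := Complex.ext (by simp) (by simp [hq'.2])
    have h2 := congrArg norm h1
    rw [norm_real, Real.norm_of_nonneg hq'.1, norm_div, h.norm_dir, div_one] at h2
    exact h2.symm
  have hqpos : 0 < ((q - ω) / u).re := by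
    rw [← hqn]
    exact norm_pos_iff.2 (sub_ne_zero.2 hqω)
  have hqs : q ∈ sheet lam c θ' := by
    refine h.mem_sheet_of_mem_halfStrip hθ hθ' (cut_subset_halfStrip hu (by positivity) hq) ?_
      fun hc => ?_
    · refine le_trans (mul_le_mul_of_nonneg_right ?_ (abs_nonneg _)) hsmall
      have h5 : ‖q‖ ≤ ‖q - ω‖ + ‖ω‖ := by simpa using norm_add_le (q - ω) ω
      linarith
    · have h1 := h.im_coord_of_mem_cut (θ := θ) hc
      rw [← hω, ← hudef, hq'.2, hqn] at h1
      have h2 := h.sin_sub_mul_pos hθ hθ' hne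
      rcases mul_eq_zero.1 h1.symm with h3 | h3
      · exact hqpos.ne' h3
      · rw [h3, zero_mul] at h2
        exact lt_irrefl _ h2
  obtain ⟨r, hr, hball⟩ := Metric.isOpen_iff.1 (h.isOpen_sheet hθ') q hqs
  -- The bound 1 pays for the +1 in the smallness condition, the real part of the coordinate keeps
  -- the disk ahead of ω, and the last term keeps it in the strip where rotation is allowed.
  refine ⟨min r (min (min 1 ((q - ω) / u).re) (δ * Real.sin θ / 8)), by positivity,
    (hF.holo θ' ⟨hθ'.1, hθ₀'⟩).mono ((Metric.ball_subset_ball (min_le_left _ _)).trans hball),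
    fun p hp hside => ?_⟩
  rw [mem_ball_iff_norm, lt_min_iff, lt_min_iff, lt_min_iff] at hp
  obtain ⟨-, ⟨hp1, hp2⟩, hp3⟩ := hp
  have hn : ‖(p - ω) / u - (q - ω) / u‖ = ‖p - q‖ := by
    rw [← sub_div, sub_sub_sub_cancel_right, norm_div, h.norm_dir, div_one]
  have hre := (abs_re_le_norm _).trans hn.le
  have him := (abs_im_le_norm _).trans hn.le
  rw [sub_re, abs_le] at hre
  rw [sub_im, hq'.2, sub_zero] at him
  refine hF.eq_of_rotate h hθ hθ' hθ₀ hθ₀' (by linarith [hre.1]) (him.trans hp3.le) hside ?_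
  refine le_trans (mul_le_mul_of_nonneg_right ?_ (abs_nonneg _)) hsmall
  linarith [hre.2]

lemma continuesAcross (hF : AssumptionA lam c ν θ₀ F) (h : RayData lam c η x₀) {θ₁ : ℝ}
    (hθ₁ : θ₁ ≤ θ₀) (hθ₁' : θ₁ ≤ η / 8) (hθ : θ ∈ Ioo 0 θ₁) (i : Fin n × ℕ) :
    ContinuesAcross (F θ) (sing lam c i) (dir lam θ i.1) := by
  intro q hq hqω
  have hθ' : θ ∈ Ioc 0 (η / 8) := ⟨hθ.1, hθ.2.le.trans hθ₁'⟩
  have hδ := h.sep_pos hθ'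
  have hq' := (mem_cut_iff (h.dir_ne (θ := θ) i.1)).1 hq
  set L := ‖sing lam c i‖ + (((q - sing lam c i) / dir lam θ i.1).re + 1) + sep η x₀ θ with hL
  have hL0 : 0 < L := by linarith [norm_nonneg (sing lam c i), hq'.1]
  set ε := min (sep η x₀ θ / 4 / L) (min (θ / 2) ((θ₁ - θ) / 2)) with hε
  have hε0 : 0 < ε := lt_min (by positivity) (lt_min (by linarith [hθ.1]) (by linarith [hθ.2]))
  have hε1 : L * ε ≤ sep η x₀ θ / 4 := by
    have := min_le_left (sep η x₀ θ / 4 / L) (min (θ / 2) ((θ₁ - θ) / 2))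
    rw [← hε, le_div_iff₀ hL0] at this
    linarith
  have hε2 : ε ≤ θ / 2 := (min_le_right _ _).trans (min_le_left _ _)
  have hε3 : ε ≤ (θ₁ - θ) / 2 := (min_le_right _ _).trans (min_le_right _ _)
  have hθ0 := hθ.1
  have hθ1 := hθ.2
  obtain ⟨r, hr, hd, heq⟩ := hF.exists_ball_rotate h (θ' := θ - ε) hθ'
    ⟨by linarith, by linarith⟩ (by linarith) (by linarith) (by linarith) hq hqω
    (by rw [show θ - ε - θ = -ε by ring, abs_neg, abs_of_pos hε0]; exact hε1)
  obtain ⟨r', hr', hd', heq'⟩ := hF.exists_ball_rotate h (θ' := θ + ε) hθ'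
    ⟨by linarith, by linarith⟩ (by linarith) (by linarith) (by linarith) hq hqω
    (by rw [show θ + ε - θ = ε by ring, abs_of_pos hε0]; exact hε1)
  have hs := Metric.ball_subset_ball (x := q) (min_le_left r r')
  have hs' := Metric.ball_subset_ball (x := q) (min_le_right r r')
  refine ⟨min r r', lt_min hr hr', F (θ - ε), F (θ + ε), hd.mono hs, hd'.mono hs',
    fun p hp hpos => heq p (hs hp) ?_, fun p hp hneg => heq' p (hs' hp) ?_⟩
  · nlinarith
  · nlinarith

/-- For each p the cuts are rotated by an angle ε inversely proportional to the distance. The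
foreign cuts then move by a bounded amount, and the own cut moves away from p by about |p - ω| ε,
which stays bounded below. So a disk of fixed radius around p fits into the rotated sheet, and the
uniform bound on the norms of the family applies. -/
lemma exists_bound_near (hF : AssumptionA lam c ν θ₀ F) (h : RayData lam c η x₀) {θ₁ : ℝ}
    (hθ₁ : θ₁ ≤ θ₀) (hθ₁' : θ₁ ≤ η / 8) (hθ : θ ∈ Ioo 0 θ₁) (i : Fin n × ℕ) :
    ∃ C R : ℝ, ∀ p ∈ halfStrip (sing lam c i) (dir lam θ i.1) (sep η x₀ θ * Real.sin θ / 8),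
      p ∉ cut (sing lam c i) (dir lam θ i.1) → R ≤ ((p - sing lam c i) / dir lam θ i.1).re →
      ‖F θ p‖ ≤ C * Real.exp (ν * ‖p‖) := by
  have hθ' : θ ∈ Ioc 0 (η / 8) := ⟨hθ.1, hθ.2.le.trans hθ₁'⟩
  have hδ := h.sep_pos hθ'
  have hu := h.dir_ne (θ := θ) i.1
  have hsin1 := Real.sin_le_one θ
  have hsin := h.sin_pos hθ'
  have hθ0 := hθ.1
  have hθ1 := hθ.2
  have hη := h.eta_le_one
  obtain ⟨M, hM⟩ := hF.growth
  set δ := sep η x₀ θ with hδdef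
  set ω := sing lam c i with hω
  set u := dir lam θ i.1 with hudef
  -- The first bound preserves the separation from other cuts; the other two keep θ ± ε inside the
  -- admissible interval, since ε = κ/L ≤ κ/δ.
  set κ := min (δ / 4) (min (δ * (θ / 2)) (δ * ((θ₁ - θ) / 2))) with hκ
  have hκ0 : 0 < κ := lt_min (by positivity)
    (lt_min (by positivity) (mul_pos hδ (by linarith)))
  have hκ1 : κ ≤ δ / 4 := min_le_left _ _
  have hκ2 : κ ≤ δ * (θ / 2) := (min_le_right _ _).trans (min_le_left _ _)
  have hκ3 : κ ≤ δ * ((θ₁ - θ) / 2) := (min_le_right _ _).trans (min_le_right _ _)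
  -- The radius κ/16 is below the gap κ/8 opened by the rotation. The threshold ‖ω‖ + 2δ ensures L ≤
  -- 2 Re w, so that Re w · ε ≥ κ/2.
  refine ⟨6 / (κ / 16) * Real.exp (ν * (κ / 16)) * M, ‖ω‖ + 2 * δ, fun p hp hpc hpR => ?_⟩
  have hωn := norm_nonneg ω
  set w := (p - ω) / u with hw
  have hwre : 0 < w.re := by linarith
  have hwim : w.im ≠ 0 := fun h0 => hpc ((mem_cut_iff hu).2 ⟨hwre.le, h0⟩)
  have hwim' : |w.im| ≤ δ * Real.sin θ / 8 := hp.2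
  have hwim8 : |w.im| ≤ δ / 8 := by nlinarith
  have hpn : ‖p - ω‖ = ‖w‖ := by rw [hw, norm_div, h.norm_dir, div_one]
  have hpn' : ‖p‖ ≤ ‖ω‖ + w.re + δ / 8 := by
    have h4 := Complex.norm_le_abs_re_add_abs_im w
    rw [abs_of_pos hwre] at h4
    have h5 : ‖p‖ ≤ ‖p - ω‖ + ‖ω‖ := by simpa using norm_add_le (p - ω) ω
    linarith
  set L := ‖ω‖ + w.re + δ with hL
  have hL0 : 0 < L := by linarith
  set ε := κ / L with hε
  have hε0 : 0 < ε := div_pos hκ0 hL0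
  have hLε : L * ε = κ := mul_div_cancel₀ _ hL0.ne'
  have hεδ : ε ≤ κ / δ := by
    rw [hε]
    gcongr
    linarith
  have hε2 : ε ≤ θ / 2 := hεδ.trans (by rw [div_le_iff₀ hδ]; linarith)
  have hε3 : ε ≤ (θ₁ - θ) / 2 := hεδ.trans (by rw [div_le_iff₀ hδ]; linarith)
  have key : ∀ ψ : ℝ, |ψ - θ| = ε → (ψ - θ) * w.im < 0 →
      ‖F θ p‖ ≤ 6 / (κ / 16) * Real.exp (ν * (κ / 16)) * M * Real.exp (ν * ‖p‖) := by
    intro ψ hψε hside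
    have hψ := abs_le.1 hψε.le
    have hψ1 : ψ ∈ Ioc 0 (η / 8) := ⟨by linarith, by linarith⟩
    have hψ0 : ψ < θ₀ := by linarith
    have hne : ψ ≠ θ := fun h0 => by rw [h0, sub_self, abs_zero] at hψε; linarith
    rw [hF.eq_of_rotate h hθ' hψ1 (by linarith) hψ0 hwre.le hwim' hside
      (by rw [hψε]; exact hLε.le.trans hκ1)]
    refine norm_le_of_rayNorm_le hF.nu_pos.le (by positivity) (hM ψ ⟨hψ1.1, hψ0⟩)
      ((hF.holo ψ ⟨hψ1.1, hψ0⟩).mono fun z hz => ?_)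
    rw [mem_ball_iff_norm] at hz
    have hzw : ‖(z - ω) / u - w‖ = ‖z - p‖ := by
      rw [hw, ← sub_div, sub_sub_sub_cancel_right, norm_div, h.norm_dir, div_one]
    have hzre := (abs_re_le_norm _).trans hzw.le
    have hzim := (abs_im_le_norm _).trans hzw.le
    rw [sub_re, abs_le] at hzre
    rw [sub_im] at hzim
    refine h.mem_sheet_of_mem_halfStrip (i := i) hθ' hψ1 ⟨?_, ?_⟩ ?_ fun hc => ?_
    · linarith [hzre.1]
    · have := abs_sub_abs_le_abs_sub ((z - ω) / u).im w.im
      linarith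
    · rw [hψε]
      have h1 : ‖z‖ ≤ ‖z - p‖ + ‖p‖ := by simpa using norm_add_le (z - p) p
      have h2 : ‖z‖ ≤ L := by linarith
      calc ‖z‖ * ε ≤ L * ε := by gcongr
        _ ≤ δ / 4 := hLε.le.trans hκ1
    · have h1 := h.im_coord_of_mem_cut (θ := θ) hc
      rw [← hω, ← hudef] at h1
      have h2 : w.re / 2 ≤ ‖z - ω‖ := by
        have h3 : ‖p - ω‖ ≤ ‖p - z‖ + ‖z - ω‖ := norm_sub_le_norm_sub_add_norm_sub _ _ _
        have h4 := (le_abs_self _).trans (abs_re_le_norm w)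
        rw [norm_sub_rev p z, hpn] at h3
        linarith
      have h5 : ε / 2 ≤ |Real.sin (ψ - θ)| := by
        have hpi := Real.pi_gt_three
        have hpi4 := Real.pi_le_four
        have h6 := Real.mul_abs_le_abs_sin (x := ψ - θ) (by rw [hψε]; linarith)
        rw [hψε] at h6
        refine le_trans ?_ h6
        have : 1 / 2 ≤ 2 / Real.pi := by rw [div_le_div_iff₀ (by norm_num) (by linarith)]; linarith
        nlinarith
      have h7 : κ / 8 ≤ ‖z - ω‖ * |Real.sin (ψ - θ)| := by
        have h8 : κ / 2 ≤ w.re * ε := by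
          have : L * ε ≤ 2 * w.re * ε := by
            gcongr
            linarith
          linarith
        calc κ / 8 ≤ w.re / 2 * (ε / 2) := by linarith
          _ ≤ _ := by gcongr
      have hsg := h.sin_sub_mul_pos hθ' hψ1 hne
      -- A point z on the rotated cut lies across the original cut from p, at height at least κ/8,
      -- which is impossible within distance κ/16 of p.
      have h9 : |((z - ω) / u).im| ≤ |((z - ω) / u).im - w.im| := by
        rw [h1]
        exact abs_le_abs_sub_of_mul_neg hsg hside (norm_nonneg _)
      rw [h1, abs_mul, abs_of_nonneg (norm_nonneg (z - ω)), ← h1] at h9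
      linarith
  rcases lt_or_gt_of_ne hwim with hlt | hlt
  · exact key (θ + ε) (by rw [add_sub_cancel_left, abs_of_pos hε0]) (by rw [add_sub_cancel_left]; nlinarith)
  · exact key (θ - ε) (by rw [sub_sub_cancel_left, abs_neg, abs_of_pos hε0])
      (by rw [sub_sub_cancel_left]; nlinarith)

/-- For small angles, the hypotheses of the decomposition theorem hold. -/
lemma cutSystem (hF : AssumptionA lam c ν θ₀ F) (h : RayData lam c η x₀) {θ₁ μ : ℝ} {M : ℝ≥0}
    (hM : ∀ θ ∈ Ioo 0 θ₀, rayNorm ν (F θ) ≤ M)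
    (hθ₁ : θ₁ ≤ θ₀) (hθ₁' : θ₁ ≤ η / 8) (hθ : θ ∈ Ioo 0 θ₁) (hμ : ν < μ)
    (hμθ : ν < μ * Real.cos θ) :
    CutSystem (F θ) (sing lam c) (fun i => dir lam θ i.1) ν μ (Real.cos θ)
      (sep η x₀ θ * Real.sin θ / 16) M := by
  have hθ' : θ ∈ Ioc 0 (η / 8) := ⟨hθ.1, hθ.2.le.trans hθ₁'⟩
  have hθ0 : θ ∈ Ioo 0 θ₀ := ⟨hθ.1, hθ.2.trans_le hθ₁⟩
  have hδ := h.sep_pos hθ'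
  have hsin := h.sin_pos hθ'
  have hsin1 := Real.sin_le_one θ
  exact
  { norm_dir := fun i => h.norm_dir i.1
    width_pos := by positivity
    nu_pos := hF.nu_pos
    nu_lt_mu := hμ
    nu_lt := hμθ
    cos_le_one := Real.cos_le_one θ
    re_div := fun i => by
      rw [h.sing_div_dir, re_ofReal_mul, exp_ofReal_mul_I_re, Real.cos_neg, h.norm_sing, mul_comm]
    separated := fun i i' hi q hq q' hq' =>
      le_trans (by nlinarith) (h.sep_le_norm_sub hθ' hi hq hq')
    norm_le := fun i q hq => h.norm_sing_le hθ' hq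
    ray := fun i φ => h.ray_subsingleton hθ' i φ
    summable := fun b hb => h.summable hb
    holo := hF.holo θ hθ0
    frobenius := fun i => hF.frobenius θ hθ0 i
    across := fun i => hF.continuesAcross h hθ₁ hθ₁' hθ i
    -- The width is chosen so that 2d is exactly the half-width (sep · sin θ)/8 in which the cuts
    -- may be rotated.
    near := fun i => by
      have := hF.exists_bound_near h hθ₁ hθ₁' hθ i
      rwa [show 2 * (sep η x₀ θ * Real.sin θ / 16) = sep η x₀ θ * Real.sin θ / 8 by ring]
    growth := hM θ hθ0 }

/-- There are finitely many rays, so finitely many positive quantities have to be bounded below;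
distinct arguments make the differences of the unit directions nonzero. -/
lemma exists_rayData (hF : AssumptionA lam c ν θ₀ F) : ∃ η x₀, RayData lam c η x₀ := by
  have hn : ∀ k, 0 < ‖lam k‖ := fun k => norm_pos_iff.2 (hF.lam_ne k)
  have hgap : ∀ k k', k ≠ k' →
      0 < ‖lam k / (‖lam k‖ : ℂ) - lam k' / (‖lam k'‖ : ℂ)‖ := by
    intro k k' hk
    rw [norm_pos_iff, sub_ne_zero]
    intro h0
    have harg : ∀ k, arg (lam k / (‖lam k‖ : ℂ)) = arg (lam k) := fun k => by
      rw [div_eq_inv_mul, ← ofReal_inv, arg_real_mul _ (inv_pos.2 (hn k))]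
    have h1 := congrArg arg h0
    rw [harg, harg] at h1
    exact hk (hF.distinct_rays h1)
  have hlt : ∀ a : ℝ, 0 < a → ∀ᶠ x in 𝓝[>] (0 : ℝ), x ≤ a := fun a ha =>
    mem_nhdsWithin_of_mem_nhds (Iic_mem_nhds ha)
  have e1 : ∀ᶠ η in 𝓝[>] (0 : ℝ), ∀ k k', k ≠ k' →
      η ≤ ‖lam k / (‖lam k‖ : ℂ) - lam k' / (‖lam k'‖ : ℂ)‖ := by
    refine eventually_all.2 fun k => eventually_all.2 fun k' => ?_
    by_cases hk : k = k'
    · exact Eventually.of_forall fun _ hk' => absurd hk hk'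
    · filter_upwards [hlt _ (hgap k k' hk)] with η hη _ using hη
  have e2 : ∀ᶠ x in 𝓝[>] (0 : ℝ), (∀ k, x ≤ c k * ‖lam k‖) ∧ ∀ k, x ≤ ‖lam k‖ :=
    (eventually_all.2 fun k => hlt _ (mul_pos (hF.c_pos k) (hn k))).and
      (eventually_all.2 fun k => hlt _ (hn k))
  obtain ⟨η, ⟨hη1, hη2⟩, hη3⟩ := ((e1.and (hlt 1 one_pos)).and self_mem_nhdsWithin).exists
  obtain ⟨x₀, ⟨hx1, hx2⟩, hx3⟩ := (e2.and self_mem_nhdsWithin).exists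
  exact ⟨η, x₀, hF.lam_ne, hη3, hη2, hη1, hx3, hx1, hx2⟩

end AssumptionA

end Resurgence

theorem theorem20 {n : ℕ} (lam : Fin n → ℂ) (c : Fin n → ℝ) (ν θ₀ : ℝ) (F : ℝ → ℂ → ℂ)
    (hF : AssumptionA lam c ν θ₀ F) (μ : ℝ) (hμ : ν < μ) :
    ∃ ν' : ℝ, 0 < ν' ∧ ∃ θ₁ ∈ Ioc 0 θ₀, ∀ θ ∈ Ioo 0 θ₁,
    ∃ (d : ℝ) (f : Fin n × ℕ → ℂ → ℂ) (G g : ℂ → ℂ), 0 < d ∧ ν < μ * Real.cos θ ∧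
      -- the half-strips around the cuts do not intersect
      (Pairwise fun i i' => Disjoint (halfStrip (sing lam c i) (dir lam θ i.1) d)
        (halfStrip (sing lam c i') (dir lam θ i'.1) d)) ∧
      -- the `f i` are resurgent elements, given by Cauchy integrals over the Hankel contours
      (∀ i, IsElement (f i) (sing lam c i) (dir lam θ i.1)) ∧
      (∀ i, ∀ p, p ∉ halfStrip (sing lam c i) (dir lam θ i.1) d →
        f i p = hankelCauchy (F θ) (μ / dir lam θ i.1) (sing lam c i) (dir lam θ i.1) d p) ∧
      -- the `i`-th summand carries the whole singularity of `F θ` at the `i`-th singular point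
      (∀ i, ∃ h : ℂ → ℂ, AnalyticAt ℂ h (sing lam c i) ∧
        ∀ᶠ p in 𝓝 (sing lam c i), p ∉ cut (sing lam c i) (dir lam θ i.1) →
          F θ p - exp (μ / dir lam θ i.1 * p) * f i p = h p) ∧
      -- exponential `L¹` bounds for the summands, decaying geometrically along the rays
      (∃ C : ℝ, ∀ i, rayNorm ν' (fun p => exp (μ / dir lam θ i.1 * p) * f i p) ≤
        ENNReal.ofReal (C * Real.exp (-(μ * Real.cos θ - ν) * ‖sing lam c i‖))) ∧
      -- `G` is entire, of exponential type
      Differentiable ℂ G ∧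
      (∃ C : ℝ, ∀ p, ‖G p‖ ≤ C * Real.exp (ν' * ‖p‖)) ∧
      -- the decomposition in the Borel plane
      HasSumLocallyUniformlyOn (fun i p => exp (μ / dir lam θ i.1 * p) * f i p)
        (fun p => F θ p - G p) (sheet lam c θ) ∧
      -- `g` is a convergent series at infinity, and it is the Laplace transform of `G`
      (∀ x : ℂ, ν' < ‖x‖ → HasSum (fun m : ℕ => iteratedDeriv m G 0 / x ^ (m + 1)) (g x)) ∧
      -- the decomposition of the Laplace transform
      (∀ (φ : ℝ) (x : ℂ), ν' < (x * exp (φ * I)).re →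
        LaplaceConverges φ (F θ) x ∧
        LaplaceConverges φ G x ∧ laplace φ G x = g x ∧
        (∀ i, LaplaceConverges φ (f i) (x - μ / dir lam θ i.1)) ∧
        HasSum (fun i => laplace φ (f i) (x - μ / dir lam θ i.1)) (laplace φ (F θ) x - g x)) := by
  obtain ⟨η, x₀, h⟩ := hF.exists_rayData
  obtain ⟨M, hM⟩ := hF.growth
  have hμ0 : 0 < μ := hF.nu_pos.trans hμ
  have hcos : ∀ᶠ θ in 𝓝 (0 : ℝ), ν < μ * Real.cos θ := by
    have hc : ContinuousAt (fun θ : ℝ => μ * Real.cos θ) 0 := by fun_prop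
    exact hc.eventually_const_lt (by simpa using hμ)
  obtain ⟨r, hr, hball⟩ := Metric.eventually_nhds_iff_ball.1 hcos
  have hη := h.eta_pos
  have hθ₀ := hF.angle_pos
  have h1 : min θ₀ (min (η / 8) r) ≤ η / 8 := (min_le_right _ _).trans (min_le_left _ _)
  have h2 : min θ₀ (min (η / 8) r) ≤ r := (min_le_right _ _).trans (min_le_right _ _)
  -- Any ν' > μ would do: the summands and the remainder grow at most like e^{μ|p|} off the cuts'
  -- strips, and the surplus makes e^{-(ν'-μ)r} integrable. The bound r on θ₁ secures μ cos θ > ν,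
  -- and η/8 the geometry of the cuts.
  refine ⟨μ + 1, by linarith, min θ₀ (min (η / 8) r), ⟨by positivity, min_le_left _ _⟩,
    fun θ hθ => ?_⟩
  have hμθ : ν < μ * Real.cos θ := by
    refine hball θ ?_
    rw [Metric.mem_ball, Real.dist_eq, sub_zero, abs_of_pos hθ.1]
    exact hθ.2.trans_le h2
  have hS := hF.cutSystem h hM (min_le_left _ _) h1 hθ hμ hμθ
  obtain ⟨f, G, g, hdec⟩ := hS.decomposition (lt_add_one μ)
  exact ⟨_, f, G, g, hS.width_pos, hμθ, hdec⟩
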